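/- Let $K$ be a field. A *couple* $(H,M)$ consists of a Hopf algebra $H$ over $K$ (with comultiplication $\Delta$, counit $\varepsilon$ and antipode $S_H$) and an $H$-Hopf bimodule $M$, that is, an $H$-bimodule which is also an $H$-bicomodule, with coactions $\rho_l:M\to H\otimes M$, $m\mapsto\sum m_{-1}\otimes m_0$, and $\rho_r:M\to M\otimes H$, $m\mapsto \sum m_0\otimes m_1$, such that $$\rho_l(h.m.h')=\sum h_1m_{-1}h'_1\otimes h_2.m_0.h'_2,\qquad \rho_r(h.m.h')=\sum h_1.m_0.h'_1\otimes h_2m_1h'_2 .$$ The *cotensor Hopf algebra* of the couple is $\mathrm{Cot}_H(M)=H\oplus M\oplus (M\square M)\oplus (M\square M\square M)\oplus\cdots$, where $\square$ is the cotensor product over $H$. Its comultiplication is the deconcatenation (on $H$ it is $\Delta$, on $M$ it is $\rho_l+\rho_r$), its counit is $\varepsilon$ on $H$ and zero in positive degrees, and its multiplication is the unique morphism of coalgebras $\mathrm{Cot}_H(M)\otimes \mathrm{Cot}_H(M)\to\mathrm{Cot}_H(M)$ whose component in $H$ is $(x,y)\mapsto p_0(x)p_0(y)$ and whose component in $M$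 is $(x,y)\mapsto p_0(x).p_1(y)+p_1(x).p_0(y)$, where $p_0,p_1$ are the projections of $\mathrm{Cot}_H(M)$ onto $H$ and $M$. This is a graded Hopf algebra. The *quantum symmetric algebra* $S_H(M)$ is the subalgebra of $\mathrm{Cot}_H(M)$ generated by $H$ and $M$; it is a graded sub-Hopf algebra, with the induced grading. A *Hopf pairing* of two Hopf algebras $A,B$ is a bilinear map $\phi:A\times B\to K$ with $\phi(1,b)=\varepsilon(b)$, $\phi(a,1)=\varepsilon(a)$, $\phi(a,bc)=\sum\phi(a_1,b)\phi(a_2,c)$, $\phi(aa',b)=\sum\phi(a,b_1)\phi(a',b_2)$ and $\phi(S_A(a),b)=\phi(a,S_B(b))$. A bilinear map $\phi: V\times W\to K$ is *two-sided non-degenerate* if $\phi(v,\cdot)=0$ implies $v=0$ and $\phi(\cdot,w)=0$ implies $w=0$. A graded Hopf algebra $A=\bigoplus_n A_n$ is *graded self-dual* if there is a two-sided non-degenerate Hopf pairing $\phi:A\times A\to K$ with $\phi(A_i,A_j)=0$ for $i\neq j$. The couple $(H,M)$ is *self-dual* if there are a Hopf pairing $\phi_0:H\times H\to K$ and a bilinear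 map $\phi_1:M\times M\to K$, both two-sided non-degenerate, such that for all $h,g\in H$ and $m,n\in M$ $$\phi_1(h.m.g,n)=\sum\phi_0(h,n_{-1})\phi_1(m,n_0)\phi_0(g,n_1),\qquad \phi_1(m,h.n.g)=\sum\phi_0(m_{-1},h)\phi_1(m_0,n)\phi_0(m_1,g),$$ where $\sum m_{-1}\otimes m_0\otimes m_1=(\mathrm{id}_H\otimes\rho_r)\rho_l(m)$. **Corollary 3.7.** For every couple $(H,M)$, the quantum symmetric algebra $S_H(M)$ is graded self-dual if and only if the couple $(H,M)$ is self-dual. -/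

import Mathlib

set_option linter.unusedSectionVars false
set_option linter.unusedSimpArgs false
set_option linter.unusedVariables false

open scoped TensorProduct
open TensorProduct

universe w u

namespace QuantumSymmetric

section Actions

variable (K : Type*) (H : Type*) (M : Type*) [Field K] [Ring H] [Algebra K H]
  [AddCommGroup M] [Module K M] [Module H M] [Module Hᵐᵒᵖ M]
  [IsScalarTower K H M] [IsScalarTower K Hᵐᵒᵖ M]

/-- The left action `h ⊗ m ↦ h.m` as a `K`-bilinear map. -/
noncomputable def lact : H →ₗ[K] M →ₗ[K] M :=
  LinearMap.mk₂ K (fun h m => h • m) (fun _ _ _ => add_smul _ _ _) (fun _ _ _ => smul_assoc _ _ _)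
    (fun _ _ _ => smul_add _ _ _) (fun c h m => smul_algebra_smul_comm c h m)

/-- The right action `m ⊗ h ↦ m.h` as a `K`-bilinear map. -/
noncomputable def ract : M →ₗ[K] H →ₗ[K] M :=
  LinearMap.mk₂ K (fun m h => MulOpposite.op h • m) (fun _ _ _ => smul_add _ _ _)
    (fun c m h => smul_algebra_smul_comm c (MulOpposite.op h) m)
    (fun _ _ _ => by rw [MulOpposite.op_add, add_smul])
    (fun _ _ _ => by rw [MulOpposite.op_smul, smul_assoc])

@[simp] theorem lact_apply (h : H) (m : M) : lact K H M h m = h • m := rfl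

@[simp] theorem ract_apply (m : M) (h : H) : ract K H M m h = MulOpposite.op h • m := rfl

end Actions

/-- An `H`-Hopf bimodule: an `H`-bimodule `M` (the right action of `h` is `MulOpposite.op h • m`)
which is an `H`-bicomodule, with structure maps `coactL` and `coactR`, such that both
structure maps are morphisms of `H`-bimodules, where `H` acts diagonally on `H ⊗ M` and `M ⊗ H`.
The pair `(H, M)` is a couple. -/
class HopfBimodule (K : Type*) (H : Type*) (M : Type*) [Field K] [Ring H] [HopfAlgebra K H]
    [AddCommGroup M] [Module K M] [Module H M] [Module Hᵐᵒᵖ M] [IsScalarTower K H M]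
    [IsScalarTower K Hᵐᵒᵖ M] [SMulCommClass H Hᵐᵒᵖ M] where
  coactL : M →ₗ[K] H ⊗[K] M
  coactR : M →ₗ[K] M ⊗[K] H
  coactL_coassoc : ∀ m, TensorProduct.assoc K H H M (Coalgebra.comul.rTensor M (coactL m)) =
    coactL.lTensor H (coactL m)
  coactL_counit : ∀ m, TensorProduct.lid K M (Coalgebra.counit.rTensor M (coactL m)) = m
  coactR_coassoc : ∀ m, TensorProduct.assoc K M H H (coactR.rTensor H (coactR m)) =
    Coalgebra.comul.lTensor M (coactR m)
  coactR_counit : ∀ m, TensorProduct.rid K M (Coalgebra.counit.lTensor M (coactR m)) = m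
  coact_comm : ∀ m, TensorProduct.assoc K H M H (coactL.rTensor H (coactR m)) =
    coactR.lTensor H (coactL m)
  coactL_smul : ∀ (h : H) (m : M), coactL (h • m) =
    TensorProduct.map₂ (LinearMap.mul K H) (lact K H M) (Coalgebra.comul h) (coactL m)
  coactL_op_smul : ∀ (h : H) (m : M), coactL (MulOpposite.op h • m) =
    TensorProduct.map₂ (LinearMap.mul K H) (ract K H M) (coactL m) (Coalgebra.comul h)
  coactR_smul : ∀ (h : H) (m : M), coactR (h • m) =
    TensorProduct.map₂ (lact K H M) (LinearMap.mul K H) (Coalgebra.comul h) (coactR m)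
  coactR_op_smul : ∀ (h : H) (m : M), coactR (MulOpposite.op h • m) =
    TensorProduct.map₂ (ract K H M) (LinearMap.mul K H) (coactR m) (Coalgebra.comul h)

section LinearAlgebra

variable {K V W X Z : Type*} [Field K] [AddCommGroup V] [Module K V] [AddCommGroup W] [Module K W]
  [AddCommGroup X] [Module K X] [AddCommGroup Z] [Module K Z]

/-- A map into `Z ⊗ V` killed by `Z ⊗ f` takes values in `Z ⊗ ker f`. -/
noncomputable def liftKer (f : V →ₗ[K] W) (g : X →ₗ[K] Z ⊗[K] V)
    (h : ∀ x, f.lTensor Z (g x) = 0) : X →ₗ[K] Z ⊗[K] (LinearMap.ker f) :=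
  (LinearEquiv.ofInjective ((LinearMap.ker f).subtype.lTensor Z)
    (Module.Flat.lTensor_preserves_injective_linearMap _ (Submodule.injective_subtype _))).symm.toLinearMap ∘ₗ
  g.codRestrict _ (fun x => ((Module.Flat.lTensor_exact Z (f := (LinearMap.ker f).subtype) (g := f)
    (LinearMap.exact_subtype_ker_map f)) (g x)).1 (h x))

theorem subtype_liftKer (f : V →ₗ[K] W) (g : X →ₗ[K] Z ⊗[K] V)
    (h : ∀ x, f.lTensor Z (g x) = 0) (x : X) :
    (LinearMap.ker f).subtype.lTensor Z (liftKer f g h x) = g x := by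
  have := LinearEquiv.apply_symm_apply (LinearEquiv.ofInjective ((LinearMap.ker f).subtype.lTensor Z)
    (Module.Flat.lTensor_preserves_injective_linearMap _ (Submodule.injective_subtype _)))
    (g.codRestrict _ (fun x => ((Module.Flat.lTensor_exact Z (f := (LinearMap.ker f).subtype) (g := f)
    (LinearMap.exact_subtype_ker_map f)) (g x)).1 (h x)) x)
  exact congrArg Subtype.val this

end LinearAlgebra

/-- Left comodules over `H`. -/
structure LComod (K : Type w) (H : Type u) [Field K] [Ring H] [HopfAlgebra K H] where
  carrier : Type u
  [grp : AddCommGroup carrier]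
  [mod : Module K carrier]
  coact : carrier →ₗ[K] H ⊗[K] carrier
  coassoc : ∀ x, TensorProduct.assoc K H H carrier (Coalgebra.comul.rTensor carrier (coact x)) =
    coact.lTensor H (coact x)
  counit : ∀ x, TensorProduct.lid K carrier (Coalgebra.counit.rTensor carrier (coact x)) = x

attribute [instance] LComod.grp LComod.mod

section Cotensor

variable {K : Type w} {H M : Type u} [Field K] [Ring H] [HopfAlgebra K H]
  [AddCommGroup M] [Module K M] [Module H M] [Module Hᵐᵒᵖ M]
  [IsScalarTower K H M] [IsScalarTower K Hᵐᵒᵖ M] [SMulCommClass H Hᵐᵒᵖ M]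
  [HopfBimodule K H M]

open HopfBimodule

variable (M) in
/-- The difference of the two maps `M ⊗ N → M ⊗ H ⊗ N` whose equalizer is `M □ N`. -/
noncomputable def cotensorMap {N : Type*} [AddCommGroup N] [Module K N] (r : N →ₗ[K] H ⊗[K] N) :
    M ⊗[K] N →ₗ[K] M ⊗[K] (H ⊗[K] N) :=
  (TensorProduct.assoc K M H N).toLinearMap ∘ₗ (coactR (K := K) (H := H) (M := M)).rTensor N -
    r.lTensor M

variable (M) in
/-- The cotensor product `M □ N`, a subspace of `M ⊗ N`. -/
noncomputable abbrev cotensor {N : Type*} [AddCommGroup N] [Module K N] (r : N →ₗ[K] H ⊗[K] N) :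
    Submodule K (M ⊗[K] N) :=
  LinearMap.ker (cotensorMap M r)

theorem lTensor_cotensorMap {N : Type*} [AddCommGroup N] [Module K N] (r : N →ₗ[K] H ⊗[K] N)
    (x : M ⊗[K] N) :
    (cotensorMap M r).lTensor H (TensorProduct.assoc K H M N
        ((coactL (K := K) (H := H) (M := M)).rTensor N x)) =
      TensorProduct.assoc K H M (H ⊗[K] N)
        ((coactL (K := K) (H := H) (M := M)).rTensor (H ⊗[K] N) (cotensorMap M r x)) := by
  induction x with
  | zero => simp only [LinearMap.map_zero, LinearEquiv.map_zero, zero_tmul, tmul_zero, smul_zero, LinearMap.zero_apply]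
  | add x y hx hy => simp only [LinearMap.map_add, LinearEquiv.map_add, hx, hy]
  | tmul m n =>
    have key := congrArg (((TensorProduct.assoc K M H N).toLinearMap ∘ₗ
      (TensorProduct.mk K (M ⊗[K] H) N).flip n).lTensor H) (coact_comm (K := K) (H := H) m)
    have h1 : ∀ z : H ⊗[K] M, ((TensorProduct.assoc K M H N).toLinearMap ∘ₗ
        (coactR (K := K) (H := H) (M := M)).rTensor N).lTensor H
          (TensorProduct.assoc K H M N (z ⊗ₜ n)) =
        ((TensorProduct.assoc K M H N).toLinearMap ∘ₗ
      (TensorProduct.mk K (M ⊗[K] H) N).flip n).lTensor H (coactR.lTensor H z) := by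
      intro z
      induction z with
      | zero => simp only [LinearMap.map_zero, LinearEquiv.map_zero, zero_tmul, tmul_zero, smul_zero, LinearMap.zero_apply]
      | add x y hx hy => simp only [LinearMap.map_add, LinearEquiv.map_add, hx, hy, add_tmul]
      | tmul a b => simp
    have h2 : ∀ z : M ⊗[K] H, ((TensorProduct.assoc K M H N).toLinearMap ∘ₗ
      (TensorProduct.mk K (M ⊗[K] H) N).flip n).lTensor H (TensorProduct.assoc K H M H
        (coactL.rTensor H z)) = TensorProduct.assoc K H M (H ⊗[K] N)
        ((coactL (K := K) (H := H) (M := M)).rTensor (H ⊗[K] N)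
          (TensorProduct.assoc K M H N (z ⊗ₜ n))) := by
      intro z
      induction z with
      | zero => simp only [LinearMap.map_zero, LinearEquiv.map_zero, zero_tmul, tmul_zero, smul_zero, LinearMap.zero_apply]
      | add x y hx hy => simp only [LinearMap.map_add, LinearEquiv.map_add, hx, hy, add_tmul]
      | tmul a b =>
        simp only [LinearMap.rTensor_tmul, assoc_tmul]
        induction coactL (K := K) (H := H) a with
        | zero => simp only [LinearMap.map_zero, LinearEquiv.map_zero, zero_tmul, tmul_zero, smul_zero, LinearMap.zero_apply]
        | add x y hx hy => simp only [LinearMap.map_add, LinearEquiv.map_add, hx, hy, add_tmul]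
        | tmul a b => simp
    have h3 : ∀ z : H ⊗[K] M, (r.lTensor M).lTensor H (TensorProduct.assoc K H M N (z ⊗ₜ n)) =
        TensorProduct.assoc K H M (H ⊗[K] N) (z ⊗ₜ r n) := by
      intro z
      induction z with
      | zero => simp only [LinearMap.map_zero, LinearEquiv.map_zero, zero_tmul, tmul_zero, smul_zero, LinearMap.zero_apply]
      | add x y hx hy => simp only [LinearMap.map_add, LinearEquiv.map_add, hx, hy, add_tmul]
      | tmul a b => simp
    rw [h2, ← h1] at key
    simp only [cotensorMap, LinearMap.lTensor_sub, LinearMap.sub_apply, LinearMap.rTensor_tmul,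
      h3, map_sub, LinearMap.lTensor_tmul]
    rw [← key]
    rfl

theorem rTensor_coactL_coassoc {N : Type*} [AddCommGroup N] [Module K N] (x : M ⊗[K] N) :
    TensorProduct.assoc K H H (M ⊗[K] N) (Coalgebra.comul.rTensor (M ⊗[K] N)
      (TensorProduct.assoc K H M N ((coactL (K := K) (H := H) (M := M)).rTensor N x))) =
    ((TensorProduct.assoc K H M N).toLinearMap ∘ₗ (coactL (K := K) (H := H) (M := M)).rTensor N).lTensor H
      (TensorProduct.assoc K H M N ((coactL (K := K) (H := H) (M := M)).rTensor N x)) := by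
  induction x with
  | zero => simp only [LinearMap.map_zero, LinearEquiv.map_zero, zero_tmul, tmul_zero, smul_zero, LinearMap.zero_apply]
  | add x y hx hy => simp only [LinearMap.map_add, LinearEquiv.map_add, hx, hy]
  | tmul m n =>
    have key := congrArg (((TensorProduct.assoc K H M N).toLinearMap ∘ₗ
      (TensorProduct.mk K (H ⊗[K] M) N).flip n).lTensor H) (coactL_coassoc (K := K) (H := H) m)
    simp only [LinearMap.rTensor_tmul]
    have h1 : ∀ z : H ⊗[K] M, (((TensorProduct.assoc K H M N).toLinearMap ∘ₗ
      (TensorProduct.mk K (H ⊗[K] M) N).flip n).lTensor H) (TensorProduct.assoc K H H M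
        (Coalgebra.comul.rTensor M z)) = TensorProduct.assoc K H H (M ⊗[K] N)
        (Coalgebra.comul.rTensor (M ⊗[K] N) (TensorProduct.assoc K H M N (z ⊗ₜ n))) := by
      intro z
      induction z with
      | zero => simp only [LinearMap.map_zero, LinearEquiv.map_zero, zero_tmul, tmul_zero, smul_zero, LinearMap.zero_apply]
      | add x y hx hy => simp only [LinearMap.map_add, LinearEquiv.map_add, hx, hy, add_tmul]
      | tmul a b =>
        simp only [LinearMap.rTensor_tmul, assoc_tmul]
        induction Coalgebra.comul (R := K) a with
        | zero => simp only [LinearMap.map_zero, LinearEquiv.map_zero, zero_tmul, tmul_zero, smul_zero, LinearMap.zero_apply]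
        | add x y hx hy => simp only [LinearMap.map_add, LinearEquiv.map_add, hx, hy, add_tmul]
        | tmul a b => simp
    have h2 : ∀ z : H ⊗[K] M, (((TensorProduct.assoc K H M N).toLinearMap ∘ₗ
      (TensorProduct.mk K (H ⊗[K] M) N).flip n).lTensor H) (coactL.lTensor H z) =
      ((TensorProduct.assoc K H M N).toLinearMap ∘ₗ (coactL (K := K) (H := H) (M := M)).rTensor N).lTensor H
        (TensorProduct.assoc K H M N (z ⊗ₜ n)) := by
      intro z
      induction z with
      | zero => simp only [LinearMap.map_zero, LinearEquiv.map_zero, zero_tmul, tmul_zero, smul_zero, LinearMap.zero_apply]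
      | add x y hx hy => simp only [LinearMap.map_add, LinearEquiv.map_add, hx, hy, add_tmul]
      | tmul a b => simp
    rw [← h1, key, h2]

theorem rTensor_coactL_counit {N : Type*} [AddCommGroup N] [Module K N] (x : M ⊗[K] N) :
    TensorProduct.lid K (M ⊗[K] N) (Coalgebra.counit.rTensor (M ⊗[K] N)
      (TensorProduct.assoc K H M N ((coactL (K := K) (H := H) (M := M)).rTensor N x))) = x := by
  induction x with
  | zero => simp only [LinearMap.map_zero, LinearEquiv.map_zero, zero_tmul, tmul_zero, smul_zero, LinearMap.zero_apply]
  | add x y hx hy => simp only [LinearMap.map_add, LinearEquiv.map_add, hx, hy]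
  | tmul m n =>
    have h1 : ∀ z : H ⊗[K] M, TensorProduct.lid K (M ⊗[K] N)
        (Coalgebra.counit.rTensor (M ⊗[K] N) (TensorProduct.assoc K H M N (z ⊗ₜ n))) =
        (TensorProduct.lid K M (Coalgebra.counit.rTensor M z)) ⊗ₜ n := by
      intro z
      induction z with
      | zero => simp only [LinearMap.map_zero, LinearEquiv.map_zero, zero_tmul, tmul_zero, smul_zero, LinearMap.zero_apply]
      | add x y hx hy => simp only [LinearMap.map_add, LinearEquiv.map_add, hx, hy, add_tmul]
      | tmul a b => simp [smul_tmul']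
    simp only [LinearMap.rTensor_tmul]
    rw [h1, coactL_counit]

/-- The left coaction on `M □ N`, induced by the left coaction of `M`. -/
noncomputable def cotensorCoact {N : Type*} [AddCommGroup N] [Module K N] (r : N →ₗ[K] H ⊗[K] N) :
    cotensor M r →ₗ[K] H ⊗[K] cotensor M r :=
  liftKer (cotensorMap M r)
    ((TensorProduct.assoc K H M N).toLinearMap ∘ₗ
      (coactL (K := K) (H := H) (M := M)).rTensor N ∘ₗ (cotensor M r).subtype)
    (fun x => by
      have := lTensor_cotensorMap (M := M) r x.1
      rw [LinearMap.mem_ker.1 x.2] at this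
      simpa using this)

theorem subtype_cotensorCoact {N : Type*} [AddCommGroup N] [Module K N] (r : N →ₗ[K] H ⊗[K] N)
    (x : cotensor M r) :
    (cotensor M r).subtype.lTensor H (cotensorCoact r x) =
      TensorProduct.assoc K H M N ((coactL (K := K) (H := H) (M := M)).rTensor N x.1) :=
  subtype_liftKer _ _ _ x

variable (M) in
/-- The cotensor product `M □ N` as a left comodule. -/
noncomputable def cotensorComod (N : LComod K H) : LComod K H where
  carrier := cotensor M N.coact
  coact := cotensorCoact N.coact
  coassoc x := by
    apply Module.Flat.lTensor_preserves_injective_linearMap (M := H) _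
      (Module.Flat.lTensor_preserves_injective_linearMap (M := H) _
        (Submodule.injective_subtype (cotensor M N.coact)))
    have h := rTensor_coactL_coassoc (K := K) (H := H) x.1
    rw [← subtype_cotensorCoact] at h
    have h1 : ∀ z : H ⊗[K] cotensor M N.coact,
      ((cotensor M N.coact).subtype.lTensor H).lTensor H (TensorProduct.assoc K H H _
        (Coalgebra.comul.rTensor _ z)) = TensorProduct.assoc K H H _ (Coalgebra.comul.rTensor _
          ((cotensor M N.coact).subtype.lTensor H z)) := by
      intro z
      induction z with
      | zero => simp only [LinearMap.map_zero, LinearEquiv.map_zero, zero_tmul, tmul_zero, smul_zero, LinearMap.zero_apply]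
      | add x y hx hy => simp only [LinearMap.map_add, LinearEquiv.map_add, hx, hy]
      | tmul a b =>
        simp only [LinearMap.rTensor_tmul, LinearMap.lTensor_tmul]
        induction Coalgebra.comul (R := K) a with
        | zero => simp only [LinearMap.map_zero, LinearEquiv.map_zero, zero_tmul, tmul_zero, smul_zero, LinearMap.zero_apply]
        | add x y hx hy => simp only [LinearMap.map_add, LinearEquiv.map_add, hx, hy, add_tmul]
        | tmul a b => simp
    have h2 : ∀ z : H ⊗[K] cotensor M N.coact,
      ((cotensor M N.coact).subtype.lTensor H).lTensor H ((cotensorCoact N.coact).lTensor H z) =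
       ((TensorProduct.assoc K H M N.carrier).toLinearMap ∘ₗ
        (coactL (K := K) (H := H) (M := M)).rTensor N.carrier).lTensor H
          ((cotensor M N.coact).subtype.lTensor H z) := by
      intro z
      induction z with
      | zero => simp only [LinearMap.map_zero, LinearEquiv.map_zero, zero_tmul, tmul_zero, smul_zero, LinearMap.zero_apply]
      | add x y hx hy => simp only [LinearMap.map_add, LinearEquiv.map_add, hx, hy]
      | tmul a b =>
        simp only [LinearMap.lTensor_tmul, subtype_cotensorCoact]
        rfl
    rw [h1, h2, h]
  counit x := by
    apply Submodule.injective_subtype (cotensor M N.coact)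
    have h := rTensor_coactL_counit (K := K) (H := H) x.1
    rw [← subtype_cotensorCoact] at h
    have h1 : ∀ z : H ⊗[K] cotensor M N.coact,
      (cotensor M N.coact).subtype (TensorProduct.lid K _ (Coalgebra.counit.rTensor _ z)) =
      TensorProduct.lid K _ (Coalgebra.counit.rTensor _ ((cotensor M N.coact).subtype.lTensor H z)) := by
      intro z
      induction z with
      | zero => simp only [LinearMap.map_zero, LinearEquiv.map_zero, zero_tmul, tmul_zero, smul_zero, LinearMap.zero_apply]
      | add x y hx hy => simp only [LinearMap.map_add, LinearEquiv.map_add, hx, hy]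
      | tmul a b => simp
    rw [h1, h]
    rfl

end Cotensor

section Cot

variable (K : Type w) (H M : Type u) [Field K] [Ring H] [HopfAlgebra K H]
  [AddCommGroup M] [Module K M] [Module H M] [Module Hᵐᵒᵖ M]
  [IsScalarTower K H M] [IsScalarTower K Hᵐᵒᵖ M] [SMulCommClass H Hᵐᵒᵖ M]
  [HopfBimodule K H M]

open HopfBimodule

/-- The `n`-fold cotensor power of `M` over `H`, with its left coaction: `H` for `n = 0`, `M` for
`n = 1`, and `M □ (M □ (⋯ □ M))`, a subspace of `M ⊗ (M ⊗ (⋯ ⊗ M))`, for larger `n`. -/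
noncomputable def cotPow : ℕ → LComod K H
  | 0 => { carrier := H
           coact := Coalgebra.comul
           coassoc := Coalgebra.coassoc_apply
           counit := fun x => by simp }
  | 1 => { carrier := M
           coact := coactL
           coassoc := coactL_coassoc
           counit := coactL_counit }
  | n + 2 => cotensorComod M (cotPow (n + 1))

/-- Splitting off the first tensor factor, `M^{□ (n+1)} → M ⊗ M^{□ n}`; this is the inclusion
for `n > 0` and the right coaction of `M` for `n = 0`. -/
noncomputable def split : (n : ℕ) → (cotPow K H M (n + 1)).carrier →ₗ[K] M ⊗[K] (cotPow K H M n).carrier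
  | 0 => coactR (K := K) (H := H) (M := M)
  | n + 1 => (cotensor M (cotPow K H M (n + 1)).coact).subtype

variable {K H M}

theorem split_coact (n : ℕ) (x : (cotPow K H M (n + 1)).carrier) :
    (split K H M n).lTensor H ((cotPow K H M (n + 1)).coact x) =
      TensorProduct.assoc K H M _ ((coactL (K := K) (H := H) (M := M)).rTensor _ (split K H M n x)) := by
  cases n with
  | zero => exact (coact_comm (K := K) (H := H) (M := M) x).symm
  | succ n => exact subtype_cotensorCoact _ x

theorem cotensorMap_split (n : ℕ) (x : (cotPow K H M (n + 1)).carrier) :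
    cotensorMap M (cotPow K H M n).coact (split K H M n x) = 0 := by
  cases n with
  | zero => exact sub_eq_zero.2 (coactR_coassoc (K := K) (H := H) (M := M) x)
  | succ n => exact x.2

theorem split_injective (n : ℕ) : Function.Injective (split K H M n) := by
  cases n with
  | zero =>
    intro x y h
    have := congrArg (fun z : M ⊗[K] H => TensorProduct.rid K M (Coalgebra.counit.lTensor M z)) h
    exact ((coactR_counit (K := K) (H := H) (M := M) x).symm.trans this).trans
      (coactR_counit (K := K) (H := H) (M := M) y)
  | succ n => exact Submodule.injective_subtype _

theorem exists_coactR_eq (x : M ⊗[K] H) (hx : cotensorMap M (Coalgebra.comul (R := K) (A := H)) x = 0) :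
    ∃ y : M, coactR (K := K) (H := H) y = x := by
  refine ⟨TensorProduct.rid K M (Coalgebra.counit.lTensor M x), ?_⟩
  have h1 : ∀ z : M ⊗[K] H, (TensorProduct.rid K H).toLinearMap.lTensor M
     ((Coalgebra.counit.lTensor H).lTensor M
      (TensorProduct.assoc K M H H ((coactR (K := K) (H := H) (M := M)).rTensor H z))) =
      coactR (TensorProduct.rid K M (Coalgebra.counit.lTensor M z)) := by
    intro z
    induction z with
    | zero => simp only [LinearMap.map_zero, LinearEquiv.map_zero, zero_tmul, tmul_zero, smul_zero, LinearMap.zero_apply]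
    | add x y hx hy => simp only [LinearMap.map_add, LinearEquiv.map_add, hx, hy]
    | tmul a b =>
      simp only [LinearMap.rTensor_tmul, LinearMap.lTensor_tmul, rid_tmul, map_smul]
      induction coactR (K := K) (H := H) a with
      | zero => simp only [LinearMap.map_zero, LinearEquiv.map_zero, zero_tmul, tmul_zero, smul_zero, LinearMap.zero_apply]
      | add x y hx hy => simp only [LinearMap.map_add, LinearEquiv.map_add, hx, hy, add_tmul, smul_add]
      | tmul a b => simp
  have h2 : ∀ z : M ⊗[K] H, (TensorProduct.rid K H).toLinearMap.lTensor M
     ((Coalgebra.counit.lTensor H).lTensor M ((Coalgebra.comul (R := K)).lTensor M z)) = z := by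
    intro z
    induction z with
    | zero => simp only [LinearMap.map_zero, LinearEquiv.map_zero, zero_tmul, tmul_zero, smul_zero, LinearMap.zero_apply]
    | add x y hx hy => simp only [LinearMap.map_add, LinearEquiv.map_add, hx, hy]
    | tmul a b => simp
  refine (h1 x).symm.trans ?_
  have h3 : TensorProduct.assoc K M H H ((coactR (K := K) (H := H) (M := M)).rTensor H x) =
    (Coalgebra.comul (R := K)).lTensor M x := sub_eq_zero.1 hx
  rw [h3]
  exact h2 x

theorem exists_split_eq (n : ℕ) (x : M ⊗[K] (cotPow K H M n).carrier)
    (hx : cotensorMap M (cotPow K H M n).coact x = 0) : ∃ y, split K H M n y = x := by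
  cases n with
  | zero =>
    exact exists_coactR_eq (K := K) (H := H) (M := M) x hx
  | succ n => exact ⟨⟨x, hx⟩, rfl⟩

theorem exists_retraction (n : ℕ) :
    ∃ p : M ⊗[K] (cotPow K H M n).carrier →ₗ[K] (cotPow K H M (n + 1)).carrier,
      p ∘ₗ split K H M n = LinearMap.id :=
  LinearMap.exists_leftInverse_of_injective _ (LinearMap.ker_eq_bot.2 (split_injective n))

variable (K H M) in
/-- A linear retraction of the injection `split`. Only its values on the image of `split` matter
for the structure maps below, and these do not depend on the choice. -/
noncomputable def retr (n : ℕ) :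
    M ⊗[K] (cotPow K H M n).carrier →ₗ[K] (cotPow K H M (n + 1)).carrier :=
  (exists_retraction n).choose

@[simp] theorem retr_split (n : ℕ) (x : (cotPow K H M (n + 1)).carrier) :
    retr K H M n (split K H M n x) = x :=
  LinearMap.congr_fun (exists_retraction n).choose_spec x

theorem exists_error (n : ℕ) :
    ∃ g : M ⊗[K] (H ⊗[K] (cotPow K H M n).carrier) →ₗ[K] M ⊗[K] (cotPow K H M n).carrier,
      ∀ x, x - split K H M n (retr K H M n x) = g (cotensorMap M (cotPow K H M n).coact x) := by
  set θ := cotensorMap M (cotPow K H M n).coact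
  obtain ⟨s, hs⟩ := θ.rangeRestrict.exists_rightInverse_of_surjective θ.range_rangeRestrict
  set d : M ⊗[K] (cotPow K H M n).carrier →ₗ[K] M ⊗[K] (cotPow K H M n).carrier :=
    LinearMap.id - split K H M n ∘ₗ retr K H M n
  obtain ⟨g, hg⟩ := LinearMap.exists_extend (d ∘ₗ s)
  refine ⟨g, fun x => ?_⟩
  have h1 : g (θ x) = d (s (θ.rangeRestrict x)) := LinearMap.congr_fun hg (θ.rangeRestrict x)
  have h2 : θ (s (θ.rangeRestrict x)) = θ x :=
    congrArg Subtype.val (LinearMap.congr_fun hs (θ.rangeRestrict x))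
  obtain ⟨y, hy⟩ := exists_split_eq n (x - s (θ.rangeRestrict x))
    (by rw [map_sub]; exact sub_eq_zero.2 h2.symm)
  have h3 : d (x - s (θ.rangeRestrict x)) = 0 := by
    rw [← hy]; simp [d]
  rw [map_sub, sub_eq_zero] at h3
  rw [h1, ← h3]
  rfl

variable (K H M) in
/-- Auxiliary map, measuring how far an element of `M ⊗ M^{□ n}` is from the cotensor product. -/
noncomputable def err (n : ℕ) :
    M ⊗[K] (H ⊗[K] (cotPow K H M n).carrier) →ₗ[K] M ⊗[K] (cotPow K H M n).carrier :=
  (exists_error n).choose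

theorem err_spec (n : ℕ) (x : M ⊗[K] (cotPow K H M n).carrier) :
    x - split K H M n (retr K H M n x) = err K H M n (cotensorMap M (cotPow K H M n).coact x) :=
  (exists_error n).choose_spec x

variable (K H M) in
/-- The space `H ⊕ M ⊕ (M □ M) ⊕ ⋯` underlying the cotensor Hopf algebra. -/
def Cot : Type u := DirectSum ℕ (fun n => (cotPow K H M n).carrier)

noncomputable instance : AddCommGroup (Cot K H M) :=
  inferInstanceAs (AddCommGroup (DirectSum ℕ (fun n => (cotPow K H M n).carrier)))

noncomputable instance : Module K (Cot K H M) :=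
  inferInstanceAs (Module K (DirectSum ℕ (fun n => (cotPow K H M n).carrier)))

namespace Cot

variable (K H M) in
/-- The inclusion of the component of degree `n`. -/
noncomputable def of (n : ℕ) : (cotPow K H M n).carrier →ₗ[K] Cot K H M :=
  DirectSum.lof K ℕ (fun n => (cotPow K H M n).carrier) n

variable (K H M) in
/-- The projection onto the component of degree `n`. -/
noncomputable def comp (n : ℕ) : Cot K H M →ₗ[K] (cotPow K H M n).carrier :=
  DirectSum.component K ℕ (fun n => (cotPow K H M n).carrier) n

/-- A linear map on the direct sum given by its components. -/
noncomputable def desc {V : Type*} [AddCommGroup V] [Module K V]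
    (f : ∀ n, (cotPow K H M n).carrier →ₗ[K] V) : Cot K H M →ₗ[K] V :=
  DirectSum.toModule K ℕ V f

@[simp] theorem desc_of {V : Type*} [AddCommGroup V] [Module K V]
    (f : ∀ n, (cotPow K H M n).carrier →ₗ[K] V) (n : ℕ) (x : (cotPow K H M n).carrier) :
    desc f (of K H M n x) = f n x :=
  DirectSum.toModule_lof K (M := fun n => (cotPow K H M n).carrier) (φ := f) n x

@[simp] theorem comp_of_self (n : ℕ) (x : (cotPow K H M n).carrier) :
    comp K H M n (of K H M n x) = x :=
  DirectSum.component.lof_self K (M := fun n => (cotPow K H M n).carrier) n x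

theorem comp_of_ne {m n : ℕ} (h : m ≠ n) (x : (cotPow K H M m).carrier) :
    comp K H M n (of K H M m x) = 0 := by
  have := DirectSum.component.of K (M := fun n => (cotPow K H M n).carrier) n m x
  rw [dif_neg h] at this
  exact this

theorem induction_on {p : Cot K H M → Prop} (x : Cot K H M) (h0 : p 0)
    (hof : ∀ n x, p (of K H M n x)) (hadd : ∀ x y, p x → p y → p (x + y)) : p x :=
  DirectSum.induction_on x h0 hof hadd

variable (K H M) in
/-- The left coaction of `H`. -/
noncomputable def rho : Cot K H M →ₗ[K] H ⊗[K] Cot K H M :=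
  desc fun n => (of K H M n).lTensor H ∘ₗ (cotPow K H M n).coact

variable (K H M) in
/-- Splitting off the first factor from `M`. -/
noncomputable def tau : Cot K H M →ₗ[K] M ⊗[K] Cot K H M :=
  desc fun n => match n with
    | 0 => 0
    | n + 1 => (of K H M n).lTensor M ∘ₗ split K H M n

variable (K H M) in
/-- Putting a factor from `M` in front, after projecting to the cotensor product. -/
noncomputable def kap : M ⊗[K] Cot K H M →ₗ[K] Cot K H M :=
  TensorProduct.lift (LinearMap.flip (desc fun n =>
    (TensorProduct.curry (of K H M (n + 1) ∘ₗ retr K H M n)).flip))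

variable (K H M) in
/-- The projection to `H`. -/
noncomputable def p0 : Cot K H M →ₗ[K] H := comp K H M 0

variable (K H M) in
/-- The inclusion of `H`. -/
noncomputable def i0 : H →ₗ[K] Cot K H M := of K H M 0

variable (K H M) in
/-- The inclusion of `M`. -/
noncomputable def i1 : M →ₗ[K] Cot K H M := of K H M 1

@[simp] theorem rho_of (n : ℕ) (x : (cotPow K H M n).carrier) :
    rho K H M (of K H M n x) = (of K H M n).lTensor H ((cotPow K H M n).coact x) := by
  simp [rho]

@[simp] theorem tau_of_zero (x : (cotPow K H M 0).carrier) : tau K H M (of K H M 0 x) = 0 := by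
  simp [tau]

@[simp] theorem tau_i0 (x : H) : tau K H M (i0 K H M x) = 0 := tau_of_zero x

@[simp] theorem tau_of_succ (n : ℕ) (x : (cotPow K H M (n + 1)).carrier) :
    tau K H M (of K H M (n + 1) x) = (of K H M n).lTensor M (split K H M n x) := by
  simp [tau]

@[simp] theorem kap_of (n : ℕ) (x : M ⊗[K] (cotPow K H M n).carrier) :
    kap K H M ((of K H M n).lTensor M x) = of K H M (n + 1) (retr K H M n x) := by
  induction x with
  | zero => simp only [LinearMap.map_zero, LinearEquiv.map_zero, zero_tmul, tmul_zero, smul_zero, LinearMap.zero_apply]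
  | add x y hx hy => simp only [LinearMap.map_add, LinearEquiv.map_add, hx, hy]
  | tmul a b => simp [kap]

@[simp] theorem p0_i0 (h : H) : p0 K H M (i0 K H M h) = h := comp_of_self 0 h

theorem p0_of_succ (n : ℕ) (x : (cotPow K H M (n + 1)).carrier) :
    p0 K H M (of K H M (n + 1) x) = 0 := comp_of_ne (by omega) x

theorem tensor_induction {V : Type*} [AddCommGroup V] [Module K V] {p : V ⊗[K] Cot K H M → Prop}
    (x : V ⊗[K] Cot K H M) (h0 : p 0)
    (hof : ∀ n x, p ((of K H M n).lTensor V x)) (hadd : ∀ x y, p x → p y → p (x + y)) : p x := by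
  induction x with
  | zero => exact h0
  | add x y hx hy => exact hadd _ _ hx hy
  | tmul v x =>
    induction x using induction_on with
    | h0 => simpa using h0
    | hof n x => exact hof n (v ⊗ₜ x)
    | hadd x y hx hy => rw [tmul_add]; exact hadd _ _ hx hy

@[simp] theorem p0_kap (x : M ⊗[K] Cot K H M) : p0 K H M (kap K H M x) = 0 := by
  induction x using tensor_induction with
  | h0 => simp
  | hof n x => rw [kap_of, p0_of_succ]
  | hadd x y hx hy => rw [map_add, map_add, hx, hy, add_zero]

theorem i0_p0_add_kap_tau (x : Cot K H M) : i0 K H M (p0 K H M x) + kap K H M (tau K H M x) = x := by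
  induction x using induction_on with
  | h0 => simp
  | hof n x =>
    cases n with
    | zero => rw [tau_of_zero, map_zero, add_zero]; exact congrArg (i0 K H M) (p0_i0 (K := K) (H := H) (M := M) x)
    | succ n => simp [p0_of_succ]
  | hadd x y hx hy =>
    simp only [map_add]; nth_rw 3 [← hx]; nth_rw 3 [← hy]; abel

variable (K H M) in
/-- The maps `err` on the direct sum. -/
noncomputable def errX : M ⊗[K] (H ⊗[K] Cot K H M) →ₗ[K] M ⊗[K] Cot K H M :=
  (TensorProduct.lift (LinearMap.flip (desc fun n =>
    (TensorProduct.curry ((of K H M n).lTensor M ∘ₗ err K H M n ∘ₗ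
      (TensorProduct.assoc K M H _).toLinearMap)).flip))) ∘ₗ (TensorProduct.assoc K M H _).symm.toLinearMap

theorem errX_of (n : ℕ) (x : M ⊗[K] (H ⊗[K] (cotPow K H M n).carrier)) :
    errX K H M (((of K H M n).lTensor H).lTensor M x) = (of K H M n).lTensor M (err K H M n x) := by
  induction x with
  | zero => simp only [LinearMap.map_zero, LinearEquiv.map_zero, zero_tmul, tmul_zero, smul_zero, LinearMap.zero_apply]
  | add x y hx hy => simp only [LinearMap.map_add, LinearEquiv.map_add, hx, hy]
  | tmul a b =>
    induction b with
    | zero => simp only [LinearMap.map_zero, LinearEquiv.map_zero, zero_tmul, tmul_zero, smul_zero, LinearMap.zero_apply]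
    | add x y hx hy => simp only [tmul_add, LinearMap.map_add, LinearEquiv.map_add, hx, hy]
    | tmul b c => simp [errX]

theorem cotensorMap_of (n : ℕ) (x : M ⊗[K] (cotPow K H M n).carrier) :
    cotensorMap M (rho K H M) ((of K H M n).lTensor M x) =
      ((of K H M n).lTensor H).lTensor M (cotensorMap M (cotPow K H M n).coact x) := by
  induction x with
  | zero => simp only [LinearMap.map_zero, LinearEquiv.map_zero, zero_tmul, tmul_zero, smul_zero, LinearMap.zero_apply]
  | add x y hx hy => simp only [LinearMap.map_add, LinearEquiv.map_add, hx, hy]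
  | tmul a b =>
    simp only [cotensorMap, LinearMap.sub_apply, LinearMap.comp_apply, LinearMap.rTensor_tmul,
      LinearMap.lTensor_tmul, rho_of, map_sub, LinearEquiv.coe_coe]
    congr 1
    induction coactR (K := K) (H := H) a with
    | zero => simp only [LinearMap.map_zero, LinearEquiv.map_zero, zero_tmul, tmul_zero, smul_zero, LinearMap.zero_apply]
    | add x y hx hy => simp only [LinearMap.map_add, LinearEquiv.map_add, hx, hy, add_tmul]
    | tmul a b => simp

theorem sub_tau_kap (x : M ⊗[K] Cot K H M) :
    x - tau K H M (kap K H M x) = errX K H M (cotensorMap M (rho K H M) x) := by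
  induction x using tensor_induction with
  | h0 => simp
  | hof n x => rw [kap_of, tau_of_succ, cotensorMap_of, errX_of, ← map_sub, err_spec]
  | hadd x y hx hy => simp only [map_add, ← hx, ← hy]; abel

/-- The left coaction is coassociative. -/
theorem rho_coassoc (x : Cot K H M) :
    TensorProduct.assoc K H H _ (Coalgebra.comul.rTensor _ (rho K H M x)) =
      (rho K H M).lTensor H (rho K H M x) := by
  induction x using induction_on with
  | h0 => simp
  | hadd x y hx hy => simp only [map_add, hx, hy]
  | hof n x =>
    have h := congrArg (((of K H M n).lTensor H).lTensor H) ((cotPow K H M n).coassoc x)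
    rw [rho_of]
    have h1 : ∀ z, ((of K H M n).lTensor H).lTensor H (TensorProduct.assoc K H H _
        (Coalgebra.comul.rTensor _ z)) = TensorProduct.assoc K H H _ (Coalgebra.comul.rTensor _
          ((of K H M n).lTensor H z)) := by
      intro z
      induction z with
      | zero => simp only [LinearMap.map_zero, LinearEquiv.map_zero, zero_tmul, tmul_zero, smul_zero, LinearMap.zero_apply]
      | add x y hx hy => simp only [LinearMap.map_add, LinearEquiv.map_add, hx, hy]
      | tmul a b =>
        simp only [LinearMap.rTensor_tmul, LinearMap.lTensor_tmul]
        induction Coalgebra.comul (R := K) a with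
        | zero => simp only [LinearMap.map_zero, LinearEquiv.map_zero, zero_tmul, tmul_zero, smul_zero, LinearMap.zero_apply]
        | add x y hx hy => simp only [LinearMap.map_add, LinearEquiv.map_add, hx, hy, add_tmul]
        | tmul a b => simp
    have h2 : ∀ z, ((of K H M n).lTensor H).lTensor H ((cotPow K H M n).coact.lTensor H z) =
        (rho K H M).lTensor H ((of K H M n).lTensor H z) := by
      intro z
      induction z with
      | zero => simp only [LinearMap.map_zero, LinearEquiv.map_zero, zero_tmul, tmul_zero, smul_zero, LinearMap.zero_apply]
      | add x y hx hy => simp only [LinearMap.map_add, LinearEquiv.map_add, hx, hy]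
      | tmul a b => simp
    rw [← h1, ← h2, h]

theorem rho_counit (x : Cot K H M) :
    TensorProduct.lid K _ (Coalgebra.counit.rTensor _ (rho K H M x)) = x := by
  induction x using induction_on with
  | h0 => simp
  | hadd x y hx hy => simp only [map_add, hx, hy]
  | hof n x =>
    have h := congrArg (of K H M n) ((cotPow K H M n).counit x)
    rw [rho_of]
    have h1 : ∀ z, of K H M n (TensorProduct.lid K _ (Coalgebra.counit.rTensor _ z)) =
        TensorProduct.lid K _ (Coalgebra.counit.rTensor _ ((of K H M n).lTensor H z)) := by
      intro z
      induction z with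
      | zero => simp only [LinearMap.map_zero, LinearEquiv.map_zero, zero_tmul, tmul_zero, smul_zero, LinearMap.zero_apply]
      | add x y hx hy => simp only [LinearMap.map_add, LinearEquiv.map_add, hx, hy]
      | tmul a b => simp
    rw [← h1, h]

theorem tau_rho (x : Cot K H M) :
    (tau K H M).lTensor H (rho K H M x) = TensorProduct.assoc K H M _
      ((coactL (K := K) (H := H) (M := M)).rTensor _ (tau K H M x)) := by
  induction x using induction_on with
  | h0 => simp
  | hadd x y hx hy => simp only [map_add, hx, hy]
  | hof n x =>
    rw [rho_of]
    cases n with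
    | zero =>
      rw [tau_of_zero, map_zero, map_zero]
      induction (cotPow K H M 0).coact x with
      | zero => simp only [LinearMap.map_zero, LinearEquiv.map_zero, zero_tmul, tmul_zero, smul_zero, LinearMap.zero_apply]
      | add x y hx hy => simp only [LinearMap.map_add, LinearEquiv.map_add, hx, hy, add_zero]
      | tmul a b => simp
    | succ n =>
      rw [tau_of_succ]
      have h := congrArg (((of K H M n).lTensor M).lTensor H) (split_coact n x)
      have h1 : ∀ z, ((of K H M n).lTensor M).lTensor H ((split K H M n).lTensor H z) =
          (tau K H M).lTensor H ((of K H M (n + 1)).lTensor H z) := by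
        intro z
        induction z with
        | zero => simp only [LinearMap.map_zero, LinearEquiv.map_zero, zero_tmul, tmul_zero, smul_zero, LinearMap.zero_apply]
        | add x y hx hy => simp only [LinearMap.map_add, LinearEquiv.map_add, hx, hy]
        | tmul a b => simp
      have h2 : ∀ z, ((of K H M n).lTensor M).lTensor H (TensorProduct.assoc K H M _
          ((coactL (K := K) (H := H) (M := M)).rTensor _ z)) = TensorProduct.assoc K H M _
          ((coactL (K := K) (H := H) (M := M)).rTensor _ ((of K H M n).lTensor M z)) := by
        intro z
        induction z with
        | zero => simp only [LinearMap.map_zero, LinearEquiv.map_zero, zero_tmul, tmul_zero, smul_zero, LinearMap.zero_apply]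
        | add x y hx hy => simp only [LinearMap.map_add, LinearEquiv.map_add, hx, hy]
        | tmul a b =>
          simp only [LinearMap.rTensor_tmul, LinearMap.lTensor_tmul]
          induction coactL (K := K) (H := H) a with
          | zero => simp only [LinearMap.map_zero, LinearEquiv.map_zero, zero_tmul, tmul_zero, smul_zero, LinearMap.zero_apply]
          | add x y hx hy => simp only [LinearMap.map_add, LinearEquiv.map_add, hx, hy, add_tmul]
          | tmul a b => simp
      rw [← h1, ← h2, h]

theorem cotensorMap_tau (x : Cot K H M) : cotensorMap M (rho K H M) (tau K H M x) = 0 := by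
  induction x using induction_on with
  | h0 => simp
  | hadd x y hx hy => simp only [map_add, hx, hy, add_zero]
  | hof n x =>
    cases n with
    | zero => simp
    | succ n => rw [tau_of_succ, cotensorMap_of, cotensorMap_split, map_zero]

theorem p0_rho (x : Cot K H M) :
    (p0 K H M).lTensor H (rho K H M x) = Coalgebra.comul (p0 K H M x) := by
  induction x using induction_on with
  | h0 => simp
  | hadd x y hx hy => simp only [map_add, hx, hy]
  | hof n x =>
    rw [rho_of]
    cases n with
    | zero =>
      have h1 : ∀ z : H ⊗[K] H, (p0 K H M).lTensor H ((i0 K H M).lTensor H z) = z := by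
        intro z
        induction z with
        | zero => simp only [LinearMap.map_zero, LinearEquiv.map_zero, zero_tmul, tmul_zero, smul_zero, LinearMap.zero_apply]
        | add x y hx hy => simp only [LinearMap.map_add, LinearEquiv.map_add, hx, hy]
        | tmul a b => simp
      refine (h1 _).trans ?_
      exact congrArg (Coalgebra.comul (R := K) (A := H)) (p0_i0 (K := K) (H := H) (M := M) x).symm
    | succ n =>
      rw [p0_of_succ, map_zero]
      induction (cotPow K H M (n + 1)).coact x with
      | zero => simp only [LinearMap.map_zero, LinearEquiv.map_zero, zero_tmul, tmul_zero, smul_zero, LinearMap.zero_apply]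
      | add x y hx hy => simp only [LinearMap.map_add, LinearEquiv.map_add, hx, hy, add_zero]
      | tmul a b => simp [p0_of_succ]

end Cot
end Cot

section Filtered

variable {K : Type*} [Field K] {A V W : Type*} [AddCommGroup A] [Module K A]
  [AddCommGroup V] [Module K V] [AddCommGroup W] [Module K W]

/-- The subspace `A ⊗ U` of `A ⊗ V`. -/
def tens (K A : Type*) [Field K] [AddCommGroup A] [Module K A] {V : Type*} [AddCommGroup V]
    [Module K V] (U : Submodule K V) : Submodule K (A ⊗[K] V) :=
  LinearMap.range (U.subtype.lTensor A)

theorem tens_congr {U : Submodule K V} {f g : V →ₗ[K] W} (h : ∀ x ∈ U, f x = g x)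
    {x : A ⊗[K] V} (hx : x ∈ tens K A U) : f.lTensor A x = g.lTensor A x := by
  obtain ⟨y, rfl⟩ := hx
  have : f ∘ₗ U.subtype = g ∘ₗ U.subtype := by ext y; exact h _ y.2
  rw [← LinearMap.comp_apply, ← LinearMap.comp_apply, ← LinearMap.lTensor_comp,
    ← LinearMap.lTensor_comp, this]

theorem tens_mono {U U' : Submodule K V} (h : U ≤ U') : tens K A U ≤ tens K A U' := by
  rintro _ ⟨y, rfl⟩
  refine ⟨(Submodule.inclusion h).lTensor A y, ?_⟩
  rw [← LinearMap.comp_apply, ← LinearMap.lTensor_comp]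
  rfl

theorem tens_map {U : Submodule K V} {U' : Submodule K W} {f : V →ₗ[K] W}
    (h : ∀ x ∈ U, f x ∈ U') {x : A ⊗[K] V} (hx : x ∈ tens K A U) :
    f.lTensor A x ∈ tens K A U' := by
  obtain ⟨y, rfl⟩ := hx
  refine ⟨(f.restrict h).lTensor A y, ?_⟩
  rw [← LinearMap.comp_apply, ← LinearMap.comp_apply, ← LinearMap.lTensor_comp,
    ← LinearMap.lTensor_comp]
  rfl

theorem tmul_mem_tens {U : Submodule K V} (a : A) {v : V} (hv : v ∈ U) : a ⊗ₜ v ∈ tens K A U :=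
  ⟨a ⊗ₜ ⟨v, hv⟩, rfl⟩

theorem tens_induction {U : Submodule K V} {p : A ⊗[K] V → Prop} {x : A ⊗[K] V}
    (hx : x ∈ tens K A U) (h0 : p 0) (ht : ∀ a, ∀ v ∈ U, p (a ⊗ₜ v))
    (hadd : ∀ x y, p x → p y → p (x + y)) : p x := by
  obtain ⟨y, rfl⟩ := hx
  induction y with
  | zero => simpa using h0
  | add x y hx hy => rw [map_add]; exact hadd _ _ hx hy
  | tmul a v => exact ht a _ v.2

theorem exists_limit (fil : ℕ → Submodule K V) (mono : Monotone fil) (exh : ∀ x, ∃ n, x ∈ fil n)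
    (G : ℕ → V →ₗ[K] W) (stab : ∀ n, ∀ x ∈ fil n, G (n + 1) x = G n x) :
    ∃ L : V →ₗ[K] W, ∀ n, ∀ x ∈ fil n, L x = G n x := by
  have h : ∀ n k, ∀ x ∈ fil n, G (n + k) x = G n x := by
    intro n k
    induction k with
    | zero => intro x _; rfl
    | succ k ih => intro x hx; rw [← add_assoc, stab _ _ (mono (Nat.le_add_right n k) hx), ih x hx]
  have h' : ∀ m n, ∀ x ∈ fil m, x ∈ fil n → G m x = G n x := by
    intro m n x hm hn
    rw [← h m n x hm, ← h n m x hn, add_comm]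
  choose N hN using exh
  refine ⟨{ toFun := fun x => G (N x) x, map_add' := ?_, map_smul' := ?_ }, fun n x hx =>
    h' _ _ x (hN x) hx⟩
  · intro x y
    have hx := mono (le_max_left (N x) (N y)) (hN x)
    have hy := mono (le_max_right (N x) (N y)) (hN y)
    rw [h' _ _ _ (hN (x + y)) (add_mem hx hy), h' _ _ _ (hN x) hx, h' _ _ _ (hN y) hy, map_add]
  · intro c x
    rw [h' _ _ _ (hN (c • x)) (Submodule.smul_mem _ c (hN x)), map_smul]
    rfl

end Filtered

section Ext

variable {K : Type*} [Field K] {A V : Type*} [AddCommGroup A] [Module K A]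
  [AddCommGroup V] [Module K V]

/-- The map `V ⊗ Z → A ⊗ V ⊗ Z` induced by a map `V → A ⊗ V`. -/
noncomputable def ext (α : V →ₗ[K] A ⊗[K] V) (Z : Type*) [AddCommGroup Z] [Module K Z] :
    V ⊗[K] Z →ₗ[K] A ⊗[K] (V ⊗[K] Z) :=
  (TensorProduct.assoc K A V Z).toLinearMap ∘ₗ α.rTensor Z

theorem ext_tmul (α : V →ₗ[K] A ⊗[K] V) {Z : Type*} [AddCommGroup Z] [Module K Z] (v : V) (z : Z) :
    ext α Z (v ⊗ₜ z) = ((TensorProduct.mk K V Z).flip z).lTensor A (α v) := by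
  simp only [ext, LinearMap.comp_apply, LinearMap.rTensor_tmul]
  induction α v with
  | zero => simp only [LinearMap.map_zero, LinearEquiv.map_zero, zero_tmul, tmul_zero, smul_zero, LinearMap.zero_apply]
  | add x y hx hy => simp only [add_tmul, LinearMap.map_add, LinearEquiv.map_add, hx, hy]
  | tmul a b => simp

end Ext

section Universal

variable {K : Type w} {H M : Type u} [Field K] [Ring H] [HopfAlgebra K H]
  [AddCommGroup M] [Module K M] [Module H M] [Module Hᵐᵒᵖ M]
  [IsScalarTower K H M] [IsScalarTower K Hᵐᵒᵖ M] [SMulCommClass H Hᵐᵒᵖ M]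
  [HopfBimodule K H M]

open HopfBimodule Cot

variable (M) in
/-- Left comodules over `H` with a map `V → M ⊗ V` compatible with the coactions, and with a
filtration along which this map is nilpotent. -/
structure IsCompat {V : Type*} [AddCommGroup V] [Module K V] (r : V →ₗ[K] H ⊗[K] V)
    (t : V →ₗ[K] M ⊗[K] V) (fil : ℕ → Submodule K V) : Prop where
  coassoc : ∀ x, TensorProduct.assoc K H H V (Coalgebra.comul.rTensor V (r x)) = r.lTensor H (r x)
  left : ∀ x, t.lTensor H (r x) =
    TensorProduct.assoc K H M V ((coactL (K := K) (H := H) (M := M)).rTensor V (t x))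
  right : ∀ x, cotensorMap M r (t x) = 0
  mono : Monotone fil
  exh : ∀ x, ∃ n, x ∈ fil n
  r_mem : ∀ n, ∀ x ∈ fil n, r x ∈ tens K H (fil n)
  t_zero : ∀ x ∈ fil 0, t x = 0
  t_mem : ∀ n, ∀ x ∈ fil (n + 1), t x ∈ tens K M (fil n)

theorem decomp {V : Type*} [AddCommGroup V] [Module K V] (v : Cot K H M ⊗[K] V) :
    (i0 K H M).rTensor V ((p0 K H M).rTensor V v) +
      (kap K H M).rTensor V ((TensorProduct.assoc K M _ V).symm (ext (tau K H M) V v)) = v := by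
  induction v with
  | zero => simp
  | add x y hx hy =>
    simp only [map_add]; nth_rw 3 [← hx]; nth_rw 3 [← hy]; abel
  | tmul x v =>
    simp only [ext, LinearMap.comp_apply, LinearEquiv.coe_coe, LinearEquiv.symm_apply_apply,
      LinearMap.rTensor_tmul]
    rw [← add_tmul, i0_p0_add_kap_tau]

theorem ext_inj {B V : Type*} [AddCommGroup V] [Module K V] [AddCommGroup B] [Module K B]
    {v w : B ⊗[K] (Cot K H M ⊗[K] V)}
    (h0 : ((p0 K H M).rTensor V).lTensor B v = ((p0 K H M).rTensor V).lTensor B w)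
    (h1 : (ext (tau K H M) V).lTensor B v = (ext (tau K H M) V).lTensor B w) : v = w := by
  have h : ∀ v : B ⊗[K] (Cot K H M ⊗[K] V), v =
      ((i0 K H M).rTensor V).lTensor B (((p0 K H M).rTensor V).lTensor B v) +
      ((kap K H M).rTensor V).lTensor B ((TensorProduct.assoc K M _ V).symm.toLinearMap.lTensor B
        ((ext (tau K H M) V).lTensor B v)) := by
    intro v
    induction v with
    | zero => simp
    | add x y hx hy =>
      simp only [map_add]; nth_rw 1 [hx]; nth_rw 1 [hy]; abel
    | tmul b v =>
      simp only [LinearMap.lTensor_tmul]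
      rw [← tmul_add]
      exact congrArg _ (decomp v).symm
  rw [h v, h w, h0, h1]

theorem ext_tau_kap {V : Type*} [AddCommGroup V] [Module K V] (y : M ⊗[K] (Cot K H M ⊗[K] V))
    (hy : cotensorMap M (ext (rho K H M) V) y = 0) :
    ext (tau K H M) V ((kap K H M).rTensor V ((TensorProduct.assoc K M _ V).symm y)) = y := by
  have h : ∀ y : M ⊗[K] (Cot K H M ⊗[K] V), y - ext (tau K H M) V ((kap K H M).rTensor V
      ((TensorProduct.assoc K M _ V).symm y)) = TensorProduct.assoc K M _ V
        ((errX K H M).rTensor V ((TensorProduct.assoc K M _ V).symm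
          ((TensorProduct.assoc K H _ V).symm.toLinearMap.lTensor M
            (cotensorMap M (ext (rho K H M) V) y)))) := by
    intro y
    induction y with
    | zero => simp
    | add x y hx hy => simp only [LinearMap.map_add, LinearEquiv.map_add, ← hx, ← hy]; abel
    | tmul m z =>
      induction z with
      | zero => simp
      | add x y hx hy => simp only [LinearMap.map_add, LinearEquiv.map_add, tmul_add, ← hx, ← hy]; abel
      | tmul x v =>
        have h1 : TensorProduct.assoc K M _ V (((m ⊗ₜ[K] x) - tau K H M (kap K H M (m ⊗ₜ x))) ⊗ₜ v) =
          (m ⊗ₜ[K] (x ⊗ₜ[K] v)) - ext (tau K H M) V ((kap K H M).rTensor V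
            ((TensorProduct.assoc K M _ V).symm (m ⊗ₜ[K] (x ⊗ₜ[K] v)))) := by
          simp [ext, sub_tmul]
        have h2 : ((TensorProduct.assoc K M _ V).symm ((TensorProduct.assoc K H _ V).symm.toLinearMap.lTensor M
            (cotensorMap M (ext (rho K H M) V) (m ⊗ₜ[K] (x ⊗ₜ[K] v))))) =
            (cotensorMap M (rho K H M) (m ⊗ₜ x)) ⊗ₜ v := by
          simp only [cotensorMap, LinearMap.sub_apply, LinearMap.comp_apply, LinearMap.rTensor_tmul,
            LinearMap.lTensor_tmul, map_sub, LinearEquiv.coe_coe, sub_tmul, ext,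
            LinearEquiv.symm_apply_apply]
          congr 1
          induction coactR (K := K) (H := H) m with
          | zero => simp only [LinearMap.map_zero, LinearEquiv.map_zero, zero_tmul, tmul_zero, smul_zero, LinearMap.zero_apply]
          | add x y hx hy => simp only [LinearMap.map_add, LinearEquiv.map_add, hx, hy, add_tmul]
          | tmul a b => simp
        rw [← h1, h2, sub_tau_kap, LinearMap.rTensor_tmul]
  have := h y
  rw [hy] at this
  simp only [map_zero] at this
  exact (sub_eq_zero.1 this).symm

theorem ext_tau_i0 {V : Type*} [AddCommGroup V] [Module K V] (z : H ⊗[K] V) :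
    ext (tau K H M) V ((i0 K H M).rTensor V z) = 0 := by
  induction z with
  | zero => simp only [LinearMap.map_zero, LinearEquiv.map_zero, zero_tmul, tmul_zero, smul_zero, LinearMap.zero_apply]
  | add x y hx hy => simp only [LinearMap.map_add, LinearEquiv.map_add, hx, hy, add_zero]
  | tmul a b => simp [ext]

/-- The coaction of the cotensor coalgebra induced by compatible maps `V → H ⊗ V`, `V → M ⊗ V`. -/
theorem exists_coaction {V : Type*} [AddCommGroup V] [Module K V] {r : V →ₗ[K] H ⊗[K] V}
    {t : V →ₗ[K] M ⊗[K] V} {fil : ℕ → Submodule K V} (hV : IsCompat M r t fil) :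
    ∃ l : V →ₗ[K] Cot K H M ⊗[K] V, (∀ x, (p0 K H M).rTensor V (l x) = r x) ∧
      (∀ x, ext (rho K H M) V (l x) = l.lTensor H (r x)) ∧
      (∀ x, ext (tau K H M) V (l x) = l.lTensor M (t x)) ∧
      (∀ n, ∀ x ∈ fil n, l x ∈ tens K (Cot K H M) (fil n)) := by
  let step : (V →ₗ[K] Cot K H M ⊗[K] V) → (V →ₗ[K] Cot K H M ⊗[K] V) := fun g =>
    (i0 K H M).rTensor V ∘ₗ r +
      (kap K H M).rTensor V ∘ₗ (TensorProduct.assoc K M _ V).symm.toLinearMap ∘ₗ g.lTensor M ∘ₗ t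
  have hstep : ∀ g x, step g x = (i0 K H M).rTensor V (r x) + (kap K H M).rTensor V
    ((TensorProduct.assoc K M _ V).symm (g.lTensor M (t x))) := fun g x => rfl
  let G : ℕ → (V →ₗ[K] Cot K H M ⊗[K] V) := fun n => step^[n] ((i0 K H M).rTensor V ∘ₗ r)
  have hG : ∀ n, G (n + 1) = step (G n) := fun n => Function.iterate_succ_apply' _ _ _
  have stab : ∀ n, ∀ x ∈ fil n, G (n + 1) x = G n x := by
    intro n
    induction n with
    | zero =>
      intro x hx
      rw [hG, hstep, hV.t_zero x hx]
      simp [G]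
    | succ n ih =>
      intro x hx
      rw [hG (n + 1), hstep, tens_congr ih (hV.t_mem n x hx), ← hstep, ← hG]
  obtain ⟨l, hl⟩ := exists_limit fil hV.mono hV.exh G stab
  have fix : ∀ x, l x = (i0 K H M).rTensor V (r x) + (kap K H M).rTensor V
      ((TensorProduct.assoc K M _ V).symm (l.lTensor M (t x))) := by
    intro x
    obtain ⟨n, hn⟩ := hV.exh x
    have hn' := hV.mono (Nat.le_succ n) hn
    rw [hl (n + 1) x hn', hG, hstep, tens_congr (hl n) (hV.t_mem n x hn')]
  have P : ∀ x, (p0 K H M).rTensor V (l x) = r x := by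
    intro x
    have h1 : ∀ z : H ⊗[K] V, (p0 K H M).rTensor V ((i0 K H M).rTensor V z) = z := by
      intro z
      induction z with
      | zero => simp only [LinearMap.map_zero, LinearEquiv.map_zero, zero_tmul, tmul_zero, smul_zero, LinearMap.zero_apply]
      | add x y hx hy => simp only [LinearMap.map_add, LinearEquiv.map_add, hx, hy]
      | tmul a b => simp
    have h2 : ∀ z : (M ⊗[K] Cot K H M) ⊗[K] V,
        (p0 K H M).rTensor V ((kap K H M).rTensor V z) = 0 := by
      intro z
      induction z with
      | zero => simp only [LinearMap.map_zero, LinearEquiv.map_zero, zero_tmul, tmul_zero, smul_zero, LinearMap.zero_apply]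
      | add x y hx hy => simp only [LinearMap.map_add, LinearEquiv.map_add, hx, hy, add_zero]
      | tmul a b => simp
    rw [fix, map_add, h1, h2, add_zero]
  have L_of_T : ∀ n, (∀ x ∈ fil n, ext (tau K H M) V (l x) = l.lTensor M (t x)) →
      ∀ x ∈ fil n, ext (rho K H M) V (l x) = l.lTensor H (r x) := by
    intro n T x hx
    apply ext_inj
    · have h1 : ∀ z : Cot K H M ⊗[K] V, ((p0 K H M).rTensor V).lTensor H (ext (rho K H M) V z) =
          TensorProduct.assoc K H H V (Coalgebra.comul.rTensor V ((p0 K H M).rTensor V z)) := by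
        intro z
        induction z with
        | zero => simp only [LinearMap.map_zero, LinearEquiv.map_zero, zero_tmul, tmul_zero, smul_zero, LinearMap.zero_apply]
        | add x y hx hy => simp only [LinearMap.map_add, LinearEquiv.map_add, hx, hy]
        | tmul a b =>
          simp only [LinearMap.rTensor_tmul, ← p0_rho, ext_tmul]
          induction rho K H M a with
          | zero => simp only [LinearMap.map_zero, LinearEquiv.map_zero, zero_tmul, tmul_zero, smul_zero, LinearMap.zero_apply]
          | add x y hx hy => simp only [LinearMap.map_add, LinearEquiv.map_add, hx, hy, add_tmul]
          | tmul a b => simp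
      have h2 : (p0 K H M).rTensor V ∘ₗ l = r := LinearMap.ext P
      rw [h1, P, hV.coassoc, ← LinearMap.lTensor_comp_apply, h2]
    · have h1 : ∀ z : Cot K H M ⊗[K] V, (ext (tau K H M) V).lTensor H (ext (rho K H M) V z) =
          TensorProduct.assoc K H M _ ((coactL (K := K) (H := H) (M := M)).rTensor _
            (ext (tau K H M) V z)) := by
        intro z
        induction z with
        | zero => simp only [LinearMap.map_zero, LinearEquiv.map_zero, zero_tmul, tmul_zero, smul_zero, LinearMap.zero_apply]
        | add x y hx hy => simp only [LinearMap.map_add, LinearEquiv.map_add, hx, hy]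
        | tmul x v =>
          have h3 : ∀ z : H ⊗[K] Cot K H M, (ext (tau K H M) V).lTensor H
              (((TensorProduct.mk K _ V).flip v).lTensor H z) =
              (((TensorProduct.mk K _ V).flip v).lTensor M).lTensor H ((tau K H M).lTensor H z) := by
            intro z
            induction z with
            | zero => simp only [LinearMap.map_zero, LinearEquiv.map_zero, zero_tmul, tmul_zero, smul_zero, LinearMap.zero_apply]
            | add x y hx hy => simp only [LinearMap.map_add, LinearEquiv.map_add, hx, hy]
            | tmul a b => simp [ext_tmul]
          have h4 : ∀ z : M ⊗[K] Cot K H M, TensorProduct.assoc K H M _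
              ((coactL (K := K) (H := H) (M := M)).rTensor _
                (((TensorProduct.mk K _ V).flip v).lTensor M z)) =
              (((TensorProduct.mk K _ V).flip v).lTensor M).lTensor H (TensorProduct.assoc K H M _
              ((coactL (K := K) (H := H) (M := M)).rTensor _ z)) := by
            intro z
            induction z with
            | zero => simp only [LinearMap.map_zero, LinearEquiv.map_zero, zero_tmul, tmul_zero, smul_zero, LinearMap.zero_apply]
            | add x y hx hy => simp only [LinearMap.map_add, LinearEquiv.map_add, hx, hy]
            | tmul a b =>
              simp only [LinearMap.rTensor_tmul, LinearMap.lTensor_tmul]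
              induction coactL (K := K) (H := H) a with
              | zero => simp only [LinearMap.map_zero, LinearEquiv.map_zero, zero_tmul, tmul_zero, smul_zero, LinearMap.zero_apply]
              | add x y hx hy => simp only [LinearMap.map_add, LinearEquiv.map_add, hx, hy, add_tmul]
              | tmul a b => simp
          rw [ext_tmul, ext_tmul, h3, h4, tau_rho]
      have h2 : ∀ z : M ⊗[K] V, TensorProduct.assoc K H M _
          ((coactL (K := K) (H := H) (M := M)).rTensor _ (l.lTensor M z)) =
          (l.lTensor M).lTensor H (TensorProduct.assoc K H M _
            ((coactL (K := K) (H := H) (M := M)).rTensor _ z)) := by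
        intro z
        induction z with
        | zero => simp only [LinearMap.map_zero, LinearEquiv.map_zero, zero_tmul, tmul_zero, smul_zero, LinearMap.zero_apply]
        | add x y hx hy => simp only [LinearMap.map_add, LinearEquiv.map_add, hx, hy]
        | tmul a b =>
          simp only [LinearMap.rTensor_tmul, LinearMap.lTensor_tmul]
          induction coactL (K := K) (H := H) a with
          | zero => simp only [LinearMap.map_zero, LinearEquiv.map_zero, zero_tmul, tmul_zero, smul_zero, LinearMap.zero_apply]
          | add x y hx hy => simp only [LinearMap.map_add, LinearEquiv.map_add, hx, hy, add_tmul]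
          | tmul a b => simp
      have h5 : (ext (tau K H M) V).lTensor H (l.lTensor H (r x)) =
          (l.lTensor M ∘ₗ t).lTensor H (r x) := by
        rw [← LinearMap.comp_apply, ← LinearMap.lTensor_comp]
        exact tens_congr T (hV.r_mem n x hx)
      rw [h1, T x hx, h2, ← hV.left, h5, LinearMap.lTensor_comp, LinearMap.comp_apply]
  have T : ∀ n, ∀ x ∈ fil n, ext (tau K H M) V (l x) = l.lTensor M (t x) := by
    intro n
    induction n with
    | zero =>
      intro x hx
      rw [fix x, hV.t_zero x hx]
      simp only [map_zero, add_zero, ext_tau_i0]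
    | succ n ih =>
      intro x hx
      rw [fix x, map_add, ext_tau_i0, zero_add]
      apply ext_tau_kap
      have h1 : (ext (rho K H M) V).lTensor M (l.lTensor M (t x)) =
          (l.lTensor H).lTensor M (r.lTensor M (t x)) := by
        rw [← LinearMap.comp_apply, ← LinearMap.comp_apply (g := r.lTensor M), ← LinearMap.lTensor_comp,
          ← LinearMap.lTensor_comp]
        exact tens_congr (L_of_T n ih) (hV.t_mem n x hx)
      have h2 : ∀ z : M ⊗[K] V, TensorProduct.assoc K M H _
          ((coactR (K := K) (H := H) (M := M)).rTensor _ (l.lTensor M z)) =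
          (l.lTensor H).lTensor M (TensorProduct.assoc K M H _
            ((coactR (K := K) (H := H) (M := M)).rTensor _ z)) := by
        intro z
        induction z with
        | zero => simp only [LinearMap.map_zero, LinearEquiv.map_zero, zero_tmul, tmul_zero, smul_zero, LinearMap.zero_apply]
        | add x y hx hy => simp only [LinearMap.map_add, LinearEquiv.map_add, hx, hy]
        | tmul a b =>
          simp only [LinearMap.rTensor_tmul, LinearMap.lTensor_tmul]
          induction coactR (K := K) (H := H) a with
          | zero => simp only [LinearMap.map_zero, LinearEquiv.map_zero, zero_tmul, tmul_zero, smul_zero, LinearMap.zero_apply]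
          | add x y hx hy => simp only [LinearMap.map_add, LinearEquiv.map_add, hx, hy, add_tmul]
          | tmul a b => simp
      have h3 := congrArg ((l.lTensor H).lTensor M) (hV.right x)
      simp only [cotensorMap, LinearMap.sub_apply, LinearMap.comp_apply, LinearEquiv.coe_coe,
        map_sub, map_zero] at h3 ⊢
      rw [h1, h2, h3]
  refine ⟨l, P, fun x => ?_, fun x => ?_, fun n => ?_⟩
  · obtain ⟨n, hn⟩ := hV.exh x
    exact L_of_T n (T n) x hn
  · obtain ⟨n, hn⟩ := hV.exh x
    exact T n x hn
  · have h0 : ∀ n, ∀ x ∈ fil n, (i0 K H M).rTensor V (r x) ∈ tens K (Cot K H M) (fil n) := by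
      intro n x hx
      refine tens_induction (p := fun z => (i0 K H M).rTensor V z ∈ tens K (Cot K H M) (fil n))
        (hV.r_mem n x hx) (by simp)
        (fun a v hv => ?_) (fun x y hx hy => by rw [map_add]; exact add_mem hx hy)
      rw [LinearMap.rTensor_tmul]
      exact tmul_mem_tens _ hv
    induction n with
    | zero =>
      intro x hx
      rw [fix x, hV.t_zero x hx]
      simp only [map_zero, add_zero]
      exact h0 0 x hx
    | succ n ih =>
      intro x hx
      rw [fix x]
      refine add_mem (h0 _ x hx) (tens_mono (hV.mono (Nat.le_succ n)) ?_)
      refine tens_induction (p := fun z => (kap K H M).rTensor V ((TensorProduct.assoc K M _ V).symm z) ∈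
        tens K (Cot K H M) (fil n)) (tens_map ih (hV.t_mem n x hx)) (by simp)
        (fun a v hv => ?_) (fun x y hx hy => by rw [map_add, map_add]; exact add_mem hx hy)
      refine tens_induction (p := fun z => (kap K H M).rTensor V ((TensorProduct.assoc K M _ V).symm
        (a ⊗ₜ z)) ∈ tens K (Cot K H M) (fil n)) hv (by simp) (fun b u hu => ?_)
        (fun x y hx hy => by rw [tmul_add, map_add, map_add]; exact add_mem hx hy)
      rw [assoc_symm_tmul, LinearMap.rTensor_tmul]
      exact tmul_mem_tens _ hu

end Universal

section Mor

variable {K A : Type*} [Field K] [AddCommGroup A] [Module K A]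
variable {U V W Z : Type*} [AddCommGroup U] [Module K U]
  [AddCommGroup V] [Module K V] [AddCommGroup W] [Module K W] [AddCommGroup Z] [Module K Z]

/-- Linear maps compatible with given maps `V → A ⊗ V` and `W → A ⊗ W`. -/
def IsMor (α : V →ₗ[K] A ⊗[K] V) (β : W →ₗ[K] A ⊗[K] W) (f : V →ₗ[K] W) : Prop :=
  ∀ x, β (f x) = f.lTensor A (α x)

theorem IsMor.comp {α : V →ₗ[K] A ⊗[K] V} {β : W →ₗ[K] A ⊗[K] W} {γ : U →ₗ[K] A ⊗[K] U}
    {f : V →ₗ[K] W} {g : W →ₗ[K] U} (hg : IsMor β γ g) (hf : IsMor α β f) : IsMor α γ (g ∘ₗ f) := by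
  intro x
  rw [LinearMap.comp_apply, hg, hf, LinearMap.lTensor_comp_apply]

theorem isMor_id (α : V →ₗ[K] A ⊗[K] V) : IsMor α α LinearMap.id := by
  intro x; simp

theorem isMor_ext_lTensor (α : V →ₗ[K] A ⊗[K] V) (g : W →ₗ[K] Z) :
    IsMor (ext α W) (ext α Z) (g.lTensor V) := by
  intro x
  induction x with
  | zero => simp only [LinearMap.map_zero, LinearEquiv.map_zero, zero_tmul, tmul_zero, smul_zero, LinearMap.zero_apply]
  | add x y hx hy => simp only [LinearMap.map_add, LinearEquiv.map_add, hx, hy]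
  | tmul v w =>
    simp only [LinearMap.lTensor_tmul, ext_tmul]
    rw [← LinearMap.lTensor_comp_apply]
    rfl

theorem isMor_ext_rTensor {α : V →ₗ[K] A ⊗[K] V} {β : W →ₗ[K] A ⊗[K] W} {f : V →ₗ[K] W}
    (hf : IsMor α β f) (Z : Type*) [AddCommGroup Z] [Module K Z] :
    IsMor (ext α Z) (ext β Z) (f.rTensor Z) := by
  intro x
  induction x with
  | zero => simp only [LinearMap.map_zero, LinearEquiv.map_zero, zero_tmul, tmul_zero, smul_zero, LinearMap.zero_apply]
  | add x y hx hy => simp only [LinearMap.map_add, LinearEquiv.map_add, hx, hy]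
  | tmul v w =>
    simp only [LinearMap.rTensor_tmul, ext_tmul]
    rw [hf v, ← LinearMap.lTensor_comp_apply, ← LinearMap.lTensor_comp_apply]
    rfl

theorem isMor_ext_assoc (α : V →ₗ[K] A ⊗[K] V) (W Z : Type*) [AddCommGroup W] [Module K W]
    [AddCommGroup Z] [Module K Z] :
    IsMor (ext (ext α W) Z) (ext α (W ⊗[K] Z)) (TensorProduct.assoc K V W Z).toLinearMap := by
  intro x
  induction x with
  | zero => simp only [LinearMap.map_zero, LinearEquiv.map_zero, zero_tmul, tmul_zero, smul_zero, LinearMap.zero_apply]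
  | add x y hx hy => simp only [LinearMap.map_add, LinearEquiv.map_add, hx, hy]
  | tmul x z =>
    induction x with
    | zero => simp only [LinearMap.map_zero, LinearEquiv.map_zero, zero_tmul, tmul_zero, smul_zero, LinearMap.zero_apply]
    | add x y hx hy => simp only [LinearMap.map_add, LinearEquiv.map_add, add_tmul, hx, hy]
    | tmul v w =>
      simp only [LinearEquiv.coe_coe, assoc_tmul, ext_tmul]
      rw [← LinearMap.lTensor_comp_apply, ← LinearMap.lTensor_comp_apply]
      rfl

theorem isMor_ext_rid (α : V →ₗ[K] A ⊗[K] V) :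
    IsMor (ext α K) α (TensorProduct.rid K V).toLinearMap := by
  intro x
  induction x with
  | zero => simp only [LinearMap.map_zero, LinearEquiv.map_zero, zero_tmul, tmul_zero, smul_zero, LinearMap.zero_apply]
  | add x y hx hy => simp only [LinearMap.map_add, LinearEquiv.map_add, hx, hy]
  | tmul v c =>
    simp only [LinearEquiv.coe_coe, rid_tmul, ext_tmul, map_smul]
    rw [← LinearMap.lTensor_comp_apply]
    have : (TensorProduct.rid K V).toLinearMap ∘ₗ (TensorProduct.mk K V K).flip c =
      c • LinearMap.id := by ext v; simp
    rw [this]; simp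

theorem isMor_rid_symm (α : V →ₗ[K] A ⊗[K] V) :
    IsMor α (ext α K) (TensorProduct.rid K V).symm.toLinearMap := by
  intro x
  simp only [LinearEquiv.coe_coe, rid_symm_apply, ext_tmul]
  congr 1

end Mor

section Box

variable {K A : Type*} [Field K] [Ring A] [Algebra K A]
variable {U V W Z : Type*} [AddCommGroup U] [Module K U]
  [AddCommGroup V] [Module K V] [AddCommGroup W] [Module K W] [AddCommGroup Z] [Module K Z]

/-- The bilinear map `(a ⊗ v, b ⊗ w) ↦ ab ⊗ v ⊗ w`. -/
noncomputable def tmulMul (K A V W : Type*) [Field K] [Ring A] [Algebra K A]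
    [AddCommGroup V] [Module K V] [AddCommGroup W] [Module K W] :
    A ⊗[K] V →ₗ[K] A ⊗[K] W →ₗ[K] A ⊗[K] (V ⊗[K] W) :=
  TensorProduct.map₂ (LinearMap.mul K A) (TensorProduct.mk K V W)

@[simp] theorem tmulMul_tmul (a b : A) (v : V) (w : W) :
    tmulMul K A V W (a ⊗ₜ v) (b ⊗ₜ w) = (a * b) ⊗ₜ (v ⊗ₜ w) := by
  simp [tmulMul]

theorem bilin_ext {A B V W : Type*} [AddCommGroup A] [Module K A] [AddCommGroup B] [Module K B]
    [AddCommGroup V] [Module K V] [AddCommGroup W] [Module K W]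
    {F G : A ⊗[K] V →ₗ[K] B ⊗[K] W →ₗ[K] Z}
    (h : ∀ a v b w, F (a ⊗ₜ v) (b ⊗ₜ w) = G (a ⊗ₜ v) (b ⊗ₜ w)) (x : A ⊗[K] V) (y : B ⊗[K] W) :
    F x y = G x y := by
  have : F = G := by ext a v b w; exact h a v b w
  rw [this]

/-- The map `V ⊗ W → A ⊗ V ⊗ W` built from `V → A ⊗ V`, `W → A ⊗ W` and the product of `A`. -/
noncomputable def box (α : V →ₗ[K] A ⊗[K] V) (β : W →ₗ[K] A ⊗[K] W) :
    V ⊗[K] W →ₗ[K] A ⊗[K] (V ⊗[K] W) :=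
  TensorProduct.lift ((tmulMul K A V W).compl₁₂ α β)

@[simp] theorem box_tmul (α : V →ₗ[K] A ⊗[K] V) (β : W →ₗ[K] A ⊗[K] W) (v : V) (w : W) :
    box α β (v ⊗ₜ w) = tmulMul K A V W (α v) (β w) := by
  simp [box]

theorem isMor_box {V' W' : Type*} [AddCommGroup V'] [Module K V'] [AddCommGroup W'] [Module K W']
    {α : V →ₗ[K] A ⊗[K] V} {β : W →ₗ[K] A ⊗[K] W} {α' : V' →ₗ[K] A ⊗[K] V'}
    {β' : W' →ₗ[K] A ⊗[K] W'} {f : V →ₗ[K] V'} {g : W →ₗ[K] W'} (hf : IsMor α α' f)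
    (hg : IsMor β β' g) : IsMor (box α β) (box α' β') (TensorProduct.map f g) := by
  intro x
  induction x with
  | zero => simp only [LinearMap.map_zero, LinearEquiv.map_zero, zero_tmul, tmul_zero, smul_zero, LinearMap.zero_apply]
  | add x y hx hy => simp only [LinearMap.map_add, LinearEquiv.map_add, hx, hy]
  | tmul v w =>
    rw [map_tmul, box_tmul, box_tmul, hf v, hg w]
    exact bilin_ext (F := (tmulMul K A V' W').compl₁₂ (f.lTensor A) (g.lTensor A))
      (G := (tmulMul K A V W).compr₂ ((TensorProduct.map f g).lTensor A)) (by intros; simp) _ _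

theorem isMor_box_assoc (α : V →ₗ[K] A ⊗[K] V) (β : W →ₗ[K] A ⊗[K] W) (γ : U →ₗ[K] A ⊗[K] U) :
    IsMor (box (box α β) γ) (box α (box β γ)) (TensorProduct.assoc K V W U).toLinearMap := by
  intro x
  induction x with
  | zero => simp only [LinearMap.map_zero, LinearEquiv.map_zero, zero_tmul, tmul_zero, smul_zero, LinearMap.zero_apply]
  | add x y hx hy => simp only [LinearMap.map_add, LinearEquiv.map_add, hx, hy]
  | tmul x u =>
    induction x with
    | zero => simp only [LinearMap.map_zero, LinearEquiv.map_zero, zero_tmul, tmul_zero, smul_zero, LinearMap.zero_apply]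
    | add x y hx hy => simp only [LinearMap.map_add, LinearEquiv.map_add, add_tmul, hx, hy]
    | tmul v w =>
      simp only [LinearEquiv.coe_coe, assoc_tmul, box_tmul]
      generalize α v = x
      generalize β w = y
      generalize γ u = z
      induction x with
      | zero => simp only [LinearMap.map_zero, LinearEquiv.map_zero, zero_tmul, tmul_zero, smul_zero, LinearMap.zero_apply]
      | add x y hx hy => simp only [LinearMap.map_add, LinearEquiv.map_add, LinearMap.add_apply, hx, hy]
      | tmul a v =>
        induction y with
        | zero => simp only [LinearMap.map_zero, LinearEquiv.map_zero, zero_tmul, tmul_zero, smul_zero, LinearMap.zero_apply]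
        | add x y hx hy => simp only [LinearMap.map_add, LinearEquiv.map_add, LinearMap.add_apply, hx, hy]
        | tmul b w =>
          induction z with
          | zero => simp only [LinearMap.map_zero, LinearEquiv.map_zero, zero_tmul, tmul_zero, smul_zero, LinearMap.zero_apply]
          | add x y hx hy => simp only [LinearMap.map_add, LinearEquiv.map_add, hx, hy]
          | tmul c u => simp [mul_assoc]

/-- The map `K → A ⊗ K` given by the unit of `A`. -/
noncomputable def unitDat (K A : Type*) [Field K] [Ring A] [Algebra K A] : K →ₗ[K] A ⊗[K] K :=
  TensorProduct.mk K A K 1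

theorem isMor_box_lid (α : V →ₗ[K] A ⊗[K] V) :
    IsMor (box (unitDat K A) α) α (TensorProduct.lid K V).toLinearMap := by
  intro x
  induction x with
  | zero => simp only [LinearMap.map_zero, LinearEquiv.map_zero, zero_tmul, tmul_zero, smul_zero, LinearMap.zero_apply]
  | add x y hx hy => simp only [LinearMap.map_add, LinearEquiv.map_add, hx, hy]
  | tmul c v =>
    simp only [LinearEquiv.coe_coe, lid_tmul, box_tmul, map_smul, unitDat, mk_apply]
    induction α v with
    | zero => simp only [LinearMap.map_zero, LinearEquiv.map_zero, zero_tmul, tmul_zero, smul_zero, LinearMap.zero_apply]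
    | add x y hx hy => simp only [LinearMap.map_add, LinearEquiv.map_add, smul_add, hx, hy]
    | tmul a v => simp

theorem isMor_box_rid (α : V →ₗ[K] A ⊗[K] V) :
    IsMor (box α (unitDat K A)) α (TensorProduct.rid K V).toLinearMap := by
  intro x
  induction x with
  | zero => simp only [LinearMap.map_zero, LinearEquiv.map_zero, zero_tmul, tmul_zero, smul_zero, LinearMap.zero_apply]
  | add x y hx hy => simp only [LinearMap.map_add, LinearEquiv.map_add, hx, hy]
  | tmul v c =>
    simp only [LinearEquiv.coe_coe, rid_tmul, box_tmul, map_smul, unitDat, mk_apply]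
    induction α v with
    | zero => simp only [LinearMap.map_zero, LinearEquiv.map_zero, zero_tmul, tmul_zero, smul_zero, LinearMap.zero_apply]
    | add x y hx hy => simp only [LinearMap.map_add, LinearEquiv.map_add, LinearMap.add_apply, smul_add, hx, hy]
    | tmul a v => simp

theorem isMor_box_comm (α : V →ₗ[K] A ⊗[K] V) (β : W →ₗ[K] A ⊗[K] W) (Z Z' : Type*)
    [AddCommGroup Z] [Module K Z] [AddCommGroup Z'] [Module K Z'] :
    IsMor (box (ext α Z) (ext β Z')) (ext (box α β) (Z ⊗[K] Z'))
      (TensorProduct.tensorTensorTensorComm K V Z W Z').toLinearMap := by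
  intro x
  induction x with
  | zero => simp only [LinearMap.map_zero, LinearEquiv.map_zero, zero_tmul, tmul_zero, smul_zero, LinearMap.zero_apply]
  | add x y hx hy => simp only [LinearMap.map_add, LinearEquiv.map_add, hx, hy]
  | tmul x y =>
    induction x with
    | zero => simp only [LinearMap.map_zero, LinearEquiv.map_zero, zero_tmul, tmul_zero, smul_zero, LinearMap.zero_apply]
    | add x y hx hy => simp only [LinearMap.map_add, LinearEquiv.map_add, add_tmul, hx, hy]
    | tmul v z =>
      induction y with
      | zero => simp only [LinearMap.map_zero, LinearEquiv.map_zero, zero_tmul, tmul_zero, smul_zero, LinearMap.zero_apply]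
      | add x y hx hy => simp only [LinearMap.map_add, LinearEquiv.map_add, tmul_add, hx, hy]
      | tmul w z' =>
        simp only [LinearEquiv.coe_coe, tensorTensorTensorComm_tmul, box_tmul, ext_tmul]
        exact bilin_ext (F := (tmulMul K A V W).compr₂
            (((TensorProduct.mk K (V ⊗[K] W) (Z ⊗[K] Z')).flip (z ⊗ₜ z')).lTensor A))
          (G := ((tmulMul K A (V ⊗[K] Z) (W ⊗[K] Z')).compl₁₂
            (((TensorProduct.mk K V Z).flip z).lTensor A) (((TensorProduct.mk K W Z').flip z').lTensor A)).compr₂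
              ((TensorProduct.tensorTensorTensorComm K V Z W Z').toLinearMap.lTensor A))
          (by intros; simp) _ _

theorem box_compat {B D : Type*} [Ring B] [Algebra K B] [Ring D] [Algebra K D]
    (δ : D →ₐ[K] A ⊗[K] B) {α : V →ₗ[K] A ⊗[K] V} {β : V →ₗ[K] B ⊗[K] V} {γ : V →ₗ[K] D ⊗[K] V}
    {α' : W →ₗ[K] A ⊗[K] W} {β' : W →ₗ[K] B ⊗[K] W} {γ' : W →ₗ[K] D ⊗[K] W}
    (h : ∀ x, β.lTensor A (α x) = TensorProduct.assoc K A B V (δ.toLinearMap.rTensor V (γ x)))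
    (h' : ∀ x, β'.lTensor A (α' x) = TensorProduct.assoc K A B W (δ.toLinearMap.rTensor W (γ' x)))
    (x : V ⊗[K] W) : (box β β').lTensor A (box α α' x) =
      TensorProduct.assoc K A B (V ⊗[K] W) (δ.toLinearMap.rTensor _ (box γ γ' x)) := by
  induction x with
  | zero => simp only [LinearMap.map_zero, LinearEquiv.map_zero, zero_tmul, tmul_zero, smul_zero, LinearMap.zero_apply]
  | add x y hx hy => simp only [LinearMap.map_add, LinearEquiv.map_add, hx, hy]
  | tmul v w =>
    rw [box_tmul, box_tmul]
    let Q : A ⊗[K] (B ⊗[K] V) →ₗ[K] A ⊗[K] (B ⊗[K] W) →ₗ[K] A ⊗[K] (B ⊗[K] (V ⊗[K] W)) :=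
      TensorProduct.map₂ (LinearMap.mul K A) (tmulMul K B V W)
    have h1 : (box β β').lTensor A (tmulMul K A V W (α v) (α' w)) =
        Q (β.lTensor A (α v)) (β'.lTensor A (α' w)) :=
      bilin_ext (F := (tmulMul K A V W).compr₂ ((box β β').lTensor A))
        (G := Q.compl₁₂ (β.lTensor A) (β'.lTensor A)) (by intros; simp [Q]) _ _
    have h2 : TensorProduct.assoc K A B (V ⊗[K] W) (δ.toLinearMap.rTensor _
        (tmulMul K D V W (γ v) (γ' w))) =
        Q (TensorProduct.assoc K A B V (δ.toLinearMap.rTensor V (γ v)))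
          (TensorProduct.assoc K A B W (δ.toLinearMap.rTensor W (γ' w))) := by
      refine bilin_ext (F := (tmulMul K D V W).compr₂ ((TensorProduct.assoc K A B (V ⊗[K] W)).toLinearMap ∘ₗ
        δ.toLinearMap.rTensor _)) (G := Q.compl₁₂ ((TensorProduct.assoc K A B V).toLinearMap ∘ₗ
          δ.toLinearMap.rTensor V) ((TensorProduct.assoc K A B W).toLinearMap ∘ₗ
          δ.toLinearMap.rTensor W)) ?_ _ _
      intro a v b w
      simp only [LinearMap.compr₂_apply, LinearMap.compl₁₂_apply, LinearMap.comp_apply, tmulMul_tmul,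
        LinearMap.rTensor_tmul, AlgHom.toLinearMap_apply, map_mul, LinearEquiv.coe_coe]
      generalize δ a = x
      generalize δ b = y
      induction x with
      | zero => simp
      | add x y hx hy => simp only [LinearMap.map_add, LinearEquiv.map_add, add_mul, add_tmul, LinearMap.add_apply, hx, hy]
      | tmul a v =>
        induction y with
        | zero => simp
        | add x y hx hy => simp only [LinearMap.map_add, LinearEquiv.map_add, mul_add, add_tmul, hx, hy]
        | tmul b w => simp [Q]
    rw [h1, h2, h, h']

theorem box_map {B : Type*} [Ring B] [Algebra K B] (δ : A →ₐ[K] B)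
    {α : V →ₗ[K] A ⊗[K] V} {β : V →ₗ[K] B ⊗[K] V} {α' : W →ₗ[K] A ⊗[K] W} {β' : W →ₗ[K] B ⊗[K] W}
    (h : ∀ x, δ.toLinearMap.rTensor V (α x) = β x) (h' : ∀ x, δ.toLinearMap.rTensor W (α' x) = β' x)
    (x : V ⊗[K] W) : δ.toLinearMap.rTensor _ (box α α' x) = box β β' x := by
  induction x with
  | zero => simp only [LinearMap.map_zero, LinearEquiv.map_zero, zero_tmul, tmul_zero, smul_zero, LinearMap.zero_apply]
  | add x y hx hy => simp only [LinearMap.map_add, LinearEquiv.map_add, hx, hy]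
  | tmul v w =>
    rw [box_tmul, box_tmul, ← h, ← h']
    exact bilin_ext (F := (tmulMul K A V W).compr₂ (δ.toLinearMap.rTensor _))
      (G := (tmulMul K B V W).compl₁₂ (δ.toLinearMap.rTensor _) (δ.toLinearMap.rTensor _))
      (by intros; simp) _ _

end Box

section Pairs

variable {K : Type w} {H M : Type u} [Field K] [Ring H] [HopfAlgebra K H]
  [AddCommGroup M] [Module K M] [Module H M] [Module Hᵐᵒᵖ M]
  [IsScalarTower K H M] [IsScalarTower K Hᵐᵒᵖ M] [SMulCommClass H Hᵐᵒᵖ M]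

section
variable {V W Z : Type*} [AddCommGroup V] [Module K V] [AddCommGroup W] [Module K W]
  [AddCommGroup Z] [Module K Z]

variable (K H M) in
noncomputable abbrev inlL : H →ₗ[K] TrivSqZeroExt H M := (TrivSqZeroExt.inlAlgHom K H M).toLinearMap

variable (K H M) in
noncomputable abbrev fstL : TrivSqZeroExt H M →ₗ[K] H := (TrivSqZeroExt.fstHom K H M).toLinearMap

variable (K H M) in
noncomputable abbrev inrL : M →ₗ[K] TrivSqZeroExt H M :=
  { toFun := TrivSqZeroExt.inr, map_add' := TrivSqZeroExt.inr_add H, map_smul' := fun c m => TrivSqZeroExt.inr_smul H c m }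

variable (K H M) in
noncomputable abbrev sndL : TrivSqZeroExt H M →ₗ[K] M :=
  { toFun := TrivSqZeroExt.snd, map_add' := TrivSqZeroExt.snd_add, map_smul' := fun c m => TrivSqZeroExt.snd_smul c m }

/-- A pair of maps `V → H ⊗ V` and `V → M ⊗ V`, as a map to `(H ⊕ M) ⊗ V`, where `H ⊕ M` is
the trivial square zero extension. -/
noncomputable def pr (r : V →ₗ[K] H ⊗[K] V) (t : V →ₗ[K] M ⊗[K] V) :
    V →ₗ[K] TrivSqZeroExt H M ⊗[K] V :=
  (inlL K H M).rTensor V ∘ₗ r + (inrL K H M).rTensor V ∘ₗ t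

theorem fst_pr (r : V →ₗ[K] H ⊗[K] V) (t : V →ₗ[K] M ⊗[K] V) (x : V) :
    (fstL K H M).rTensor V (pr r t x) = r x := by
  have h1 : ∀ z : H ⊗[K] V, (fstL K H M).rTensor V ((inlL K H M).rTensor V z) = z := by
    intro z
    rw [← LinearMap.rTensor_comp_apply]
    have : fstL K H M ∘ₗ inlL K H M = LinearMap.id := by ext; simp
    rw [this]; simp
  have h2 : ∀ z : M ⊗[K] V, (fstL K H M).rTensor V ((inrL K H M).rTensor V z) = 0 := by
    intro z
    rw [← LinearMap.rTensor_comp_apply]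
    have : fstL K H M ∘ₗ inrL K H M = 0 := by ext; simp
    rw [this]; simp
  simp only [pr, LinearMap.add_apply, map_add, LinearMap.comp_apply, h1, h2, add_zero]

theorem snd_pr (r : V →ₗ[K] H ⊗[K] V) (t : V →ₗ[K] M ⊗[K] V) (x : V) :
    (sndL K H M).rTensor V (pr r t x) = t x := by
  have h1 : ∀ z : H ⊗[K] V, (sndL K H M).rTensor V ((inlL K H M).rTensor V z) = 0 := by
    intro z
    rw [← LinearMap.rTensor_comp_apply]
    have : sndL K H M ∘ₗ inlL K H M = 0 := by ext; simp
    rw [this]; simp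
  have h2 : ∀ z : M ⊗[K] V, (sndL K H M).rTensor V ((inrL K H M).rTensor V z) = z := by
    intro z
    rw [← LinearMap.rTensor_comp_apply]
    have : sndL K H M ∘ₗ inrL K H M = LinearMap.id := by ext; simp
    rw [this]; simp
  simp only [pr, LinearMap.add_apply, map_add, LinearMap.comp_apply, h1, h2, zero_add]

theorem tmulMul_lTensor_comm {A : Type*} [AddCommGroup A] [Module K A] {B : Type*} [AddCommGroup B]
    [Module K B] (p : A →ₗ[K] B) (f : V →ₗ[K] W) (x : A ⊗[K] V) :
    p.rTensor W (f.lTensor A x) = f.lTensor B (p.rTensor V x) := by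
  rw [← LinearMap.comp_apply, ← LinearMap.comp_apply, LinearMap.rTensor_comp_lTensor,
    LinearMap.lTensor_comp_rTensor]

theorem isMor_pr {r : V →ₗ[K] H ⊗[K] V} {t : V →ₗ[K] M ⊗[K] V} {r' : W →ₗ[K] H ⊗[K] W}
    {t' : W →ₗ[K] M ⊗[K] W} {f : V →ₗ[K] W} :
    IsMor (pr r t) (pr r' t') f ↔ IsMor r r' f ∧ IsMor t t' f := by
  constructor
  · intro h
    refine ⟨fun x => ?_, fun x => ?_⟩
    · rw [← fst_pr r' t', h, tmulMul_lTensor_comm, fst_pr]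
    · rw [← snd_pr r' t', h, tmulMul_lTensor_comm, snd_pr]
  · rintro ⟨h, h'⟩ x
    simp only [pr, LinearMap.add_apply, LinearMap.comp_apply, map_add, h x, h' x,
      tmulMul_lTensor_comm]

theorem ext_pr (r : V →ₗ[K] H ⊗[K] V) (t : V →ₗ[K] M ⊗[K] V) (Z : Type*) [AddCommGroup Z]
    [Module K Z] : ext (pr r t) Z = pr (ext r Z) (ext t Z) := by
  ext v z
  simp only [AlgebraTensorModule.curry_apply, curry_apply, LinearMap.restrictScalars_self, ext_tmul, pr,
    LinearMap.add_apply, map_add, LinearMap.comp_apply, tmulMul_lTensor_comm]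

/-- The map `V ⊗ W → M ⊗ V ⊗ W` built from maps `V → H ⊗ V`, `V → M ⊗ V` and likewise for `W`:
`v ⊗ w ↦ v₋₁.w_M ⊗ v₀ ⊗ w' + v_M.w₋₁ ⊗ v' ⊗ w₀`. -/
noncomputable def boxM (r : V →ₗ[K] H ⊗[K] V) (t : V →ₗ[K] M ⊗[K] V) (r' : W →ₗ[K] H ⊗[K] W)
    (t' : W →ₗ[K] M ⊗[K] W) : V ⊗[K] W →ₗ[K] M ⊗[K] (V ⊗[K] W) :=
  TensorProduct.lift ((TensorProduct.map₂ (lact K H M) (TensorProduct.mk K V W)).compl₁₂ r t' +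
    (TensorProduct.map₂ (ract K H M) (TensorProduct.mk K V W)).compl₁₂ t r')

theorem box_pr (r : V →ₗ[K] H ⊗[K] V) (t : V →ₗ[K] M ⊗[K] V) (r' : W →ₗ[K] H ⊗[K] W)
    (t' : W →ₗ[K] M ⊗[K] W) : box (pr r t) (pr r' t') = pr (box r r') (boxM r t r' t') := by
  ext v w
  simp only [AlgebraTensorModule.curry_apply, curry_apply, LinearMap.restrictScalars_self, pr, box_tmul,
    LinearMap.add_apply, map_add, LinearMap.comp_apply, boxM, lift.tmul, LinearMap.compl₁₂_apply]
  have h1 : ∀ x y, tmulMul K _ V W ((inlL K H M).rTensor V x) ((inlL K H M).rTensor W y) =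
      (inlL K H M).rTensor _ (tmulMul K H V W x y) :=
    bilin_ext (F := (tmulMul K _ V W).compl₁₂ ((inlL K H M).rTensor V) ((inlL K H M).rTensor W))
      (G := (tmulMul K H V W).compr₂ ((inlL K H M).rTensor _)) (by intros; simp [TrivSqZeroExt.inl_mul_inr, TrivSqZeroExt.inr_mul_inl])
  have h2 : ∀ x y, tmulMul K _ V W ((inlL K H M).rTensor V x) ((inrL K H M).rTensor W y) =
      (inrL K H M).rTensor _ (TensorProduct.map₂ (lact K H M) (TensorProduct.mk K V W) x y) :=
    bilin_ext (F := (tmulMul K _ V W).compl₁₂ ((inlL K H M).rTensor V) ((inrL K H M).rTensor W))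
      (G := (TensorProduct.map₂ (lact K H M) (TensorProduct.mk K V W)).compr₂ ((inrL K H M).rTensor _))
      (by intros; simp [TrivSqZeroExt.inl_mul_inr, TrivSqZeroExt.inr_mul_inl])
  have h3 : ∀ x y, tmulMul K _ V W ((inrL K H M).rTensor V x) ((inlL K H M).rTensor W y) =
      (inrL K H M).rTensor _ (TensorProduct.map₂ (ract K H M) (TensorProduct.mk K V W) x y) :=
    bilin_ext (F := (tmulMul K _ V W).compl₁₂ ((inrL K H M).rTensor V) ((inlL K H M).rTensor W))
      (G := (TensorProduct.map₂ (ract K H M) (TensorProduct.mk K V W)).compr₂ ((inrL K H M).rTensor _))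
      (by intros; simp [TrivSqZeroExt.inl_mul_inr, TrivSqZeroExt.inr_mul_inl])
  have h4 : ∀ x y, tmulMul K _ V W ((inrL K H M).rTensor V x) ((inrL K H M).rTensor W y) = 0 :=
    bilin_ext (F := (tmulMul K _ V W).compl₁₂ ((inrL K H M).rTensor V) ((inrL K H M).rTensor W))
      (G := 0) (by intros; simp [TrivSqZeroExt.inl_mul_inr, TrivSqZeroExt.inr_mul_inl])
  rw [h1, h2, h3, h4]
  abel

end

variable [HopfBimodule K H M]
open HopfBimodule

variable (K H M) in
/-- The algebra map `H ⊕ M → H ⊗ (H ⊕ M)` given by the left coactions. -/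
noncomputable def coL : TrivSqZeroExt H M →ₐ[K] H ⊗[K] TrivSqZeroExt H M :=
  TrivSqZeroExt.lift ((Algebra.TensorProduct.map (AlgHom.id K H) (TrivSqZeroExt.inlAlgHom K H M)).comp
    (Bialgebra.comulAlgHom K H)) ((inrL K H M).lTensor H ∘ₗ coactL)
    (fun x y => by
      simp only [LinearMap.comp_apply]
      generalize coactL (K := K) (H := H) x = x
      generalize coactL (K := K) (H := H) y = y
      induction x with
      | zero => simp
      | add x y hx hy => simp only [LinearMap.map_add, LinearEquiv.map_add, add_mul, hx, hy, add_zero]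
      | tmul a b =>
        induction y with
        | zero => simp
        | add x y hx hy => simp only [LinearMap.map_add, LinearEquiv.map_add, mul_add, hx, hy, add_zero]
        | tmul c d => simp)
    (fun h x => by
      simp only [LinearMap.comp_apply, coactL_smul, AlgHom.comp_apply, Bialgebra.comulAlgHom_apply]
      exact bilin_ext (F := (TensorProduct.map₂ (LinearMap.mul K H) (lact K H M)).compr₂
        ((inrL K H M).lTensor H)) (G := (LinearMap.mul K (H ⊗[K] TrivSqZeroExt H M)).compl₁₂
          (Algebra.TensorProduct.map (AlgHom.id K H) (TrivSqZeroExt.inlAlgHom K H M)).toLinearMap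
          ((inrL K H M).lTensor H)) (by intros; simp [TrivSqZeroExt.inl_mul_inr, TrivSqZeroExt.inr_mul_inl]) _ _)
    (fun h x => by
      simp only [LinearMap.comp_apply, coactL_op_smul, AlgHom.comp_apply, Bialgebra.comulAlgHom_apply]
      exact bilin_ext (F := (TensorProduct.map₂ (LinearMap.mul K H) (ract K H M)).compr₂
        ((inrL K H M).lTensor H)) (G := (LinearMap.mul K (H ⊗[K] TrivSqZeroExt H M)).compl₁₂
          ((inrL K H M).lTensor H)
          (Algebra.TensorProduct.map (AlgHom.id K H) (TrivSqZeroExt.inlAlgHom K H M)).toLinearMap)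
          (by intros; simp [TrivSqZeroExt.inl_mul_inr, TrivSqZeroExt.inr_mul_inl]) _ _)

variable (K H M) in
/-- The algebra map `H ⊕ M → (H ⊕ M) ⊗ H` given by the right coactions. -/
noncomputable def coR : TrivSqZeroExt H M →ₐ[K] TrivSqZeroExt H M ⊗[K] H :=
  TrivSqZeroExt.lift ((Algebra.TensorProduct.map (TrivSqZeroExt.inlAlgHom K H M) (AlgHom.id K H)).comp
    (Bialgebra.comulAlgHom K H)) ((inrL K H M).rTensor H ∘ₗ coactR)
    (fun x y => by
      simp only [LinearMap.comp_apply]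
      generalize coactR (K := K) (H := H) x = x
      generalize coactR (K := K) (H := H) y = y
      induction x with
      | zero => simp
      | add x y hx hy => simp only [LinearMap.map_add, LinearEquiv.map_add, add_mul, hx, hy, add_zero]
      | tmul a b =>
        induction y with
        | zero => simp
        | add x y hx hy => simp only [LinearMap.map_add, LinearEquiv.map_add, mul_add, hx, hy, add_zero]
        | tmul c d => simp)
    (fun h x => by
      simp only [LinearMap.comp_apply, coactR_smul, AlgHom.comp_apply, Bialgebra.comulAlgHom_apply]
      exact bilin_ext (F := (TensorProduct.map₂ (lact K H M) (LinearMap.mul K H)).compr₂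
        ((inrL K H M).rTensor H)) (G := (LinearMap.mul K (TrivSqZeroExt H M ⊗[K] H)).compl₁₂
          (Algebra.TensorProduct.map (TrivSqZeroExt.inlAlgHom K H M) (AlgHom.id K H)).toLinearMap
          ((inrL K H M).rTensor H)) (by intros; simp [TrivSqZeroExt.inl_mul_inr, TrivSqZeroExt.inr_mul_inl]) _ _)
    (fun h x => by
      simp only [LinearMap.comp_apply, coactR_op_smul, AlgHom.comp_apply, Bialgebra.comulAlgHom_apply]
      exact bilin_ext (F := (TensorProduct.map₂ (ract K H M) (LinearMap.mul K H)).compr₂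
        ((inrL K H M).rTensor H)) (G := (LinearMap.mul K (TrivSqZeroExt H M ⊗[K] H)).compl₁₂
          ((inrL K H M).rTensor H)
          (Algebra.TensorProduct.map (TrivSqZeroExt.inlAlgHom K H M) (AlgHom.id K H)).toLinearMap)
          (by intros; simp [TrivSqZeroExt.inl_mul_inr, TrivSqZeroExt.inr_mul_inl]) _ _)

end Pairs

section Compat

variable {K : Type w} {H M : Type u} [Field K] [Ring H] [HopfAlgebra K H]
  [AddCommGroup M] [Module K M] [Module H M] [Module Hᵐᵒᵖ M]
  [IsScalarTower K H M] [IsScalarTower K Hᵐᵒᵖ M] [SMulCommClass H Hᵐᵒᵖ M]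
  [HopfBimodule K H M]
open HopfBimodule

section Pair

variable {V : Type*} [AddCommGroup V] [Module K V]

theorem coL_inl (h : H) : coL K H M (TrivSqZeroExt.inl h) = (inlL K H M).lTensor H (Coalgebra.comul h) := by
  simp only [coL, TrivSqZeroExt.lift_apply_inl, AlgHom.comp_apply, Bialgebra.comulAlgHom_apply]
  rfl

theorem coL_inr (m : M) : coL K H M (TrivSqZeroExt.inr m) = (inrL K H M).lTensor H (coactL m) := by
  simp only [coL, TrivSqZeroExt.lift_apply_inr, LinearMap.comp_apply]

theorem coR_inl (h : H) : coR K H M (TrivSqZeroExt.inl h) = (inlL K H M).rTensor H (Coalgebra.comul h) := by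
  simp only [coR, TrivSqZeroExt.lift_apply_inl, AlgHom.comp_apply, Bialgebra.comulAlgHom_apply]
  rfl

theorem coR_inr (m : M) : coR K H M (TrivSqZeroExt.inr m) = (inrL K H M).rTensor H (coactR m) := by
  simp only [coR, TrivSqZeroExt.lift_apply_inr, LinearMap.comp_apply]

theorem assoc_lTensor {B C D : Type*} [AddCommGroup B] [Module K B] [AddCommGroup C] [Module K C]
    [AddCommGroup D] [Module K D] (f : C →ₗ[K] D) (z : B ⊗[K] C) (v : V) :
    TensorProduct.assoc K B D V (f.lTensor B z ⊗ₜ v) =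
      (f.rTensor V).lTensor B (TensorProduct.assoc K B C V (z ⊗ₜ v)) := by
  induction z with
  | zero => simp only [LinearMap.map_zero, LinearEquiv.map_zero, zero_tmul, tmul_zero, smul_zero, LinearMap.zero_apply]
  | add x y hx hy => simp only [LinearMap.map_add, LinearEquiv.map_add, add_tmul, hx, hy]
  | tmul b c => simp

theorem assoc_rTensor {B C D : Type*} [AddCommGroup B] [Module K B] [AddCommGroup C] [Module K C]
    [AddCommGroup D] [Module K D] (f : B →ₗ[K] D) (z : B ⊗[K] C) (v : V) :
    TensorProduct.assoc K D C V (f.rTensor C z ⊗ₜ v) =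
      f.rTensor (C ⊗[K] V) (TensorProduct.assoc K B C V (z ⊗ₜ v)) := by
  induction z with
  | zero => simp only [LinearMap.map_zero, LinearEquiv.map_zero, zero_tmul, tmul_zero, smul_zero, LinearMap.zero_apply]
  | add x y hx hy => simp only [LinearMap.map_add, LinearEquiv.map_add, add_tmul, hx, hy]
  | tmul b c => simp

theorem snd_coL (z : TrivSqZeroExt H M ⊗[K] V) : ((sndL K H M).rTensor V).lTensor H
    (TensorProduct.assoc K H _ V ((coL K H M).toLinearMap.rTensor V z)) =
    TensorProduct.assoc K H M V (coactL.rTensor V ((sndL K H M).rTensor V z)) := by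
  induction z with
  | zero => simp only [LinearMap.map_zero, LinearEquiv.map_zero, zero_tmul, tmul_zero, smul_zero, LinearMap.zero_apply]
  | add x y hx hy => simp only [LinearMap.map_add, LinearEquiv.map_add, hx, hy]
  | tmul a v =>
    have h1 : (sndL K H M) ∘ₗ (inlL K H M) = 0 := by ext; simp
    have h2 : (sndL K H M) ∘ₗ (inrL K H M) = LinearMap.id := by ext; simp
    induction a using TrivSqZeroExt.ind with
    | inl_add_inr h m =>
      simp only [LinearMap.rTensor_tmul, AlgHom.toLinearMap_apply, map_add, coL_inl, coL_inr, add_tmul]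
      rw [← assoc_lTensor, ← assoc_lTensor, ← LinearMap.lTensor_comp_apply,
        ← LinearMap.lTensor_comp_apply, h1, h2]
      simp

theorem snd_coR (z : TrivSqZeroExt H M ⊗[K] V) : (sndL K H M).rTensor (H ⊗[K] V)
    (TensorProduct.assoc K _ H V ((coR K H M).toLinearMap.rTensor V z)) =
    TensorProduct.assoc K M H V (coactR.rTensor V ((sndL K H M).rTensor V z)) := by
  induction z with
  | zero => simp only [LinearMap.map_zero, LinearEquiv.map_zero, zero_tmul, tmul_zero, smul_zero, LinearMap.zero_apply]
  | add x y hx hy => simp only [LinearMap.map_add, LinearEquiv.map_add, hx, hy]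
  | tmul a v =>
    have h1 : (sndL K H M) ∘ₗ (inlL K H M) = 0 := by ext; simp
    have h2 : (sndL K H M) ∘ₗ (inrL K H M) = LinearMap.id := by ext; simp
    induction a using TrivSqZeroExt.ind with
    | inl_add_inr h m =>
      simp only [LinearMap.rTensor_tmul, AlgHom.toLinearMap_apply, map_add, coR_inl, coR_inr, add_tmul]
      rw [← assoc_rTensor, ← assoc_rTensor, ← LinearMap.rTensor_comp_apply,
        ← LinearMap.rTensor_comp_apply, h1, h2]
      simp

theorem coL_rTensor_inl (z : H ⊗[K] V) : TensorProduct.assoc K H _ V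
    ((coL K H M).toLinearMap.rTensor V ((inlL K H M).rTensor V z)) =
    ((inlL K H M).rTensor V).lTensor H (TensorProduct.assoc K H H V (Coalgebra.comul.rTensor V z)) := by
  induction z with
  | zero => simp only [LinearMap.map_zero, LinearEquiv.map_zero, zero_tmul, tmul_zero, smul_zero, LinearMap.zero_apply]
  | add x y hx hy => simp only [LinearMap.map_add, LinearEquiv.map_add, hx, hy]
  | tmul a v =>
    rw [LinearMap.rTensor_tmul, LinearMap.rTensor_tmul, LinearMap.rTensor_tmul, ← assoc_lTensor, ← coL_inl]
    rfl

theorem coL_rTensor_inr (z : M ⊗[K] V) : TensorProduct.assoc K H _ V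
    ((coL K H M).toLinearMap.rTensor V ((inrL K H M).rTensor V z)) =
    ((inrL K H M).rTensor V).lTensor H (TensorProduct.assoc K H M V (coactL.rTensor V z)) := by
  induction z with
  | zero => simp only [LinearMap.map_zero, LinearEquiv.map_zero, zero_tmul, tmul_zero, smul_zero, LinearMap.zero_apply]
  | add x y hx hy => simp only [LinearMap.map_add, LinearEquiv.map_add, hx, hy]
  | tmul a v =>
    rw [LinearMap.rTensor_tmul, LinearMap.rTensor_tmul, LinearMap.rTensor_tmul, ← assoc_lTensor, ← coL_inr]
    rfl

theorem coR_rTensor_inl (z : H ⊗[K] V) : TensorProduct.assoc K _ H V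
    ((coR K H M).toLinearMap.rTensor V ((inlL K H M).rTensor V z)) =
    (inlL K H M).rTensor (H ⊗[K] V) (TensorProduct.assoc K H H V (Coalgebra.comul.rTensor V z)) := by
  induction z with
  | zero => simp only [LinearMap.map_zero, LinearEquiv.map_zero, zero_tmul, tmul_zero, smul_zero, LinearMap.zero_apply]
  | add x y hx hy => simp only [LinearMap.map_add, LinearEquiv.map_add, hx, hy]
  | tmul a v =>
    rw [LinearMap.rTensor_tmul, LinearMap.rTensor_tmul, LinearMap.rTensor_tmul, ← assoc_rTensor, ← coR_inl]
    rfl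

theorem coR_rTensor_inr (z : M ⊗[K] V) : TensorProduct.assoc K _ H V
    ((coR K H M).toLinearMap.rTensor V ((inrL K H M).rTensor V z)) =
    (inrL K H M).rTensor (H ⊗[K] V) (TensorProduct.assoc K M H V (coactR.rTensor V z)) := by
  induction z with
  | zero => simp only [LinearMap.map_zero, LinearEquiv.map_zero, zero_tmul, tmul_zero, smul_zero, LinearMap.zero_apply]
  | add x y hx hy => simp only [LinearMap.map_add, LinearEquiv.map_add, hx, hy]
  | tmul a v =>
    rw [LinearMap.rTensor_tmul, LinearMap.rTensor_tmul, LinearMap.rTensor_tmul, ← assoc_rTensor, ← coR_inr]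
    rfl

variable {r : V →ₗ[K] H ⊗[K] V} {t : V →ₗ[K] M ⊗[K] V} {fil : ℕ → Submodule K V}

theorem IsCompat.coL (h : IsCompat M r t fil) (x : V) : (pr r t).lTensor H (r x) =
    TensorProduct.assoc K H _ V ((coL K H M).toLinearMap.rTensor V (pr r t x)) := by
  have h1 : (pr r t).lTensor H (r x) = ((inlL K H M).rTensor V).lTensor H (r.lTensor H (r x)) +
      ((inrL K H M).rTensor V).lTensor H (t.lTensor H (r x)) := by
    simp only [pr, LinearMap.lTensor_add, LinearMap.add_apply, LinearMap.lTensor_comp_apply]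
  rw [h1]
  simp only [pr, LinearMap.add_apply, LinearMap.comp_apply, map_add, coL_rTensor_inl, coL_rTensor_inr,
    h.coassoc, h.left]

theorem IsCompat.coR (h : IsCompat M r t fil) (x : V) : r.lTensor _ (pr r t x) =
    TensorProduct.assoc K _ H V ((coR K H M).toLinearMap.rTensor V (pr r t x)) := by
  have h2 := sub_eq_zero.1 (h.right x)
  simp only [LinearMap.comp_apply, LinearEquiv.coe_coe] at h2
  simp only [pr, LinearMap.add_apply, LinearMap.comp_apply, map_add, coR_rTensor_inl, coR_rTensor_inr,
    h.coassoc, h2, tmulMul_lTensor_comm]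

end Pair

section BoxCompat

variable {V W : Type*} [AddCommGroup V] [Module K V] [AddCommGroup W] [Module K W]

/-- The tensor product filtration. -/
def filBox (fil : ℕ → Submodule K V) (fil' : ℕ → Submodule K W) (n : ℕ) : Submodule K (V ⊗[K] W) :=
  ⨆ (i : ℕ) (j : ℕ) (_ : i + j ≤ n), Submodule.map₂ (TensorProduct.mk K V W) (fil i) (fil' j)

theorem tmul_mem_filBox {fil : ℕ → Submodule K V} {fil' : ℕ → Submodule K W} {n i j : ℕ} (h : i + j ≤ n)
    {v : V} (hv : v ∈ fil i) {y : W} (hy : y ∈ fil' j) : v ⊗ₜ y ∈ filBox fil fil' n :=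
  (le_iSup_of_le i (le_iSup_of_le j (le_iSup_of_le h le_rfl)) :
    Submodule.map₂ (TensorProduct.mk K V W) (fil i) (fil' j) ≤ filBox fil fil' n)
    (Submodule.apply_mem_map₂ _ hv hy)

theorem filBox_le {fil : ℕ → Submodule K V} {fil' : ℕ → Submodule K W} {n : ℕ}
    {P : Submodule K (V ⊗[K] W)} (h : ∀ i j, i + j ≤ n → ∀ v ∈ fil i, ∀ y ∈ fil' j, v ⊗ₜ y ∈ P) :
    filBox fil fil' n ≤ P :=
  iSup_le fun i => iSup_le fun j => iSup_le fun hij => Submodule.map₂_le.2 (h i j hij)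

theorem filBox_mono (fil : ℕ → Submodule K V) (fil' : ℕ → Submodule K W) : Monotone (filBox fil fil') :=
  fun _ _ hmn => filBox_le fun _ _ hij _ hv _ hy => tmul_mem_filBox (hij.trans hmn) hv hy

theorem map₂_mem_tens {A B C : Type*} [AddCommGroup A] [Module K A] [AddCommGroup B] [Module K B]
    [AddCommGroup C] [Module K C] (f : A →ₗ[K] B →ₗ[K] C)
    {fil : ℕ → Submodule K V} {fil' : ℕ → Submodule K W} {n i j : ℕ} (h : i + j ≤ n)
    {x : A ⊗[K] V} (hx : x ∈ tens K A (fil i)) {y : B ⊗[K] W} (hy : y ∈ tens K B (fil' j)) :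
    TensorProduct.map₂ f (TensorProduct.mk K V W) x y ∈ tens K C (filBox fil fil' n) := by
  refine tens_induction (p := fun x => TensorProduct.map₂ f (TensorProduct.mk K V W) x y ∈
    tens K C (filBox fil fil' n)) hx (by simp) (fun a v hv => ?_)
    (fun x y hx hy => by rw [map_add]; exact add_mem hx hy)
  refine tens_induction (p := fun y => TensorProduct.map₂ f (TensorProduct.mk K V W) (a ⊗ₜ v) y ∈
    tens K C (filBox fil fil' n)) hy (by simp) (fun b w hw => ?_)
    (fun x y hx hy => by rw [map_add]; exact add_mem hx hy)
  rw [map₂_apply_tmul, map_tmul, mk_apply]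
  exact tmul_mem_tens _ (tmul_mem_filBox h hv hw)

theorem IsCompat.box {r : V →ₗ[K] H ⊗[K] V} {t : V →ₗ[K] M ⊗[K] V} {fil : ℕ → Submodule K V}
    {r' : W →ₗ[K] H ⊗[K] W} {t' : W →ₗ[K] M ⊗[K] W} {fil' : ℕ → Submodule K W}
    (h : IsCompat M r t fil) (h' : IsCompat M r' t' fil') :
    IsCompat M (box r r') (boxM r t r' t') (filBox fil fil') where
  coassoc x := (box_compat (Bialgebra.comulAlgHom K H) (fun x => (h.coassoc x).symm)
    (fun x => (h'.coassoc x).symm) x).symm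
  left x := by
    have key := congrArg (((sndL K H M).rTensor _).lTensor H) (box_compat (QuantumSymmetric.coL K H M) h.coL h'.coL x)
    rw [snd_coL, box_pr, snd_pr, ← LinearMap.lTensor_comp_apply] at key
    rw [← key]
    congr 2
    exact (LinearMap.ext (snd_pr _ _)).symm
  right x := by
    have key := congrArg ((sndL K H M).rTensor _) (box_compat (QuantumSymmetric.coR K H M) h.coR h'.coR x)
    rw [snd_coR, box_pr, snd_pr, tmulMul_lTensor_comm, snd_pr] at key
    exact sub_eq_zero.2 key.symm
  mono := filBox_mono _ _
  exh x := by
    induction x with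
    | zero => exact ⟨0, zero_mem _⟩
    | add x y hx hy =>
      obtain ⟨i, hi⟩ := hx
      obtain ⟨j, hj⟩ := hy
      exact ⟨max i j, add_mem (filBox_mono _ _ (le_max_left _ _) hi) (filBox_mono _ _ (le_max_right _ _) hj)⟩
    | tmul v w =>
      obtain ⟨i, hi⟩ := h.exh v
      obtain ⟨j, hj⟩ := h'.exh w
      exact ⟨i + j, tmul_mem_filBox le_rfl hi hj⟩
  r_mem n := filBox_le (P := (tens K H _).comap (QuantumSymmetric.box r r')) fun i j hij v hv w hw => by
    rw [Submodule.mem_comap, box_tmul]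
    exact map₂_mem_tens _ hij (h.r_mem i v hv) (h'.r_mem j w hw)
  t_zero := by
    refine filBox_le (P := LinearMap.ker (boxM r t r' t')) fun i j hij v hv w hw => ?_
    obtain rfl : i = 0 := by omega
    obtain rfl : j = 0 := by omega
    simp [boxM, h.t_zero v hv, h'.t_zero w hw]
  t_mem n := filBox_le (P := (tens K M _).comap (boxM r t r' t')) fun i j hij v hv w hw => by
    rw [Submodule.mem_comap]
    simp only [boxM, lift.tmul, LinearMap.add_apply, LinearMap.compl₁₂_apply]
    refine add_mem ?_ ?_
    · cases j with
      | zero => simp [h'.t_zero w hw]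
      | succ j => exact map₂_mem_tens _ (by omega) (h.r_mem i v hv) (h'.t_mem j w hw)
    · cases i with
      | zero => simp [h.t_zero v hv]
      | succ i => exact map₂_mem_tens _ (by omega) (h.t_mem i v hv) (h'.r_mem j w hw)

end BoxCompat

namespace Cot

variable (K H M) in
/-- The elements of degree at most `n`. -/
noncomputable def fil (n : ℕ) : Submodule K (Cot K H M) := ⨆ (k : ℕ) (_ : k ≤ n), LinearMap.range (of K H M k)

theorem of_mem_fil {k n : ℕ} (h : k ≤ n) (x : (cotPow K H M k).carrier) : of K H M k x ∈ fil K H M n :=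
  (le_iSup_of_le k (le_iSup_of_le h le_rfl) : LinearMap.range (of K H M k) ≤ fil K H M n) ⟨x, rfl⟩

theorem fil_le {n : ℕ} {P : Submodule K (Cot K H M)} (h : ∀ k, k ≤ n → ∀ x, of K H M k x ∈ P) :
    fil K H M n ≤ P :=
  iSup_le fun k => iSup_le fun hk => by rintro _ ⟨x, rfl⟩; exact h k hk x

theorem fil_mono : Monotone (fil K H M) := fun _ _ h => fil_le fun _ hk x => of_mem_fil (hk.trans h) x

theorem of_lTensor_mem {A : Type*} [AddCommGroup A] [Module K A] {k n : ℕ} (h : k ≤ n)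
    (z : A ⊗[K] (cotPow K H M k).carrier) : (of K H M k).lTensor A z ∈ tens K A (fil K H M n) := by
  induction z with
  | zero => simp
  | add x y hx hy => rw [map_add]; exact add_mem hx hy
  | tmul a x => exact tmul_mem_tens _ (of_mem_fil h x)

theorem isCompat : IsCompat M (rho K H M) (tau K H M) (fil K H M) where
  coassoc := rho_coassoc
  left := tau_rho
  right := cotensorMap_tau
  mono := fil_mono
  exh x := by
    induction x using induction_on with
    | h0 => exact ⟨0, zero_mem _⟩
    | hof n x => exact ⟨n, of_mem_fil le_rfl x⟩
    | hadd x y hx hy =>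
      obtain ⟨i, hi⟩ := hx
      obtain ⟨j, hj⟩ := hy
      exact ⟨max i j, add_mem (fil_mono (le_max_left _ _) hi) (fil_mono (le_max_right _ _) hj)⟩
  r_mem n := fil_le (P := (tens K H _).comap (rho K H M)) fun k hk x => by
    rw [Submodule.mem_comap, rho_of]
    exact of_lTensor_mem hk _
  t_zero := fil_le (P := LinearMap.ker (tau K H M)) fun k hk x => by
    obtain rfl : k = 0 := by omega
    exact tau_of_zero x
  t_mem n := fil_le (P := (tens K M _).comap (tau K H M)) fun k hk x => by
    rw [Submodule.mem_comap]
    cases k with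
    | zero => rw [tau_of_zero]; exact zero_mem _
    | succ k => rw [tau_of_succ]; exact of_lTensor_mem (by omega) _

theorem split_comp (n : ℕ) (x : Cot K H M) :
    split K H M n (comp K H M (n + 1) x) = (comp K H M n).lTensor M (tau K H M x) := by
  induction x using induction_on with
  | h0 => simp
  | hadd x y hx hy => simp only [map_add, hx, hy]
  | hof k x =>
    cases k with
    | zero => rw [tau_of_zero, comp_of_ne (by omega), map_zero, map_zero]
    | succ k =>
      rw [tau_of_succ]
      by_cases hk : k = n
      · subst hk
        have : comp K H M k ∘ₗ of K H M k = LinearMap.id := by ext x; simp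
        rw [comp_of_self, ← LinearMap.lTensor_comp_apply, this]
        simp
      · have : comp K H M n ∘ₗ of K H M k = 0 := by ext x; simp [comp_of_ne hk]
        rw [comp_of_ne (by omega), ← LinearMap.lTensor_comp_apply, this]
        simp

theorem eq_zero_of_comp {Z : Type*} [AddCommGroup Z] [Module K Z] (v : Cot K H M ⊗[K] Z)
    (h : ∀ n, (comp K H M n).rTensor Z v = 0) : v = 0 := by
  have key : ∃ N, ∀ n, N ≤ n → v = ∑ k ∈ Finset.range n,
      (of K H M k).rTensor Z ((comp K H M k).rTensor Z v) := by
    clear h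
    induction v with
    | zero => exact ⟨0, by simp⟩
    | add x y hx hy =>
      obtain ⟨i, hi⟩ := hx
      obtain ⟨j, hj⟩ := hy
      refine ⟨max i j, fun n hn => ?_⟩
      simp only [map_add, Finset.sum_add_distrib]
      rw [← hi n (by omega), ← hj n (by omega)]
    | tmul x z =>
      induction x using induction_on with
      | h0 => exact ⟨0, by simp⟩
      | hadd x y hx hy =>
        obtain ⟨i, hi⟩ := hx
        obtain ⟨j, hj⟩ := hy
        refine ⟨max i j, fun n hn => ?_⟩
        simp only [add_tmul, map_add, Finset.sum_add_distrib]
        rw [← hi n (by omega), ← hj n (by omega)]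
      | hof k x =>
        refine ⟨k + 1, fun n hn => ?_⟩
        rw [Finset.sum_eq_single k]
        · simp
        · intro m _ hm
          simp [comp_of_ne hm.symm]
        · intro hk
          exact absurd (Finset.mem_range.2 (by omega)) hk
  obtain ⟨N, hN⟩ := key
  rw [hN N le_rfl]
  simp [h]

variable (K H M) in
/-- The pair `rho`, `tau`. -/
noncomputable def al : Cot K H M →ₗ[K] TrivSqZeroExt H M ⊗[K] Cot K H M := pr (rho K H M) (tau K H M)

/-- Maps into `Cot ⊗ Z` are determined by their component in `H ⊗ Z`. -/
theorem mor_unique {V Z : Type*} [AddCommGroup V] [Module K V] [AddCommGroup Z] [Module K Z]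
    {α : V →ₗ[K] TrivSqZeroExt H M ⊗[K] V} {F G : V →ₗ[K] Cot K H M ⊗[K] Z}
    (hF : IsMor α (ext (al K H M) Z) F) (hG : IsMor α (ext (al K H M) Z) G)
    (h : ∀ x, (p0 K H M).rTensor Z (F x) = (p0 K H M).rTensor Z (G x)) : F = G := by
  have step : ∀ n, ∀ v : Cot K H M ⊗[K] Z, TensorProduct.assoc K M _ Z
      ((split K H M n).rTensor Z ((comp K H M (n + 1)).rTensor Z v)) =
      ((comp K H M n).rTensor Z).lTensor M (ext (tau K H M) Z v) := by
    intro n v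
    induction v with
    | zero => simp only [LinearMap.map_zero, LinearEquiv.map_zero, zero_tmul, tmul_zero, smul_zero, LinearMap.zero_apply]
    | add x y hx hy => simp only [LinearMap.map_add, LinearEquiv.map_add, hx, hy]
    | tmul x z =>
      rw [LinearMap.rTensor_tmul, LinearMap.rTensor_tmul, split_comp, assoc_lTensor]
      rfl
  have ht : ∀ F : V →ₗ[K] Cot K H M ⊗[K] Z, IsMor α (ext (al K H M) Z) F → ∀ x,
      ext (tau K H M) Z (F x) = F.lTensor M ((sndL K H M).rTensor V (α x)) := by
    intro F hF x
    have := congrArg ((sndL K H M).rTensor _) (hF x)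
    rwa [al, ext_pr, snd_pr, tmulMul_lTensor_comm] at this
  have main : ∀ n, (comp K H M n).rTensor Z ∘ₗ F = (comp K H M n).rTensor Z ∘ₗ G := by
    intro n
    induction n with
    | zero => exact LinearMap.ext h
    | succ n ih =>
      ext x
      apply Module.Flat.rTensor_preserves_injective_linearMap (M := Z) _ (split_injective n)
      apply (TensorProduct.assoc K M _ Z).injective
      simp only [LinearMap.comp_apply]
      rw [step, step, ht F hF, ht G hG, ← LinearMap.lTensor_comp_apply, ← LinearMap.lTensor_comp_apply, ih]
  ext x
  rw [← sub_eq_zero]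
  apply eq_zero_of_comp
  intro n
  rw [map_sub, sub_eq_zero]
  exact LinearMap.congr_fun (main n) x

theorem mor_unique' {V : Type*} [AddCommGroup V] [Module K V]
    {α : V →ₗ[K] TrivSqZeroExt H M ⊗[K] V} {F G : V →ₗ[K] Cot K H M}
    (hF : IsMor α (al K H M) F) (hG : IsMor α (al K H M) G)
    (h : ∀ x, p0 K H M (F x) = p0 K H M (G x)) : F = G := by
  have := mor_unique ((isMor_rid_symm _).comp hF) ((isMor_rid_symm _).comp hG)
    (fun x => by simp [h])
  ext x
  exact (TensorProduct.rid K _).symm.injective (LinearMap.congr_fun this x)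

variable (K H M) in
/-- The comultiplication of the cotensor coalgebra, that is, the deconcatenation. It is the unique
linear map `Δ` (see `mor_unique`) whose component in `H ⊗ Cot` is the left coaction (`p0_comulX`)
and which commutes with the left coaction (`rho_comulX`) and with splitting off the first factor
from `M` (`tau_comulX`). -/
noncomputable def comulX : Cot K H M →ₗ[K] Cot K H M ⊗[K] Cot K H M :=
  (exists_coaction (isCompat (K := K) (H := H) (M := M))).choose

theorem p0_comulX (x : Cot K H M) : (p0 K H M).rTensor _ (comulX K H M x) = rho K H M x :=
  (exists_coaction isCompat).choose_spec.1 x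

theorem rho_comulX : IsMor (rho K H M) (ext (rho K H M) _) (comulX K H M) :=
  (exists_coaction isCompat).choose_spec.2.1

theorem tau_comulX : IsMor (tau K H M) (ext (tau K H M) _) (comulX K H M) :=
  (exists_coaction isCompat).choose_spec.2.2.1

theorem comulX_mem (n : ℕ) (x : Cot K H M) (hx : x ∈ fil K H M n) :
    comulX K H M x ∈ tens K (Cot K H M) (fil K H M n) :=
  (exists_coaction isCompat).choose_spec.2.2.2 n x hx

theorem isMor_comulX : IsMor (al K H M) (ext (al K H M) _) (comulX K H M) := by
  rw [al, ext_pr]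
  exact isMor_pr.2 ⟨rho_comulX, tau_comulX⟩

variable (K H M) in
/-- The counit of the cotensor coalgebra. -/
noncomputable def counitX : Cot K H M →ₗ[K] K := Coalgebra.counit ∘ₗ p0 K H M

noncomputable instance : Coalgebra K (Cot K H M) where
  comul := comulX K H M
  counit := counitX K H M
  coassoc := by
    refine mor_unique ((isMor_ext_assoc _ _ _).comp ((isMor_ext_rTensor isMor_comulX _).comp
      isMor_comulX)) ((isMor_ext_lTensor _ _).comp isMor_comulX) fun x => ?_
    simp only [LinearMap.comp_apply, LinearEquiv.coe_coe]
    have h1 : ∀ z : Cot K H M ⊗[K] Cot K H M, (p0 K H M).rTensor _ (TensorProduct.assoc K _ _ _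
        ((comulX K H M).rTensor _ z)) = ext (rho K H M) _ z := by
      intro z
      induction z with
      | zero => simp only [LinearMap.map_zero, LinearEquiv.map_zero, zero_tmul, tmul_zero, smul_zero, LinearMap.zero_apply]
      | add x y hx hy => simp only [LinearMap.map_add, LinearEquiv.map_add, hx, hy]
      | tmul a b => rw [LinearMap.rTensor_tmul, ← assoc_rTensor, p0_comulX]; rfl
    rw [h1, tmulMul_lTensor_comm, p0_comulX, rho_comulX]
  rTensor_counit_comp_comul := by
    ext x
    rw [LinearMap.comp_apply, counitX, LinearMap.rTensor_comp_apply, p0_comulX]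
    apply (TensorProduct.lid K _).injective
    rw [rho_counit]
    simp
  lTensor_counit_comp_comul := by
    refine mor_unique ((isMor_ext_lTensor _ _).comp isMor_comulX) (isMor_rid_symm _) fun x => ?_
    rw [LinearMap.comp_apply, tmulMul_lTensor_comm, p0_comulX, counitX, LinearMap.lTensor_comp_apply,
      p0_rho]
    simp

end Cot
end Compat

section Mult

variable {K : Type w} {H M : Type u} [Field K] [Ring H] [HopfAlgebra K H]
  [AddCommGroup M] [Module K M] [Module H M] [Module Hᵐᵒᵖ M]
  [IsScalarTower K H M] [IsScalarTower K Hᵐᵒᵖ M] [SMulCommClass H Hᵐᵒᵖ M]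
  [HopfBimodule K H M]
open HopfBimodule

namespace Cot

theorem isCompat_box : IsCompat M (box (rho K H M) (rho K H M))
    (boxM (rho K H M) (tau K H M) (rho K H M) (tau K H M)) (filBox (fil K H M) (fil K H M)) :=
  isCompat.box isCompat

variable (K H M) in
/-- The multiplication of the cotensor Hopf algebra: the coalgebra morphism `Cot ⊗ Cot → Cot`
(`comul_mul'`) whose component in `H` is the product of the components in `H` (`p0_mul`) and whose
component in `M` is given by the actions of `H` on `M` (`p1_mul`). These properties determine it,
by the universal property of the cotensor coalgebra. -/
noncomputable def mulX : Cot K H M ⊗[K] Cot K H M →ₗ[K] Cot K H M :=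
  (TensorProduct.rid K _).toLinearMap ∘ₗ
    (LinearMap.lTensor _ (Coalgebra.counit (R := K) (A := Cot K H M ⊗[K] Cot K H M))) ∘ₗ
      (exists_coaction (isCompat_box (K := K) (H := H) (M := M))).choose

theorem isMor_mulX : IsMor (box (al K H M) (al K H M)) (al K H M) (mulX K H M) := by
  refine (isMor_ext_rid _).comp ((isMor_ext_lTensor _ _).comp ?_)
  rw [al, box_pr, ext_pr]
  have h := (exists_coaction (isCompat_box (K := K) (H := H) (M := M))).choose_spec
  exact isMor_pr.2 ⟨h.2.1, h.2.2.1⟩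

theorem counit_eq (x : Cot K H M) :
    Coalgebra.counit (R := K) x = Coalgebra.counit (R := K) (p0 K H M x) := rfl

theorem p0_mulX (x y : Cot K H M) : p0 K H M (mulX K H M (x ⊗ₜ y)) = p0 K H M x * p0 K H M y := by
  have h := (exists_coaction (isCompat_box (K := K) (H := H) (M := M))).choose_spec.1 (x ⊗ₜ y)
  have h1 : ∀ z : Cot K H M ⊗[K] (Cot K H M ⊗[K] Cot K H M),
      p0 K H M (TensorProduct.rid K _ (Coalgebra.counit.lTensor _ z)) =
      TensorProduct.rid K _ (Coalgebra.counit.lTensor _ ((p0 K H M).rTensor _ z)) := by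
    intro z
    induction z with
    | zero => simp only [LinearMap.map_zero, LinearEquiv.map_zero, zero_tmul, tmul_zero, smul_zero, LinearMap.zero_apply]
    | add x y hx hy => simp only [LinearMap.map_add, LinearEquiv.map_add, hx, hy]
    | tmul a b => simp
  have h2 : ∀ u v : H ⊗[K] Cot K H M, TensorProduct.rid K _ (Coalgebra.counit.lTensor _
      (tmulMul K H (Cot K H M) (Cot K H M) u v)) =
      TensorProduct.rid K _ (Coalgebra.counit.lTensor H u) *
      TensorProduct.rid K _ (Coalgebra.counit.lTensor H v) :=
    bilin_ext (F := (tmulMul K H (Cot K H M) (Cot K H M)).compr₂ ((TensorProduct.rid K _).toLinearMap ∘ₗ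
        (Coalgebra.counit (R := K) (A := Cot K H M ⊗[K] Cot K H M)).lTensor H))
      (G := (LinearMap.mul K H).compl₁₂ ((TensorProduct.rid K _).toLinearMap ∘ₗ
        (Coalgebra.counit (R := K) (A := Cot K H M)).lTensor H) ((TensorProduct.rid K _).toLinearMap ∘ₗ
        (Coalgebra.counit (R := K) (A := Cot K H M)).lTensor H))
      (by intros; simp [smul_smul, mul_comm])
  have h3 : ∀ x : Cot K H M, TensorProduct.rid K _ (Coalgebra.counit.lTensor H (rho K H M x)) = p0 K H M x := by
    intro x
    have : (Coalgebra.counit (R := K) (A := Cot K H M)) = Coalgebra.counit ∘ₗ p0 K H M := rfl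
    rw [this, LinearMap.lTensor_comp_apply, p0_rho]
    simp
  rw [mulX, LinearMap.comp_apply, LinearMap.comp_apply, LinearEquiv.coe_coe, h1, h, box_tmul, h2, h3, h3]

noncomputable instance : Mul (Cot K H M) := ⟨fun x y => mulX K H M (x ⊗ₜ y)⟩

noncomputable instance : One (Cot K H M) := ⟨i0 K H M 1⟩

theorem mul_def (x y : Cot K H M) : x * y = mulX K H M (x ⊗ₜ y) := rfl

theorem one_def : (1 : Cot K H M) = i0 K H M 1 := rfl

theorem p0_mul (x y : Cot K H M) : p0 K H M (x * y) = p0 K H M x * p0 K H M y := p0_mulX x y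

theorem rho_one : rho K H M 1 = 1 ⊗ₜ 1 := by
  have : rho K H M (i0 K H M 1) = (i0 K H M).lTensor H (Coalgebra.comul 1) := rho_of 0 _
  rw [one_def, this, Bialgebra.comul_one, Algebra.TensorProduct.one_def, LinearMap.lTensor_tmul]

theorem al_one : al K H M 1 = 1 ⊗ₜ 1 := by
  have h2 : tau K H M 1 = 0 := tau_i0 1
  simp [al, pr, rho_one, h2]

theorem isMor_one : IsMor (unitDat K (TrivSqZeroExt H M)) (al K H M)
    (LinearMap.toSpanSingleton K _ (1 : Cot K H M)) := by
  intro c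
  simp [unitDat, al_one]

theorem mul_assoc' (x y z : Cot K H M) : x * y * z = x * (y * z) := by
  have := mor_unique' (isMor_mulX.comp (isMor_box isMor_mulX (isMor_id (al K H M))))
    (isMor_mulX.comp ((isMor_box (isMor_id (al K H M)) isMor_mulX).comp (isMor_box_assoc _ _ _)))
    (fun w => by
      induction w with
      | zero => simp only [LinearMap.map_zero, LinearEquiv.map_zero, zero_tmul, tmul_zero, smul_zero, LinearMap.zero_apply]
      | add x y hx hy => simp only [LinearMap.map_add, LinearEquiv.map_add, hx, hy]
      | tmul w z =>
        induction w with
        | zero => simp only [LinearMap.map_zero, LinearEquiv.map_zero, zero_tmul, tmul_zero, smul_zero, LinearMap.zero_apply]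
        | add x y hx hy => simp only [LinearMap.map_add, LinearEquiv.map_add, add_tmul, hx, hy]
        | tmul x y => simp [p0_mulX, mul_assoc])
  exact LinearMap.congr_fun this (x ⊗ₜ y ⊗ₜ z)

theorem p0_one : p0 K H M 1 = 1 := p0_i0 1

theorem one_mul' (x : Cot K H M) : 1 * x = x := by
  have := mor_unique' (isMor_mulX.comp (isMor_box isMor_one (isMor_id (al K H M))))
    (isMor_box_lid (al K H M)) (fun w => by
      induction w with
      | zero => simp only [LinearMap.map_zero, LinearEquiv.map_zero, zero_tmul, tmul_zero, smul_zero, LinearMap.zero_apply]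
      | add x y hx hy => simp only [LinearMap.map_add, LinearEquiv.map_add, hx, hy]
      | tmul c x => simp [p0_mulX, p0_one])
  have h := LinearMap.congr_fun this ((1 : K) ⊗ₜ x)
  simp only [LinearMap.comp_apply, map_tmul, LinearMap.toSpanSingleton_apply, one_smul, LinearMap.id_apply,
    LinearEquiv.coe_coe, lid_tmul] at h
  exact h

theorem mul_one' (x : Cot K H M) : x * 1 = x := by
  have := mor_unique' (isMor_mulX.comp (isMor_box (isMor_id (al K H M)) isMor_one))
    (isMor_box_rid (al K H M)) (fun w => by
      induction w with
      | zero => simp only [LinearMap.map_zero, LinearEquiv.map_zero, zero_tmul, tmul_zero, smul_zero, LinearMap.zero_apply]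
      | add x y hx hy => simp only [LinearMap.map_add, LinearEquiv.map_add, hx, hy]
      | tmul x c => simp [p0_mulX, p0_one])
  have h := LinearMap.congr_fun this (x ⊗ₜ (1 : K))
  simp only [LinearMap.comp_apply, map_tmul, LinearMap.toSpanSingleton_apply, one_smul, LinearMap.id_apply,
    LinearEquiv.coe_coe, rid_tmul] at h
  exact h

noncomputable instance : Ring (Cot K H M) :=
  { (inferInstance : AddCommGroup (Cot K H M)) with
    mul := (· * ·)
    one := 1
    left_distrib := fun a b c => by simp only [mul_def, tmul_add, map_add]
    right_distrib := fun a b c => by simp only [mul_def, add_tmul, map_add]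
    zero_mul := fun a => by simp only [mul_def, zero_tmul, map_zero]
    mul_zero := fun a => by simp only [mul_def, tmul_zero, map_zero]
    mul_assoc := mul_assoc'
    one_mul := one_mul'
    mul_one := mul_one' }

noncomputable instance : Algebra K (Cot K H M) :=
  Algebra.ofModule (fun c x y => by
      change mulX K H M ((c • x) ⊗ₜ y) = c • mulX K H M (x ⊗ₜ y)
      rw [← smul_tmul', map_smul])
    (fun c x y => by
      change mulX K H M (x ⊗ₜ (c • y)) = c • mulX K H M (x ⊗ₜ y)
      rw [tmul_smul, map_smul])

theorem rho_mul (x y : Cot K H M) : rho K H M (x * y) = rho K H M x * rho K H M y := by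
  have h := isMor_mulX (K := K) (H := H) (M := M)
  rw [al, box_pr] at h
  have := (isMor_pr.1 h).1 (x ⊗ₜ y)
  rw [box_tmul] at this
  refine Eq.trans this ?_
  exact bilin_ext (F := (tmulMul K H (Cot K H M) (Cot K H M)).compr₂ ((mulX K H M).lTensor H))
    (G := LinearMap.mul K (H ⊗[K] Cot K H M)) (by intros; simp [mul_def]) _ _

theorem tau_mul (x y : Cot K H M) : tau K H M (x * y) =
    TensorProduct.map₂ (lact K H M) (LinearMap.mul K (Cot K H M)) (rho K H M x) (tau K H M y) +
    TensorProduct.map₂ (ract K H M) (LinearMap.mul K (Cot K H M)) (tau K H M x) (rho K H M y) := by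
  have h := isMor_mulX (K := K) (H := H) (M := M)
  rw [al, box_pr] at h
  have := (isMor_pr.1 h).2 (x ⊗ₜ y)
  rw [boxM, lift.tmul, LinearMap.add_apply, LinearMap.add_apply, map_add] at this
  refine Eq.trans this ?_
  congr 1
  · exact bilin_ext (F := (TensorProduct.map₂ (lact K H M) (TensorProduct.mk K _ _)).compr₂
        ((mulX K H M).lTensor M))
      (G := TensorProduct.map₂ (lact K H M) (LinearMap.mul K (Cot K H M)))
      (by intros; simp [mul_def]) _ _
  · exact bilin_ext (F := (TensorProduct.map₂ (ract K H M) (TensorProduct.mk K _ _)).compr₂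
        ((mulX K H M).lTensor M))
      (G := TensorProduct.map₂ (ract K H M) (LinearMap.mul K (Cot K H M)))
      (by intros; simp [mul_def]) _ _

variable (K H M) in
/-- The projection to `M`. -/
noncomputable def p1 : Cot K H M →ₗ[K] M := comp K H M 1

theorem p1_eq (x : Cot K H M) :
    p1 K H M x = TensorProduct.rid K M ((counitX K H M).lTensor M (tau K H M x)) := by
  induction x using induction_on with
  | h0 => simp
  | hadd x y hx hy => simp only [map_add, hx, hy]
  | hof n x =>
    match n with
    | 0 => rw [tau_of_zero, map_zero, map_zero]; exact comp_of_ne (by omega) x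
    | 1 =>
      have h1 : (counitX K H M).comp (i0 K H M) = Coalgebra.counit := by
        ext a; simp [counitX]
      refine (comp_of_self 1 x).trans ?_
      rw [tau_of_succ, ← LinearMap.lTensor_comp_apply]
      refine (coactR_counit (K := K) (H := H) (M := M) x).symm.trans ?_
      rw [← h1]
      rfl
    | n + 2 =>
      have h1 : (counitX K H M).comp (of K H M (n + 1)) = 0 := by
        ext a; simp [counitX, p0_of_succ]
      rw [tau_of_succ, ← LinearMap.lTensor_comp_apply, h1]
      rw [LinearMap.lTensor_zero, LinearMap.zero_apply, map_zero]
      exact comp_of_ne (by omega) x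

/-- The component in `M` of a product. -/
theorem p1_mul (x y : Cot K H M) : p1 K H M (x * y) =
    p0 K H M x • p1 K H M y + MulOpposite.op (p0 K H M y) • p1 K H M x := by
  have hc : ∀ z, TensorProduct.rid K H ((counitX K H M).lTensor H (rho K H M z)) = p0 K H M z := by
    intro z
    rw [counitX, LinearMap.lTensor_comp_apply, p0_rho]
    simp
  have hm : ∀ a b : Cot K H M, counitX K H M (a * b) = counitX K H M a * counitX K H M b := by
    intro a b
    simp [counitX, p0_mul]
  rw [p1_eq, p1_eq, p1_eq, tau_mul, map_add, map_add, ← hc x, ← hc y]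
  congr 1
  · exact bilin_ext (F := (TensorProduct.map₂ (lact K H M) (LinearMap.mul K (Cot K H M))).compr₂
        ((TensorProduct.rid K M).toLinearMap ∘ₗ (counitX K H M).lTensor M))
      (G := (lact K H M).compl₁₂ ((TensorProduct.rid K H).toLinearMap ∘ₗ (counitX K H M).lTensor H)
        ((TensorProduct.rid K M).toLinearMap ∘ₗ (counitX K H M).lTensor M))
      (by
        intro a v b w
        simp only [LinearMap.compr₂_apply, LinearMap.compl₁₂_apply, map₂_apply_tmul, lact_apply,
          LinearMap.mul_apply', map_tmul, LinearMap.comp_apply, LinearMap.lTensor_tmul, LinearEquiv.coe_coe, rid_tmul, hm]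
        rw [smul_assoc, mul_smul, smul_algebra_smul_comm (counitX K H M w) a b]) _ _
  · exact bilin_ext (F := (TensorProduct.map₂ (ract K H M) (LinearMap.mul K (Cot K H M))).compr₂
        ((TensorProduct.rid K M).toLinearMap ∘ₗ (counitX K H M).lTensor M))
      (G := (ract K H M).compl₁₂ ((TensorProduct.rid K M).toLinearMap ∘ₗ (counitX K H M).lTensor M)
        ((TensorProduct.rid K H).toLinearMap ∘ₗ (counitX K H M).lTensor H))
      (by
        intro a v b w
        simp only [LinearMap.compr₂_apply, LinearMap.compl₁₂_apply, map₂_apply_tmul, ract_apply,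
          LinearMap.mul_apply', map_tmul, LinearMap.comp_apply, LinearMap.lTensor_tmul, LinearEquiv.coe_coe, rid_tmul, hm]
        rw [MulOpposite.op_smul, smul_assoc, mul_comm, mul_smul,
          smul_algebra_smul_comm (counitX K H M v) (MulOpposite.op b) a]) _ _

theorem comul_def' : (Coalgebra.comul : Cot K H M →ₗ[K] _) = comulX K H M := rfl

theorem comul_mul' (x y : Cot K H M) :
    Coalgebra.comul (R := K) (x * y) = Coalgebra.comul (R := K) x * Coalgebra.comul (R := K) y := by
  have key : ∀ u v : Cot K H M ⊗[K] Cot K H M, u * v = TensorProduct.map (mulX K H M) (mulX K H M)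
      (TensorProduct.tensorTensorTensorComm K _ _ _ _ (u ⊗ₜ v)) :=
    bilin_ext (F := LinearMap.mul K (Cot K H M ⊗[K] Cot K H M))
      (G := (TensorProduct.mk K _ _).compr₂ (TensorProduct.map (mulX K H M) (mulX K H M) ∘ₗ
        (TensorProduct.tensorTensorTensorComm K _ _ _ _).toLinearMap)) (by intros; simp [mul_def])
  have hm : TensorProduct.map (mulX K H M) (mulX K H M) =
      (mulX K H M).rTensor _ ∘ₗ (mulX K H M).lTensor _ := by
    rw [LinearMap.rTensor_comp_lTensor]
  have := mor_unique (isMor_comulX.comp isMor_mulX)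
    ((((isMor_ext_rTensor isMor_mulX _).comp (isMor_ext_lTensor _ (mulX K H M))).comp
      (isMor_box_comm _ _ _ _)).comp (isMor_box isMor_comulX isMor_comulX)) (fun w => by
      induction w with
      | zero => simp only [LinearMap.map_zero, LinearEquiv.map_zero, zero_tmul, tmul_zero, smul_zero, LinearMap.zero_apply]
      | add x y hx hy => simp only [LinearMap.map_add, LinearEquiv.map_add, hx, hy]
      | tmul x y =>
        rw [← hm]
        simp only [LinearMap.comp_apply, map_tmul, LinearEquiv.coe_coe]
        rw [← key, p0_comulX]
        refine (rho_mul x y).trans ?_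
        rw [← p0_comulX, ← p0_comulX]
        exact bilin_ext (F := (LinearMap.mul K (H ⊗[K] Cot K H M)).compl₁₂ ((p0 K H M).rTensor _)
            ((p0 K H M).rTensor _))
          (G := (LinearMap.mul K (Cot K H M ⊗[K] Cot K H M)).compr₂ ((p0 K H M).rTensor _))
          (by intros; simp [p0_mul]) _ _)
  have := LinearMap.congr_fun this (x ⊗ₜ y)
  rw [← hm] at this
  refine Eq.trans this ?_
  exact (key _ _).symm

theorem comul_one' : Coalgebra.comul (R := K) (1 : Cot K H M) = 1 := by
  have h := decomp (comulX K H M 1)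
  rw [p0_comulX, tau_comulX] at h
  have h2 : tau K H M 1 = 0 := tau_i0 1
  rw [h2, rho_one] at h
  simp only [map_zero, add_zero, LinearMap.rTensor_tmul] at h
  exact h.symm

noncomputable instance : Bialgebra K (Cot K H M) :=
  Bialgebra.mk' K (Cot K H M) (by rw [counit_eq, p0_one]; simp)
    (by intro a b; rw [counit_eq, p0_mul]; simp [counit_eq]) comul_one' (comul_mul' _ _)

variable (K H M) in
/-- The comultiplication in degree `0` is that of `H`. -/
theorem comul_i0 (h : H) : Coalgebra.comul (R := K) (i0 K H M h) =
    TensorProduct.map (i0 K H M) (i0 K H M) (Coalgebra.comul (R := K) h) := by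
  have h' := decomp (comulX K H M (i0 K H M h))
  rw [p0_comulX, tau_comulX, tau_i0] at h'
  simp only [map_zero, add_zero] at h'
  refine h'.symm.trans ?_
  have : rho K H M (i0 K H M h) = (i0 K H M).lTensor H (Coalgebra.comul h) := rho_of 0 _
  rw [this, ← LinearMap.comp_apply, LinearMap.rTensor_comp_lTensor]

/-- The comultiplication in degree `1` is the sum of the two coactions. -/
theorem comul_i1 (m : M) : Coalgebra.comul (R := K) (i1 K H M m) =
    TensorProduct.map (i0 K H M) (i1 K H M) (coactL m) +
    TensorProduct.map (i1 K H M) (i0 K H M) (coactR m) := by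
  have h' := decomp (comulX K H M (i1 K H M m))
  have h1 : tau K H M (i1 K H M m) = (i0 K H M).lTensor M (coactR m) := tau_of_succ 0 _
  have h2 : rho K H M (i1 K H M m) = (i1 K H M).lTensor H (coactL m) := rho_of 1 _
  rw [p0_comulX, tau_comulX, h1, h2] at h'
  refine h'.symm.trans ?_
  congr 1
  · rw [← LinearMap.comp_apply, LinearMap.rTensor_comp_lTensor]
  · have h3 : ∀ z : H, comulX K H M (i0 K H M z) = TensorProduct.map (i0 K H M) (i0 K H M)
      (Coalgebra.comul (R := K) z) := comul_i0 K H M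
    rw [← LinearMap.lTensor_comp_apply]
    have h4 : comulX K H M ∘ₗ i0 K H M = TensorProduct.map (i0 K H M) (i0 K H M) ∘ₗ
      Coalgebra.comul (R := K) := LinearMap.ext h3
    rw [h4, LinearMap.lTensor_comp_apply, ← coactR_coassoc]
    have h5 : ∀ z : (M ⊗[K] H) ⊗[K] H, (kap K H M).rTensor _ ((TensorProduct.assoc K M _ _).symm
        ((TensorProduct.map (i0 K H M) (i0 K H M)).lTensor M (TensorProduct.assoc K M H H z))) =
        TensorProduct.map (kap K H M ∘ₗ (i0 K H M).lTensor M) (i0 K H M) z := by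
      intro z
      induction z with
      | zero => simp only [LinearMap.map_zero, LinearEquiv.map_zero, zero_tmul, tmul_zero, smul_zero, LinearMap.zero_apply]
      | add x y hx hy => simp only [LinearMap.map_add, LinearEquiv.map_add, hx, hy]
      | tmul z h =>
        induction z with
        | zero => simp only [LinearMap.map_zero, LinearEquiv.map_zero, zero_tmul, tmul_zero, smul_zero, LinearMap.zero_apply]
        | add x y hx hy => simp only [LinearMap.map_add, LinearEquiv.map_add, add_tmul, hx, hy]
        | tmul m h' => simp
    rw [h5, ← LinearMap.comp_apply, LinearMap.map_comp_rTensor]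
    congr 2
    ext m
    have h6 : ∀ z : M ⊗[K] H, kap K H M ((i0 K H M).lTensor M z) = of K H M 1 (retr K H M 0 z) :=
      fun z => kap_of 0 z
    exact (h6 _).trans (congrArg (of K H M 1) (retr_split (K := K) (H := H) (M := M) 0 m))

theorem eq_of_p0_tau {x y : Cot K H M} (h0 : p0 K H M x = p0 K H M y) (h1 : tau K H M x = tau K H M y) :
    x = y := by
  rw [← i0_p0_add_kap_tau x, ← i0_p0_add_kap_tau y, h0, h1]

theorem tau_i1 (m : M) : tau K H M (i1 K H M m) = (i0 K H M).lTensor M (coactR m) := tau_of_succ 0 _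

theorem rho_i0 (h : H) : rho K H M (i0 K H M h) = (i0 K H M).lTensor H (Coalgebra.comul h) := rho_of 0 _

theorem p0_i1 (m : M) : p0 K H M (i1 K H M m) = 0 := p0_of_succ 0 _

theorem i0_mul_i0 (h h' : H) : i0 K H M h * i0 K H M h' = i0 K H M (h * h') :=
  eq_of_p0_tau (by rw [p0_mul, p0_i0, p0_i0, p0_i0]) (by simp [tau_mul])

theorem i0_mul_i1 (h : H) (m : M) : i0 K H M h * i1 K H M m = i1 K H M (h • m) := by
  refine eq_of_p0_tau (by rw [p0_mul, p0_i1, p0_i1, mul_zero]) ?_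
  rw [tau_mul, tau_i0, map_zero, LinearMap.zero_apply, add_zero, tau_i1, tau_i1, rho_i0, coactR_smul]
  exact bilin_ext (F := (TensorProduct.map₂ (lact K H M) (LinearMap.mul K (Cot K H M))).compl₁₂
      ((i0 K H M).lTensor H) ((i0 K H M).lTensor M))
    (G := (TensorProduct.map₂ (lact K H M) (LinearMap.mul K H)).compr₂ ((i0 K H M).lTensor M))
    (by intros; simp [i0_mul_i0]) _ _

theorem i1_mul_i0 (m : M) (h : H) : i1 K H M m * i0 K H M h = i1 K H M (MulOpposite.op h • m) := by
  refine eq_of_p0_tau (by rw [p0_mul, p0_i1, p0_i1, zero_mul]) ?_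
  rw [tau_mul, tau_i0, map_zero, zero_add, tau_i1, tau_i1, rho_i0, coactR_op_smul]
  exact bilin_ext (F := (TensorProduct.map₂ (ract K H M) (LinearMap.mul K (Cot K H M))).compl₁₂
      ((i0 K H M).lTensor M) ((i0 K H M).lTensor H))
    (G := (TensorProduct.map₂ (ract K H M) (LinearMap.mul K H)).compr₂ ((i0 K H M).lTensor M))
    (by intros; simp [i0_mul_i0]) _ _

end Cot
end Mult

section SubHopf

variable {K B : Type*} [Field K] [Ring B] [HopfAlgebra K B] (S : Subalgebra K B)

theorem map_val_injective : Function.Injective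
    (TensorProduct.map S.val.toLinearMap S.val.toLinearMap : S ⊗[K] S →ₗ[K] B ⊗[K] B) :=
  TensorProduct.map_injective_of_flat_flat _ _ Subtype.val_injective Subtype.val_injective

/-- A subalgebra is a sub-Hopf algebra if the comultiplication maps it to its tensor square and
the antipode maps it to itself. -/
structure IsSubHopf : Prop where
  comul_mem : ∀ x ∈ S, Coalgebra.comul (R := K) x ∈ LinearMap.range
    (TensorProduct.map S.val.toLinearMap S.val.toLinearMap : S ⊗[K] S →ₗ[K] B ⊗[K] B)
  antipode_mem : ∀ x ∈ S, HopfAlgebra.antipode K x ∈ S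

variable {S}

/-- The restriction of the comultiplication. -/
noncomputable def subComul (h : IsSubHopf S) : S →ₗ[K] S ⊗[K] S :=
  (LinearEquiv.ofInjective _ (map_val_injective S)).symm.toLinearMap ∘ₗ
    (Coalgebra.comul ∘ₗ S.val.toLinearMap).codRestrict _ (fun x => h.comul_mem x.1 x.2)

theorem map_subComul (h : IsSubHopf S) (x : S) :
    TensorProduct.map S.val.toLinearMap S.val.toLinearMap (subComul h x) =
      Coalgebra.comul (R := K) (x : B) := by
  have := LinearEquiv.apply_symm_apply (LinearEquiv.ofInjective _ (map_val_injective S))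
    ((Coalgebra.comul ∘ₗ S.val.toLinearMap).codRestrict _ (fun x => h.comul_mem x.1 x.2) x)
  exact congrArg Subtype.val this

theorem coassoc_of_injective {V : Type*} [AddCommGroup V] [Module K V] (i : V →ₗ[K] B)
    (hi : Function.Injective i) (D : V →ₗ[K] V ⊗[K] V)
    (hD : ∀ x, TensorProduct.map i i (D x) = Coalgebra.comul (R := K) (i x)) :
    (TensorProduct.assoc K V V V).toLinearMap ∘ₗ D.rTensor V ∘ₗ D = D.lTensor V ∘ₗ D := by
  ext x
  apply (TensorProduct.map_injective_of_flat_flat _ _ hi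
    (TensorProduct.map_injective_of_flat_flat _ _ hi hi) :
      Function.Injective (TensorProduct.map i (TensorProduct.map i i)))
  have h1 : ∀ z : V ⊗[K] V, TensorProduct.map i (TensorProduct.map i i)
      (TensorProduct.assoc K V V V (D.rTensor V z)) =
      TensorProduct.assoc K B B B (Coalgebra.comul.rTensor B (TensorProduct.map i i z)) := by
    intro z
    induction z with
    | zero => simp only [LinearMap.map_zero, LinearEquiv.map_zero, zero_tmul, tmul_zero, smul_zero, LinearMap.zero_apply]
    | add x y hx hy => simp only [LinearMap.map_add, LinearEquiv.map_add, hx, hy]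
    | tmul a b =>
      rw [map_tmul, LinearMap.rTensor_tmul, LinearMap.rTensor_tmul, ← hD]
      induction D a with
      | zero => simp only [LinearMap.map_zero, LinearEquiv.map_zero, zero_tmul, tmul_zero, smul_zero, LinearMap.zero_apply]
      | add x y hx hy => simp only [LinearMap.map_add, LinearEquiv.map_add, add_tmul, hx, hy]
      | tmul a b => simp
  have h2 : ∀ z : V ⊗[K] V, TensorProduct.map i (TensorProduct.map i i) (D.lTensor V z) =
      Coalgebra.comul.lTensor B (TensorProduct.map i i z) := by
    intro z
    induction z with
    | zero => simp only [LinearMap.map_zero, LinearEquiv.map_zero, zero_tmul, tmul_zero, smul_zero, LinearMap.zero_apply]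
    | add x y hx hy => simp only [LinearMap.map_add, LinearEquiv.map_add, hx, hy]
    | tmul a b => rw [map_tmul, LinearMap.lTensor_tmul, LinearMap.lTensor_tmul, map_tmul, hD]
  simp only [LinearMap.comp_apply, LinearEquiv.coe_coe]
  rw [h1, h2, hD]
  exact Coalgebra.coassoc_apply _

/-- The Hopf algebra structure on a sub-Hopf algebra, given by restriction. -/
noncomputable abbrev subHopf (h : IsSubHopf S) : HopfAlgebra K S :=
  letI : Coalgebra K S :=
    { comul := subComul h
      counit := Coalgebra.counit ∘ₗ S.val.toLinearMap
      coassoc := coassoc_of_injective S.val.toLinearMap Subtype.val_injective _ (map_subComul h)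
      rTensor_counit_comp_comul := by
        ext x
        apply (TensorProduct.lid K S).injective
        apply Subtype.val_injective
        have h1 : ∀ z : S ⊗[K] S, ((TensorProduct.lid K S
            ((Coalgebra.counit ∘ₗ S.val.toLinearMap).rTensor S z) : S) : B) = TensorProduct.lid K B
            (Coalgebra.counit.rTensor B (TensorProduct.map S.val.toLinearMap S.val.toLinearMap z)) := by
          intro z
          induction z with
          | zero => simp
          | add x y hx hy => simp only [LinearMap.map_add, LinearEquiv.map_add, hx, hy, Subalgebra.coe_add]
          | tmul a b => simp
        rw [LinearMap.comp_apply, h1, map_subComul]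
        simp
      lTensor_counit_comp_comul := by
        ext x
        apply (TensorProduct.rid K S).injective
        apply Subtype.val_injective
        have h1 : ∀ z : S ⊗[K] S, ((TensorProduct.rid K S
            ((Coalgebra.counit ∘ₗ S.val.toLinearMap).lTensor S z) : S) : B) = TensorProduct.rid K B
            (Coalgebra.counit.lTensor B (TensorProduct.map S.val.toLinearMap S.val.toLinearMap z)) := by
          intro z
          induction z with
          | zero => simp
          | add x y hx hy => simp only [LinearMap.map_add, LinearEquiv.map_add, hx, hy, Subalgebra.coe_add]
          | tmul a b => simp
        rw [LinearMap.comp_apply, h1, map_subComul]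
        simp }
  have key : ∀ z : S ⊗[K] S, TensorProduct.map S.val.toLinearMap S.val.toLinearMap z =
      Algebra.TensorProduct.map S.val S.val z := fun z => rfl
  letI : Bialgebra K S := Bialgebra.mk' K S
    (show Coalgebra.counit (R := K) ((1 : S) : B) = 1 by simp)
    (fun {a b} => show Coalgebra.counit (R := K) ((a * b : S) : B) =
      Coalgebra.counit (R := K) (a : B) * Coalgebra.counit (R := K) (b : B) by simp)
    (by
      apply map_val_injective S
      refine (map_subComul h 1).trans ?_
      rw [key, map_one]; simp)
    (fun {a b} => by
      apply map_val_injective S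
      refine (map_subComul h (a * b)).trans ?_
      rw [key, map_mul, ← key, ← key]
      refine Eq.trans ?_ (congrArg₂ (· * ·) (map_subComul h a) (map_subComul h b)).symm
      simp)
  { antipode := (HopfAlgebra.antipode K (A := B)).restrict (p := Subalgebra.toSubmodule S)
      (q := Subalgebra.toSubmodule S) h.antipode_mem
    mul_antipode_rTensor_comul := by
      ext x
      have h1 : ∀ z : S ⊗[K] S, ((LinearMap.mul' K S (((HopfAlgebra.antipode K (A := B)).restrict
          (p := Subalgebra.toSubmodule S) (q := Subalgebra.toSubmodule S) h.antipode_mem).rTensor S z) : S) : B) =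
          LinearMap.mul' K B ((HopfAlgebra.antipode K (A := B)).rTensor B
            (TensorProduct.map S.val.toLinearMap S.val.toLinearMap z)) := by
        intro z
        induction z with
        | zero => simp
        | add x y hx hy => simp only [LinearMap.map_add, LinearEquiv.map_add, hx, hy, Subalgebra.coe_add]
        | tmul a b => rfl
      refine (h1 _).trans ?_
      rw [show (Coalgebra.comul (R := K) x) = subComul h x from rfl, map_subComul]
      simp
      rfl
    mul_antipode_lTensor_comul := by
      ext x
      have h1 : ∀ z : S ⊗[K] S, ((LinearMap.mul' K S (((HopfAlgebra.antipode K (A := B)).restrict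
          (p := Subalgebra.toSubmodule S) (q := Subalgebra.toSubmodule S) h.antipode_mem).lTensor S z) : S) : B) =
          LinearMap.mul' K B ((HopfAlgebra.antipode K (A := B)).lTensor B
            (TensorProduct.map S.val.toLinearMap S.val.toLinearMap z)) := by
        intro z
        induction z with
        | zero => simp
        | add x y hx hy => simp only [LinearMap.map_add, LinearEquiv.map_add, hx, hy, Subalgebra.coe_add]
        | tmul a b => rfl
      refine (h1 _).trans ?_
      rw [show (Coalgebra.comul (R := K) x) = subComul h x from rfl, map_subComul]
      simp
      rfl }

end SubHopf

section Antipode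

variable {K : Type w} {H M : Type u} [Field K] [Ring H] [HopfAlgebra K H]
  [AddCommGroup M] [Module K M] [Module H M] [Module Hᵐᵒᵖ M]
  [IsScalarTower K H M] [IsScalarTower K Hᵐᵒᵖ M] [SMulCommClass H Hᵐᵒᵖ M]
  [HopfBimodule K H M]
open HopfBimodule WithConv

namespace Cot

variable (K H M) in
/-- The inclusion of `H` as an algebra morphism. -/
noncomputable def i0Hom : H →ₐ[K] Cot K H M :=
  AlgHom.ofLinearMap (i0 K H M) rfl (fun x y => (i0_mul_i0 x y).symm)

theorem conv_mem {S : Subalgebra K (Cot K H M)}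
    (hS : ∀ x ∈ S, Coalgebra.comul (R := K) x ∈ LinearMap.range
      (TensorProduct.map S.val.toLinearMap S.val.toLinearMap :
        S ⊗[K] S →ₗ[K] Cot K H M ⊗[K] Cot K H M))
    {f g : Cot K H M →ₗ[K] Cot K H M} (hf : ∀ x ∈ S, f x ∈ S) (hg : ∀ x ∈ S, g x ∈ S)
    (x : Cot K H M) (hx : x ∈ S) : (toConv f * toConv g) x ∈ S := by
  obtain ⟨z, hz⟩ := hS x hx
  rw [LinearMap.convMul_apply, ← hz]
  clear hz
  induction z with
  | zero => simp
  | add x y hx hy => simp only [LinearMap.map_add, LinearEquiv.map_add]; exact add_mem hx hy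
  | tmul a b => exact mul_mem (hf a a.2) (hg b b.2)

theorem lTensor_tau_congr {n : ℕ} {f g : Cot K H M →ₗ[K] Cot K H M}
    (h : ∀ x ∈ fil K H M n, f x = g x) (x : Cot K H M) (hx : x ∈ fil K H M (n + 1)) :
    (f.lTensor (Cot K H M) ∘ₗ comulX K H M).lTensor M (tau K H M x) =
      (g.lTensor (Cot K H M) ∘ₗ comulX K H M).lTensor M (tau K H M x) := by
  have h1 : ∀ y ∈ fil K H M n, (f.lTensor (Cot K H M) ∘ₗ comulX K H M) y =
      (g.lTensor (Cot K H M) ∘ₗ comulX K H M) y := by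
    intro y hy
    have h2 := comulX_mem n y hy
    exact tens_congr h h2
  have h3 := isCompat.t_mem n x hx
  exact tens_congr h1 h3

theorem exists_conv_inverse (j v : Cot K H M →ₗ[K] Cot K H M)
    (h : ∀ a : H, (toConv j * toConv v) (i0 K H M a) = algebraMap K _ (Coalgebra.counit (R := K) a)) :
    ∃ r : Cot K H M →ₗ[K] Cot K H M, toConv j * toConv r = 1 ∧
      (∀ a, r (i0 K H M a) = v (i0 K H M a)) ∧
      ∀ S : Subalgebra K (Cot K H M), (∀ x ∈ S, Coalgebra.comul (R := K) x ∈ LinearMap.range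
      (TensorProduct.map S.val.toLinearMap S.val.toLinearMap :
        S ⊗[K] S →ₗ[K] Cot K H M ⊗[K] Cot K H M)) → (∀ x ∈ S, j x ∈ S) → (∀ x ∈ S, v x ∈ S) →
        ∀ x ∈ S, r x ∈ S := by
  let f : WithConv (Cot K H M →ₗ[K] Cot K H M) := 1 - toConv j * toConv v
  have hf : ∀ a, f (i0 K H M a) = 0 := by
    intro a
    change (1 : WithConv (Cot K H M →ₗ[K] Cot K H M)) (i0 K H M a) - (toConv j * toConv v) (i0 K H M a) = 0
    rw [h, LinearMap.convOne_apply, counit_eq, p0_i0, sub_self]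
  let G : ℕ → (Cot K H M →ₗ[K] Cot K H M) := fun n =>
    (fun g : Cot K H M →ₗ[K] Cot K H M => (1 + f * toConv g).ofConv)^[n]
      (1 : WithConv (Cot K H M →ₗ[K] Cot K H M)).ofConv
  have hG : ∀ n, G (n + 1) = (1 + f * toConv (G n)).ofConv := fun n => Function.iterate_succ_apply' _ _ _
  have hGx : ∀ n x, G (n + 1) x = algebraMap K _ (Coalgebra.counit (R := K) x) + (f * toConv (G n)) x := by
    intro n x; rw [hG]; rfl
  have hconv : ∀ (g : Cot K H M →ₗ[K] Cot K H M) x, (f * toConv g) x = LinearMap.mul' K _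
      (f.ofConv.rTensor _ ((kap K H M).rTensor _ ((TensorProduct.assoc K M _ _).symm
        ((g.lTensor _ ∘ₗ comulX K H M).lTensor M (tau K H M x))))) := by
    intro g x
    rw [LinearMap.convMul_apply]
    have h1 := decomp (comulX K H M x)
    rw [p0_comulX, tau_comulX] at h1
    rw [show Coalgebra.comul (R := K) x = comulX K H M x from rfl, ← h1, map_add, map_add]
    have h2 : ∀ z : H ⊗[K] Cot K H M, TensorProduct.map f.ofConv (toConv g).ofConv
        ((i0 K H M).rTensor _ z) = 0 := by
      intro z
      induction z with
      | zero => simp only [LinearMap.map_zero, LinearEquiv.map_zero, zero_tmul, tmul_zero, smul_zero, LinearMap.zero_apply]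
      | add x y hx hy => simp only [LinearMap.map_add, LinearEquiv.map_add, hx, hy, add_zero]
      | tmul a b =>
        have : f.ofConv (i0 K H M a) = 0 := hf a
        simp [this]
    have h3 : ∀ z : M ⊗[K] (Cot K H M ⊗[K] Cot K H M), TensorProduct.map f.ofConv (toConv g).ofConv
        ((kap K H M).rTensor _ ((TensorProduct.assoc K M _ _).symm z)) =
        f.ofConv.rTensor _ ((kap K H M).rTensor _ ((TensorProduct.assoc K M _ _).symm
          ((g.lTensor _).lTensor M z))) := by
      intro z
      induction z with
      | zero => simp only [LinearMap.map_zero, LinearEquiv.map_zero, zero_tmul, tmul_zero, smul_zero, LinearMap.zero_apply]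
      | add x y hx hy => simp only [LinearMap.map_add, LinearEquiv.map_add, hx, hy]
      | tmul a b =>
        induction b with
        | zero => simp only [LinearMap.map_zero, LinearEquiv.map_zero, zero_tmul, tmul_zero, smul_zero, LinearMap.zero_apply]
        | add x y hx hy => simp only [LinearMap.map_add, LinearEquiv.map_add, tmul_add, hx, hy]
        | tmul b c => simp
    rw [h2, map_zero, zero_add, h3, LinearMap.lTensor_comp_apply]
  have stab : ∀ n, ∀ x ∈ fil K H M n, G (n + 1) x = G n x := by
    intro n
    induction n with
    | zero =>
      intro x hx
      rw [hGx, hconv, isCompat.t_zero x hx]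
      simp only [map_zero, add_zero]
      rfl
    | succ n ih =>
      intro x hx
      refine (hGx (n + 1) x).trans (Eq.trans ?_ (hGx n x).symm)
      rw [hconv (G (n + 1)) x, hconv (G n) x]
      have h7 := lTensor_tau_congr ih x hx
      rw [h7]
  obtain ⟨s, hs⟩ := exists_limit (fil K H M) fil_mono isCompat.exh G stab
  have hfix : toConv s = 1 + f * toConv s := by
    ext x
    obtain ⟨n, hn⟩ := isCompat.exh x
    have hn' := fil_mono (Nat.le_succ n) hn
    change s x = algebraMap K _ (Coalgebra.counit (R := K) x) + (f * toConv s) x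
    rw [hs (n + 1) x hn', hGx, LinearMap.convMul_apply, LinearMap.convMul_apply]
    congr 2
    have h4 : ∀ g : Cot K H M →ₗ[K] Cot K H M, ∀ z, TensorProduct.map f.ofConv g z =
        f.ofConv.rTensor _ (g.lTensor _ z) := by
      intro g z
      rw [← LinearMap.comp_apply, LinearMap.rTensor_comp_lTensor]
    simp only [ofConv_toConv]
    rw [h4, h4]
    congr 1
    exact tens_congr (fun y hy => (hs n y hy).symm) (comulX_mem n x hn)
  refine ⟨(toConv v * toConv s).ofConv, ?_, ?_, ?_⟩
  · rw [toConv_ofConv, ← mul_assoc]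
    have : toConv j * toConv v = 1 - f := by simp [f]
    rw [this, sub_mul, one_mul]
    exact sub_eq_of_eq_add hfix
  · intro a
    have hs0 : s ∘ₗ i0 K H M = (1 : WithConv (Cot K H M →ₗ[K] Cot K H M)).ofConv ∘ₗ i0 K H M := by
      ext a
      exact hs 0 _ (of_mem_fil (k := 0) le_rfl a)
    have h5 : ∀ g : Cot K H M →ₗ[K] Cot K H M, (toConv v * toConv g) (i0 K H M a) =
        LinearMap.mul' K _ (TensorProduct.map (v ∘ₗ i0 K H M) (g ∘ₗ i0 K H M) (Coalgebra.comul (R := K) a)) := by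
      intro g
      rw [LinearMap.convMul_apply, comul_i0, ← LinearMap.comp_apply (TensorProduct.map _ _),
        ← TensorProduct.map_comp]
    have h6 : (toConv v * 1) (i0 K H M a) = v (i0 K H M a) := by rw [mul_one]
    refine (h5 s).trans ?_
    rw [hs0, ← h5]
    exact h6
  · intro S hS hj hv
    have h1 : ∀ x ∈ S, (1 : WithConv (Cot K H M →ₗ[K] Cot K H M)) x ∈ S := fun x _ =>
      S.algebraMap_mem _
    have hfS : ∀ x ∈ S, f.ofConv x ∈ S := fun x hx => sub_mem (h1 x hx) (conv_mem hS hj hv x hx)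
    have hGS : ∀ n, ∀ x ∈ S, G n x ∈ S := by
      intro n
      induction n with
      | zero => exact h1
      | succ n ih =>
        intro x hx
        rw [hGx]
        exact add_mem (h1 x hx) (conv_mem hS hfS ih x hx)
    refine conv_mem hS hv fun x hx => ?_
    obtain ⟨n, hn⟩ := isCompat.exh x
    rw [hs n x hn]
    exact hGS n x hx

theorem exists_antipode : ∃ r : Cot K H M →ₗ[K] Cot K H M, toConv LinearMap.id * toConv r = 1 ∧
    toConv r * toConv LinearMap.id = 1 ∧
      ∀ S : Subalgebra K (Cot K H M), (∀ x ∈ S, Coalgebra.comul (R := K) x ∈ LinearMap.range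
      (TensorProduct.map S.val.toLinearMap S.val.toLinearMap :
        S ⊗[K] S →ₗ[K] Cot K H M ⊗[K] Cot K H M)) → (∀ a, i0 K H M a ∈ S) → ∀ x ∈ S, r x ∈ S := by
  have hcomp : ∀ (f g : Cot K H M →ₗ[K] Cot K H M) (p q : H →ₗ[K] H),
      (∀ a, f (i0 K H M a) = i0 K H M (p a)) → (∀ a, g (i0 K H M a) = i0 K H M (q a)) →
      ∀ a, (toConv f * toConv g) (i0 K H M a) =
        i0 K H M (LinearMap.mul' K H (TensorProduct.map p q (Coalgebra.comul (R := K) a))) := by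
    intro f g p q hf hg a
    rw [LinearMap.convMul_apply, comul_i0]
    generalize Coalgebra.comul (R := K) a = z
    induction z with
    | zero => simp only [LinearMap.map_zero, LinearEquiv.map_zero, zero_tmul, tmul_zero, smul_zero, LinearMap.zero_apply]
    | add x y hx hy => simp only [LinearMap.map_add, LinearEquiv.map_add, hx, hy]
    | tmul a b => simp [hf, hg, i0_mul_i0]
  have halg : ∀ c : K, i0 K H M (algebraMap K H c) = algebraMap K _ c :=
    fun c => (i0Hom K H M).commutes c
  obtain ⟨r, h1, h2, h3⟩ := exists_conv_inverse (K := K) (H := H) (M := M) LinearMap.id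
    (i0 K H M ∘ₗ HopfAlgebra.antipode K ∘ₗ p0 K H M) (fun a => by
      rw [hcomp _ _ LinearMap.id (HopfAlgebra.antipode K) (fun _ => rfl) (fun a => by simp), ← halg,
        ← HopfAlgebra.mul_antipode_lTensor_comul_apply]
      rfl)
  obtain ⟨r', h1', -, -⟩ := exists_conv_inverse (K := K) (H := H) (M := M) r
    (i0 K H M ∘ₗ p0 K H M) (fun a => by
      rw [hcomp _ _ (HopfAlgebra.antipode K) LinearMap.id (fun a => by rw [h2]; simp) (fun a => by simp), ← halg,
        ← HopfAlgebra.mul_antipode_rTensor_comul_apply]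
      rfl)
  refine ⟨r, h1, ?_, fun S hS hi => h3 S hS (fun x hx => hx) fun x _ => hi _⟩
  have : toConv LinearMap.id = toConv r' := left_inv_eq_right_inv h1 h1'
  rw [this, h1']

/-- The cotensor Hopf algebra of the couple `(H, M)`. -/
noncomputable instance : HopfAlgebra K (Cot K H M) :=
  HopfAlgebra.ofConvInverse (exists_antipode (K := K) (H := H) (M := M)).choose
    (exists_antipode (K := K) (H := H) (M := M)).choose_spec.2.1
    (exists_antipode (K := K) (H := H) (M := M)).choose_spec.1

end Cot

variable (K H M) in
/-- The quantum symmetric algebra of the couple `(H, M)`: the subalgebra of the cotensor Hopf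
algebra generated by `H` and `M`. -/
noncomputable def quantumSymmetricAlgebra : Subalgebra K (Cot K H M) :=
  Algebra.adjoin K (Set.range (Cot.i0 K H M) ∪ Set.range (Cot.i1 K H M))

theorem i0_mem (a : H) : Cot.i0 K H M a ∈ quantumSymmetricAlgebra K H M :=
  Algebra.subset_adjoin (Or.inl ⟨a, rfl⟩)

theorem i1_mem (m : M) : Cot.i1 K H M m ∈ quantumSymmetricAlgebra K H M :=
  Algebra.subset_adjoin (Or.inr ⟨m, rfl⟩)

theorem comul_mem_quantumSymmetricAlgebra (x : Cot K H M) (hx : x ∈ quantumSymmetricAlgebra K H M) :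
    Coalgebra.comul (R := K) x ∈ LinearMap.range (TensorProduct.map
      (quantumSymmetricAlgebra K H M).val.toLinearMap (quantumSymmetricAlgebra K H M).val.toLinearMap :
      quantumSymmetricAlgebra K H M ⊗[K] quantumSymmetricAlgebra K H M →ₗ[K] _) := by
  set S := quantumSymmetricAlgebra K H M with hS
  have hle : S ≤ (Algebra.TensorProduct.map S.val S.val).range.comap (Bialgebra.comulAlgHom K (Cot K H M)) := by
    refine Algebra.adjoin_le ?_
    have h00 : ∀ {A B : Type u} [AddCommGroup A] [Module K A] [AddCommGroup B] [Module K B]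
        (f : A →ₗ[K] Cot K H M) (g : B →ₗ[K] Cot K H M), (∀ a, f a ∈ S) → (∀ b, g b ∈ S) →
        ∀ z, TensorProduct.map f g z ∈ (Algebra.TensorProduct.map S.val S.val).range := by
      intro A B _ _ _ _ f g hf hg z
      induction z with
      | zero => rw [map_zero]; exact zero_mem _
      | add x y hx hy => rw [map_add]; exact add_mem hx hy
      | tmul a b => exact ⟨⟨f a, hf a⟩ ⊗ₜ ⟨g b, hg b⟩, rfl⟩
    rintro _ (⟨a, rfl⟩ | ⟨m, rfl⟩)
    · change Coalgebra.comul (R := K) (Cot.i0 K H M a) ∈ (Algebra.TensorProduct.map S.val S.val).range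
      rw [Cot.comul_i0]
      exact h00 _ _ i0_mem i0_mem _
    · change Coalgebra.comul (R := K) (Cot.i1 K H M m) ∈ (Algebra.TensorProduct.map S.val S.val).range
      rw [Cot.comul_i1]
      exact add_mem (h00 _ _ i0_mem i1_mem _) (h00 _ _ i1_mem i0_mem _)
  exact hle hx

theorem isSubHopf_quantumSymmetricAlgebra : IsSubHopf (quantumSymmetricAlgebra K H M) where
  comul_mem := comul_mem_quantumSymmetricAlgebra
  antipode_mem := (Cot.exists_antipode (K := K) (H := H) (M := M)).choose_spec.2.2 _
    comul_mem_quantumSymmetricAlgebra i0_mem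

noncomputable instance : HopfAlgebra K (quantumSymmetricAlgebra K H M) :=
  subHopf isSubHopf_quantumSymmetricAlgebra

variable (K H M) in
/-- The component of degree `n` of the quantum symmetric algebra. -/
noncomputable def quantumSymmetricAlgebra.degree (n : ℕ) : Submodule K (quantumSymmetricAlgebra K H M) :=
  (LinearMap.range (Cot.of K H M n)).comap (quantumSymmetricAlgebra K H M).val.toLinearMap

end Antipode

section Pairings

variable {K : Type*} [Field K]

/-- Hopf pairings between Hopf algebras. -/
structure IsHopfPairing {A B : Type*} [Ring A] [HopfAlgebra K A] [Ring B] [HopfAlgebra K B]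
    (φ : A →ₗ[K] B →ₗ[K] K) : Prop where
  one_left : ∀ b, φ 1 b = Coalgebra.counit (R := K) b
  one_right : ∀ a, φ a 1 = Coalgebra.counit (R := K) a
  /-- `φ(a, b c) = ∑ φ(a₁, b) φ(a₂, c)` -/
  mul_right : ∀ a b c, φ a (b * c) =
    LinearMap.mul' K K (TensorProduct.map (φ.flip b) (φ.flip c) (Coalgebra.comul a))
  /-- `φ(a a', b) = ∑ φ(a, b₁) φ(a', b₂)` -/
  mul_left : ∀ a a' b, φ (a * a') b =
    LinearMap.mul' K K (TensorProduct.map (φ a) (φ a') (Coalgebra.comul b))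
  antipode : ∀ a b, φ (HopfAlgebra.antipode K a) b = φ a (HopfAlgebra.antipode K b)

/-- A Hopf algebra graded by the subspaces `𝒜 n` is graded self-dual if it has a two-sided
non-degenerate Hopf pairing with itself for which components of different degrees are orthogonal. -/
def IsGradedSelfDual {A : Type*} [Ring A] [HopfAlgebra K A] (𝒜 : ℕ → Submodule K A) : Prop :=
  ∃ φ : A →ₗ[K] A →ₗ[K] K, IsHopfPairing φ ∧
    (∀ i j, i ≠ j → ∀ a ∈ 𝒜 i, ∀ b ∈ 𝒜 j, φ a b = 0) ∧ φ.Nondegenerate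

open HopfBimodule

/-- Pairings between couples `(H, M)` and `(B, N)`. -/
structure IsCouplePairing {H M B N : Type*} [Ring H] [HopfAlgebra K H]
    [AddCommGroup M] [Module K M] [Module H M] [Module Hᵐᵒᵖ M]
    [IsScalarTower K H M] [IsScalarTower K Hᵐᵒᵖ M] [SMulCommClass H Hᵐᵒᵖ M] [HopfBimodule K H M]
    [Ring B] [HopfAlgebra K B] [AddCommGroup N] [Module K N] [Module B N] [Module Bᵐᵒᵖ N]
    [IsScalarTower K B N] [IsScalarTower K Bᵐᵒᵖ N] [SMulCommClass B Bᵐᵒᵖ N] [HopfBimodule K B N]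
    (φ₀ : H →ₗ[K] B →ₗ[K] K) (φ₁ : M →ₗ[K] N →ₗ[K] K) : Prop where
  isHopfPairing : IsHopfPairing φ₀
  /-- `φ₁(h.m.g, n) = ∑ φ₀(h, n₋₁) φ₁(m, n₀) φ₀(g, n₁)` -/
  left : ∀ (h g : H) (m : M) (n : N), φ₁ (h • MulOpposite.op g • m) n =
    LinearMap.mul' K K (TensorProduct.map (φ₀ h)
      (LinearMap.mul' K K ∘ₗ TensorProduct.map (φ₁ m) (φ₀ g))
        ((coactR (K := K) (H := B)).lTensor B (coactL (K := K) (H := B) n)))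
  /-- `φ₁(m, b.n.c) = ∑ φ₀(m₋₁, b) φ₁(m₀, n) φ₀(m₁, c)` -/
  right : ∀ (b c : B) (m : M) (n : N), φ₁ m (b • MulOpposite.op c • n) =
    LinearMap.mul' K K (TensorProduct.map (φ₀.flip b)
      (LinearMap.mul' K K ∘ₗ TensorProduct.map (φ₁.flip n) (φ₀.flip c))
        ((coactR (K := K) (H := H)).lTensor H (coactL (K := K) (H := H) m)))

/-- The couple `(H, M)` is self-dual if it has a pairing with itself both of whose components
are two-sided non-degenerate. -/
def IsSelfDualCouple (K H M : Type*) [Field K] [Ring H] [HopfAlgebra K H]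
    [AddCommGroup M] [Module K M] [Module H M] [Module Hᵐᵒᵖ M]
    [IsScalarTower K H M] [IsScalarTower K Hᵐᵒᵖ M] [SMulCommClass H Hᵐᵒᵖ M]
    [HopfBimodule K H M] : Prop :=
  ∃ (φ₀ : H →ₗ[K] H →ₗ[K] K) (φ₁ : M →ₗ[K] M →ₗ[K] K),
    IsCouplePairing φ₀ φ₁ ∧ φ₀.Nondegenerate ∧ φ₁.Nondegenerate

end Pairings

end QuantumSymmetric

/-!
Elements of the quantum symmetric algebra `S = S_H(M)` are represented by words, that is, by
elements of the free algebra `F` on the vector space `H ⊕ M` (`wordsToCot`), and words act on the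
cotensor Hopf algebra `C` as functionals: given a pairing `(φ₀, φ₁)` of the couple, `h` acts as
`φ₀(h, p₀(·))`, `m` acts as `φ₁(m, p₁(·))`, and a product of letters acts as the convolution product
(`wordsPairing`). Pairing words with products in `C` is governed by a lift to `F` of the
comultiplication, because multiplication is a coalgebra morphism and because of the formulas for
`φ₁` (`exists_wordsPairing_mul_right`). Hence, by induction on words, pairing a word `s` with the
image of a word `t` is the same as pairing `t` with the image of `s`, with the two sides of
`(φ₀, φ₁)` exchanged (`wordsPairing_wordsToCot`). So the pairing only depends on the images of the
two words and descends to `S` (`exists_pairing`), where it is a Hopf pairing; compatibility with the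
antipodes is automatic by uniqueness of convolution inverses (`pairing_antipode`). It is
graded because words of degree `n` act as functionals concentrated in degree `n`
(`iSup_wordsDegree`, `map_comul_eq_zero`). It is non-degenerate because words already separate the
elements of `C` (`eq_zero_of_wordsPairing`): the component of degree `n` of `C` lies in
`M ⊗ ⋯ ⊗ M`, whose elements are separated by products of functionals `φ₁(m, ·)`. The
two halves of the non-degeneracy of `φ₀` and `φ₁` give the two halves for the pairing on `S`.

Conversely, a graded Hopf pairing of `S` restricts to a Hopf pairing of the component `H` and to a
bilinear form on the component `M`. Since `h.m.g` is a product in `S` and different degrees are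
orthogonal, only the part in `H ⊗ M ⊗ H` of the iterated comultiplication of an element of `M`
contributes to the pairing with `h.m.g` (`pairing_smul_op_smul`), and non-degeneracy passes to
the components since `S` is their sum (`separatingLeft_component`).
-/

namespace QuantumSymmetric

/-! ### Pairings of Hopf algebras and of couples -/

section Pairings

variable {K : Type*} [Field K]

theorem mul'_map_comul {C ι : Type*} [AddCommGroup C] [Module K C] [Coalgebra K C] (f g : C →ₗ[K] K)
    {c : C} (r : Coalgebra.Repr K c ι) :
    LinearMap.mul' K K (TensorProduct.map f g (Coalgebra.comul c)) =
      ∑ i ∈ r.index, f (r.left i) * g (r.right i) := by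
  simp [← r.eq]

open WithConv Coalgebra in
/-- A bialgebra pairing of Hopf algebras is compatible with the antipodes: both
`φ(S a, b)` and `φ(a, S b)` are convolution inverses of `φ`, seen as a functional on `A ⊗ B`. -/
theorem pairing_antipode {A B : Type*} [Ring A] [HopfAlgebra K A] [Ring B] [HopfAlgebra K B]
    {φ : A →ₗ[K] B →ₗ[K] K} (one_left : ∀ b, φ 1 b = Coalgebra.counit (R := K) b)
    (one_right : ∀ a, φ a 1 = Coalgebra.counit (R := K) a)
    (mul_right : ∀ a b c, φ a (b * c) =
      LinearMap.mul' K K (TensorProduct.map (φ.flip b) (φ.flip c) (Coalgebra.comul a)))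
    (mul_left : ∀ a a' b, φ (a * a') b =
      LinearMap.mul' K K (TensorProduct.map (φ a) (φ a') (Coalgebra.comul b))) (a : A) (b : B) :
    φ (HopfAlgebra.antipode K a) b = φ a (HopfAlgebra.antipode K b) := by
  have h : toConv (TensorProduct.lift (φ ∘ₗ HopfAlgebra.antipode K)) =
      toConv (TensorProduct.lift (φ.compl₂ (HopfAlgebra.antipode K))) := by
    apply left_inv_eq_right_inv (a := toConv (TensorProduct.lift φ))
    · ext a b
      have := congrArg (fun x => φ x b) (HopfAlgebra.sum_antipode_mul_eq_algebraMap_counit (ℛ K a))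
      simp only [map_sum, LinearMap.sum_apply, mul_left, mul'_map_comul _ _ (ℛ K b)] at this
      simpa [((ℛ K a).tmul (ℛ K b)).convMul_apply, Finset.sum_product, Algebra.algebraMap_eq_smul_one,
        one_left, mul_comm (counit (R := K) (_ : B))] using this
    · ext a b
      have := congrArg (φ a) (HopfAlgebra.sum_mul_antipode_eq_algebraMap_counit (ℛ K b))
      simp only [map_sum, mul_right, mul'_map_comul _ _ (ℛ K a)] at this
      rw [Finset.sum_comm] at this
      simpa [((ℛ K a).tmul (ℛ K b)).convMul_apply, Finset.sum_product, Algebra.algebraMap_eq_smul_one,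
        one_right, mul_comm] using this
  exact LinearMap.congr_fun (toConv_injective h) (a ⊗ₜ b)

theorem IsHopfPairing.flip {A B : Type*} [Ring A] [HopfAlgebra K A] [Ring B] [HopfAlgebra K B]
    {φ : A →ₗ[K] B →ₗ[K] K} (h : IsHopfPairing φ) : IsHopfPairing φ.flip where
  one_left := h.one_right
  one_right := h.one_left
  mul_right a b c := h.mul_left b c a
  mul_left a a' b := h.mul_right b a a'
  antipode a b := (h.antipode b a).symm

open HopfBimodule

variable {H M B N : Type*} [Ring H] [HopfAlgebra K H]
    [AddCommGroup M] [Module K M] [Module H M] [Module Hᵐᵒᵖ M]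
    [IsScalarTower K H M] [IsScalarTower K Hᵐᵒᵖ M] [SMulCommClass H Hᵐᵒᵖ M] [HopfBimodule K H M]
    [Ring B] [HopfAlgebra K B] [AddCommGroup N] [Module K N] [Module B N] [Module Bᵐᵒᵖ N]
    [IsScalarTower K B N] [IsScalarTower K Bᵐᵒᵖ N] [SMulCommClass B Bᵐᵒᵖ N] [HopfBimodule K B N]
    {φ₀ : H →ₗ[K] B →ₗ[K] K} {φ₁ : M →ₗ[K] N →ₗ[K] K}

/-- The conditions on a pairing of couples are symmetric, so statements about one argument transfer
to the other one. -/
theorem IsCouplePairing.flip (h : IsCouplePairing φ₀ φ₁) : IsCouplePairing φ₀.flip φ₁.flip where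
  isHopfPairing := h.isHopfPairing.flip
  left b c n m := h.right b c m n
  right a g n m := h.left a g m n

theorem IsCouplePairing.smul_left (h : IsCouplePairing φ₀ φ₁) (a : H) (m : M) (n : N) :
    φ₁ (a • m) n = LinearMap.mul' K K (TensorProduct.map (φ₀ a) (φ₁ m)
      (coactL (K := K) (H := B) n)) := by
  have h1 := h.left a 1 m n
  rw [MulOpposite.op_one, one_smul] at h1
  rw [h1]
  have h2 : (LinearMap.mul' K K ∘ₗ TensorProduct.map (φ₁ m) (φ₀ 1)) ∘ₗ coactR (K := K) (H := B) =
      φ₁ m := by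
    ext n
    conv_rhs => rw [← coactR_counit (K := K) (H := B) n]
    simp only [LinearMap.comp_apply]
    induction coactR (K := K) (H := B) n with
    | zero => simp
    | add x y hx hy => simp only [map_add, hx, hy]
    | tmul a b => simp [h.isHopfPairing.one_left, mul_comm]
  rw [← LinearMap.comp_apply (TensorProduct.map _ _), LinearMap.map_comp_lTensor, h2]

theorem IsCouplePairing.op_smul_left (h : IsCouplePairing φ₀ φ₁) (a : H) (m : M) (n : N) :
    φ₁ (MulOpposite.op a • m) n = LinearMap.mul' K K (TensorProduct.map (φ₁ m) (φ₀ a)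
      (coactR (K := K) (H := B) n)) := by
  have h1 := h.left 1 a m n
  rw [one_smul] at h1
  rw [h1]
  have h3 : φ₀ 1 = Coalgebra.counit := LinearMap.ext h.isHopfPairing.one_left
  conv_rhs => rw [← coactL_counit (K := K) (H := B) n]
  rw [h3]
  induction coactL (K := K) (H := B) n with
  | zero => simp
  | add x y hx hy => simp only [map_add, hx, hy]
  | tmul a b => simp

end Pairings

/-! ### Contractions and gradings -/

section Separation

variable {K M N V : Type*} [Field K] [AddCommGroup M] [Module K M] [AddCommGroup N] [Module K N]
  [AddCommGroup V] [Module K V]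

/-- Contracting the first factor with a separating family of functionals separates the points of
`M ⊗ V`. -/
theorem eq_zero_of_contract {φ : M →ₗ[K] N →ₗ[K] K} (hφ : φ.SeparatingLeft) (z : M ⊗[K] V)
    (hz : ∀ n, TensorProduct.lid K V ((φ.flip n).rTensor V z) = 0) : z = 0 := by
  classical
  set b := Module.Basis.ofVectorSpace K V
  apply (TensorProduct.equivFinsuppOfBasisRight (M := M) b).injective
  ext i
  rw [map_zero, Finsupp.zero_apply]
  refine hφ _ fun n => ?_
  have h := congrArg (b.coord i) (hz n)
  rw [map_zero] at h
  rw [← h, TensorProduct.equivFinsuppOfBasisRight_apply]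
  clear h hz
  induction z with
  | zero => simp
  | add x y hx hy => simp only [map_add, LinearMap.add_apply, hx, hy]
  | tmul m v => simp [mul_comm]

end Separation

section Graded

variable {K A : Type*} [Field K] [Ring A] [Algebra K A]

/-- Subspaces indexed by degrees which are stable under multiplication and contain a generating
set of an algebra span it. -/
theorem iSup_eq_top_of_adjoin {G : ℕ → Submodule K A} (h1 : 1 ∈ G 0)
    (hmul : ∀ i j, ∀ a ∈ G i, ∀ b ∈ G j, a * b ∈ G (i + j)) {s : Set A}
    (hs : ∀ a ∈ s, a ∈ ⨆ i, G i) (ha : Algebra.adjoin K s = ⊤) : ⨆ i, G i = ⊤ := by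
  refine eq_top_iff.2 fun x _ => ?_
  have hx : x ∈ Algebra.adjoin K s := ha ▸ trivial
  have hm : ∀ i, G i ≤ ⨆ i, G i := le_iSup G
  induction hx using Algebra.adjoin_induction with
  | mem x hx => exact hs x hx
  | algebraMap r =>
    rw [Algebra.algebraMap_eq_smul_one]
    exact Submodule.smul_mem _ _ (hm 0 h1)
  | add x y _ _ hx hy => exact add_mem (hx trivial) (hy trivial)
  | mul x y _ _ hx hy =>
    refine Submodule.iSup_induction G (motive := fun x => x * y ∈ ⨆ i, G i) (hx trivial)
      (fun i a ha => ?_) (by simp) (fun a b ha hb => by rw [add_mul]; exact add_mem ha hb)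
    exact Submodule.iSup_induction G (motive := fun y => a * y ∈ ⨆ i, G i) (hy trivial)
      (fun j b hb => hm _ (hmul i j a ha b hb)) (by simp)
      (fun a b ha hb => by rw [mul_add]; exact add_mem ha hb)

end Graded

/-! ### The grading of the cotensor Hopf algebra -/

section CotGrading

variable {K : Type w} {H M : Type u} [Field K] [Ring H] [HopfAlgebra K H]
  [AddCommGroup M] [Module K M] [Module H M] [Module Hᵐᵒᵖ M]
  [IsScalarTower K H M] [IsScalarTower K Hᵐᵒᵖ M] [SMulCommClass H Hᵐᵒᵖ M]
  [HopfBimodule K H M]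

open HopfBimodule

theorem lTensor_mem_tens_range {A V W : Type*} [AddCommGroup A] [Module K A] [AddCommGroup V]
    [Module K V] [AddCommGroup W] [Module K W] (f : V →ₗ[K] W) (z : A ⊗[K] V) :
    f.lTensor A z ∈ tens K A (LinearMap.range f) := by
  refine ⟨f.rangeRestrict.lTensor A z, ?_⟩
  rw [← LinearMap.lTensor_comp_apply]
  rfl

namespace Cot

theorem rho_mem_tens {n : ℕ} {x : Cot K H M} (hx : x ∈ LinearMap.range (of K H M n)) :
    rho K H M x ∈ tens K H (LinearMap.range (of K H M n)) := by
  obtain ⟨x, rfl⟩ := hx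
  rw [rho_of]
  exact lTensor_mem_tens_range _ _

theorem tau_mem_tens {n : ℕ} {x : Cot K H M} (hx : x ∈ LinearMap.range (of K H M (n + 1))) :
    tau K H M x ∈ tens K M (LinearMap.range (of K H M n)) := by
  obtain ⟨x, rfl⟩ := hx
  rw [tau_of_succ]
  exact lTensor_mem_tens_range _ _

theorem tau_eq_zero {x : Cot K H M} (hx : x ∈ LinearMap.range (of K H M 0)) :
    tau K H M x = 0 := by
  obtain ⟨x, rfl⟩ := hx
  exact tau_of_zero x

theorem p0_eq_zero {k : ℕ} (hk : k ≠ 0) {x : Cot K H M}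
    (hx : x ∈ LinearMap.range (of K H M k)) : p0 K H M x = 0 := by
  obtain ⟨x, rfl⟩ := hx
  exact comp_of_ne hk x

theorem p1_eq_zero {k : ℕ} (hk : k ≠ 1) {x : Cot K H M}
    (hx : x ∈ LinearMap.range (of K H M k)) : p1 K H M x = 0 := by
  obtain ⟨x, rfl⟩ := hx
  exact comp_of_ne hk x

theorem kap_mem_range {n : ℕ} (m : M) {x : Cot K H M} (hx : x ∈ LinearMap.range (of K H M n)) :
    kap K H M (m ⊗ₜ x) ∈ LinearMap.range (of K H M (n + 1)) := by
  obtain ⟨x, rfl⟩ := hx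
  exact ⟨_, (kap_of n (m ⊗ₜ x)).symm⟩

theorem mem_range_succ {n : ℕ} {x : Cot K H M} (h0 : p0 K H M x = 0)
    (h1 : tau K H M x ∈ tens K M (LinearMap.range (of K H M n))) :
    x ∈ LinearMap.range (of K H M (n + 1)) := by
  rw [← i0_p0_add_kap_tau x, h0, map_zero, zero_add]
  exact tens_induction (p := fun z => kap K H M z ∈ LinearMap.range (of K H M (n + 1))) h1
    (by simp) (fun m v hv => kap_mem_range m hv)
    (fun x y hx hy => by rw [map_add]; exact add_mem hx hy)

theorem map₂_mul_mem_tens {A B C : Type*} [AddCommGroup A] [Module K A] [AddCommGroup B]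
    [Module K B] [AddCommGroup C] [Module K C] (f : A →ₗ[K] B →ₗ[K] C)
    {P Q R : Submodule K (Cot K H M)} (h : ∀ x ∈ P, ∀ y ∈ Q, x * y ∈ R)
    {x : A ⊗[K] Cot K H M} (hx : x ∈ tens K A P) {y : B ⊗[K] Cot K H M} (hy : y ∈ tens K B Q) :
    TensorProduct.map₂ f (LinearMap.mul K (Cot K H M)) x y ∈ tens K C R := by
  refine tens_induction (p := fun x => TensorProduct.map₂ f (LinearMap.mul K (Cot K H M)) x y ∈
    tens K C R) hx (by simp) (fun a v hv => ?_)
    (fun x y hx hy => by rw [map_add]; exact add_mem hx hy)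
  refine tens_induction (p := fun y => TensorProduct.map₂ f (LinearMap.mul K (Cot K H M))
    (a ⊗ₜ v) y ∈ tens K C R) hy (by simp) (fun b w hw => ?_)
    (fun x y hx hy => by rw [map_add]; exact add_mem hx hy)
  rw [map₂_apply_tmul, map_tmul, LinearMap.mul_apply']
  exact tmul_mem_tens _ (h v hv w hw)

/-- The multiplication of the cotensor Hopf algebra is graded. -/
theorem mul_mem_range {i j : ℕ} {x y : Cot K H M} (hx : x ∈ LinearMap.range (of K H M i))
    (hy : y ∈ LinearMap.range (of K H M j)) : x * y ∈ LinearMap.range (of K H M (i + j)) := by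
  obtain ⟨n, hn⟩ : ∃ n, i + j = n := ⟨_, rfl⟩
  rw [hn]
  induction n generalizing i j x y with
  | zero =>
    obtain ⟨rfl, rfl⟩ : i = 0 ∧ j = 0 := by omega
    obtain ⟨a, rfl⟩ := hx
    obtain ⟨b, rfl⟩ := hy
    exact ⟨_, (i0_mul_i0 (K := K) (H := H) (M := M) a b).symm⟩
  | succ n ih =>
    apply mem_range_succ
    · rw [p0_mul]
      rcases i with _ | i
      · obtain ⟨j, rfl⟩ : ∃ k, j = k + 1 := ⟨n, by omega⟩
        rw [p0_eq_zero j.succ_ne_zero hy, mul_zero]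
      · rw [p0_eq_zero i.succ_ne_zero hx, zero_mul]
    · rw [tau_mul]
      refine add_mem ?_ ?_
      · rcases j with _ | j
        · rw [tau_eq_zero hy, map_zero]; exact zero_mem _
        · exact map₂_mul_mem_tens _ (fun x hx y hy => ih hx hy (by omega)) (rho_mem_tens hx)
            (tau_mem_tens hy)
      · rcases i with _ | i
        · rw [tau_eq_zero hx, map_zero, LinearMap.zero_apply]; exact zero_mem _
        · exact map₂_mul_mem_tens _ (fun x hx y hy => ih hx hy (by omega)) (tau_mem_tens hx)
            (rho_mem_tens hy)

/-- The comultiplication of the cotensor Hopf algebra is graded, in dual form: the convolution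
product of a functional concentrated in degree `i` and one concentrated in degree `j` is
concentrated in degree `i + j`. -/
theorem map_comul_eq_zero {f g : Cot K H M →ₗ[K] K} {i j : ℕ}
    (hf : ∀ k, k ≠ i → ∀ x ∈ LinearMap.range (of K H M k), f x = 0)
    (hg : ∀ k, k ≠ j → ∀ x ∈ LinearMap.range (of K H M k), g x = 0) (n : ℕ) (hn : n ≠ i + j)
    (x : Cot K H M) (hx : x ∈ LinearMap.range (of K H M n)) :
    TensorProduct.map f g (Coalgebra.comul (R := K) x) = 0 := by
  have h0 : ∀ {f : Cot K H M →ₗ[K] K} {i n : ℕ}, n ≠ i + j →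
      (∀ k, k ≠ i → ∀ x ∈ LinearMap.range (of K H M k), f x = 0) →
      ∀ z ∈ tens K H (LinearMap.range (of K H M n)),
        TensorProduct.map f g ((i0 K H M).rTensor _ z) = 0 := by
    refine fun {f i n} hn hf z hz => tens_induction (p := fun z => TensorProduct.map f g
      ((i0 K H M).rTensor _ z) = 0) hz (by simp) (fun a v hv => ?_)
      (fun x y hx hy => by simp only [map_add, hx, hy, add_zero])
    rw [LinearMap.rTensor_tmul, map_tmul]
    by_cases h : i = 0
    · rw [hg n (by omega) v hv, tmul_zero]
    · rw [hf 0 (Ne.symm h) (i0 K H M a) ⟨a, rfl⟩, zero_tmul]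
  induction n generalizing f i x with
  | zero =>
    rw [← decomp (Coalgebra.comul (R := K) x), comul_def', p0_comulX, tau_comulX, tau_eq_zero hx]
    simp only [map_zero, add_zero]
    exact h0 hn hf _ (rho_mem_tens hx)
  | succ n ih =>
    rw [← decomp (Coalgebra.comul (R := K) x), comul_def', p0_comulX, tau_comulX, map_add,
      h0 hn hf _ (rho_mem_tens hx), zero_add]
    refine tens_induction (p := fun z => TensorProduct.map f g ((kap K H M).rTensor _
      ((TensorProduct.assoc K M _ _).symm ((comulX K H M).lTensor M z))) = 0)
      (tau_mem_tens hx) (by simp) (fun m v hv => ?_)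
      (fun x y hx hy => by simp only [map_add, hx, hy, add_zero])
    have h1 : ∀ z : Cot K H M ⊗[K] Cot K H M, TensorProduct.map f g ((kap K H M).rTensor _
        ((TensorProduct.assoc K M _ _).symm (m ⊗ₜ z))) =
        TensorProduct.map (f ∘ₗ kap K H M ∘ₗ TensorProduct.mk K M _ m) g z := by
      intro z
      induction z with
      | zero => simp
      | add x y hx hy => simp only [tmul_add, map_add, hx, hy]
      | tmul a b => simp
    rw [LinearMap.lTensor_tmul, h1]
    rcases i with _ | i
    · have h2 : f ∘ₗ kap K H M ∘ₗ TensorProduct.mk K M _ m = 0 := by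
        ext y
        induction y using induction_on with
        | h0 => simp
        | hof k y => exact hf (k + 1) (by omega) _ (kap_mem_range m ⟨y, rfl⟩)
        | hadd x y hx hy => simp only [map_add, hx, hy]
      rw [h2, map_zero_left, LinearMap.zero_apply]
    · refine ih (f := f ∘ₗ kap K H M ∘ₗ TensorProduct.mk K M _ m) (i := i) ?_ (by omega) v hv
      exact fun k hk y hy => hf (k + 1) (by omega) _ (kap_mem_range m hy)

/-- Splitting off a factor from `M` is the component of the comultiplication in `M ⊗ Cot`. -/
theorem p1_rTensor_comul (x : Cot K H M) :
    (p1 K H M).rTensor _ (Coalgebra.comul (R := K) x) = tau K H M x := by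
  have h1 : ∀ z : Cot K H M ⊗[K] Cot K H M, (p1 K H M).rTensor _ z =
      ((TensorProduct.lid K _).toLinearMap ∘ₗ (counitX K H M).rTensor _).lTensor M
        (ext (tau K H M) _ z) := by
    intro z
    induction z with
    | zero => simp
    | add x y hx hy => simp only [map_add, hx, hy]
    | tmul a b =>
      rw [LinearMap.rTensor_tmul, p1_eq, ext_tmul]
      induction tau K H M a with
      | zero => simp
      | add x y hx hy => simp only [map_add, add_tmul, hx, hy]
      | tmul m c => simp [smul_tmul]
  rw [h1, comul_def', tau_comulX, ← LinearMap.lTensor_comp_apply]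
  have h2 : ((TensorProduct.lid K _).toLinearMap ∘ₗ (counitX K H M).rTensor _) ∘ₗ comulX K H M =
      LinearMap.id := by
    ext x
    have h := Coalgebra.rTensor_counit_comul (R := K) x
    refine (congrArg (TensorProduct.lid K _) h).trans ?_
    simp
  rw [h2, LinearMap.lTensor_id, LinearMap.id_apply]

theorem p1_i1 (m : M) : p1 K H M (i1 K H M m) = m := comp_of_self 1 m

theorem p1_i0 (h : H) : p1 K H M (i0 K H M h) = 0 := comp_of_ne (m := 0) (n := 1) (by omega) h

end Cot

end CotGrading

/-! ### The pairing of the free algebra on `H ⊕ M` with the cotensor Hopf algebra -/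

theorem ι_eq_add {K V W : Type*} [Field K] [AddCommGroup V] [Module K V] [AddCommGroup W]
    [Module K W] (v : V) (w : W) : TensorAlgebra.ι K (v, w) =
      TensorAlgebra.ι K (v, (0 : W)) + TensorAlgebra.ι K ((0 : V), w) := by
  rw [← map_add, Prod.mk_add_mk, add_zero, zero_add]

section Words

variable {K : Type w} {H M : Type u} [Field K] [Ring H] [HopfAlgebra K H]
  [AddCommGroup M] [Module K M] [Module H M] [Module Hᵐᵒᵖ M]
  [IsScalarTower K H M] [IsScalarTower K Hᵐᵒᵖ M] [SMulCommClass H Hᵐᵒᵖ M]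
  [HopfBimodule K H M]

open HopfBimodule Cot

variable (K H M) in
/-- The algebra homomorphism from the free algebra on the vector space `H ⊕ M` to the cotensor
Hopf algebra which is the inclusion on `H` and on `M`. -/
noncomputable def wordsToCot : TensorAlgebra K (H × M) →ₐ[K] Cot K H M :=
  TensorAlgebra.lift K ((i0 K H M).coprod (i1 K H M))

theorem wordsToCot_ι (h : H) (m : M) :
    wordsToCot K H M (TensorAlgebra.ι K (h, m)) = i0 K H M h + i1 K H M m := by
  simp [wordsToCot]

theorem range_wordsToCot : (wordsToCot K H M).range = quantumSymmetricAlgebra K H M := by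
  rw [wordsToCot, TensorAlgebra.range_lift, quantumSymmetricAlgebra]
  apply le_antisymm <;> refine Algebra.adjoin_le ?_
  · rintro _ ⟨⟨h, m⟩, rfl⟩
    exact add_mem (Algebra.subset_adjoin (Or.inl ⟨h, rfl⟩)) (Algebra.subset_adjoin (Or.inr ⟨m, rfl⟩))
  · rintro _ (⟨h, rfl⟩ | ⟨m, rfl⟩)
    · exact Algebra.subset_adjoin ⟨(h, 0), by simp⟩
    · exact Algebra.subset_adjoin ⟨(0, m), by simp⟩

/-- The pairing of words with elements of the cotensor Hopf algebra: `h` and `m` act as the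
functionals `φ₀(h, p₀(·))` and `φ₁(m, p₁(·))`, and words act by convolution products of these. -/
noncomputable def wordsPairing (φ₀ : H →ₗ[K] H →ₗ[K] K) (φ₁ : M →ₗ[K] M →ₗ[K] K) :
    TensorAlgebra K (H × M) →ₗ[K] Cot K H M →ₗ[K] K :=
  (WithConv.linearEquiv K (Cot K H M →ₗ[K] K)).toLinearMap ∘ₗ
    (TensorAlgebra.lift K ((WithConv.linearEquiv K (Cot K H M →ₗ[K] K)).symm.toLinearMap ∘ₗ
      ((φ₀.compl₂ (p0 K H M)).coprod (φ₁.compl₂ (p1 K H M))))).toLinearMap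

variable {φ₀ : H →ₗ[K] H →ₗ[K] K} {φ₁ : M →ₗ[K] M →ₗ[K] K}

theorem wordsPairing_algebraMap (r : K) (c : Cot K H M) :
    wordsPairing φ₀ φ₁ (algebraMap K _ r) c = r * Coalgebra.counit (R := K) c := by
  simp only [wordsPairing, LinearMap.comp_apply, AlgHom.toLinearMap_apply, AlgHom.commutes]
  rfl

theorem wordsPairing_one (c : Cot K H M) :
    wordsPairing φ₀ φ₁ 1 c = Coalgebra.counit (R := K) c := by
  rw [← map_one (algebraMap K _), wordsPairing_algebraMap, one_mul]

theorem wordsPairing_ι (h : H) (m : M) (c : Cot K H M) :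
    wordsPairing φ₀ φ₁ (TensorAlgebra.ι K (h, m)) c =
      φ₀ h (p0 K H M c) + φ₁ m (p1 K H M c) := by
  simp only [wordsPairing, LinearMap.comp_apply, AlgHom.toLinearMap_apply,
    TensorAlgebra.lift_ι_apply]
  rfl

theorem wordsPairing_ι_left (h : H) : wordsPairing φ₀ φ₁ (TensorAlgebra.ι K (h, (0 : M))) =
    φ₀ h ∘ₗ p0 K H M := by
  ext c
  simp [wordsPairing_ι]

theorem wordsPairing_ι_right (m : M) : wordsPairing φ₀ φ₁ (TensorAlgebra.ι K ((0 : H), m)) =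
    φ₁ m ∘ₗ p1 K H M := by
  ext c
  simp [wordsPairing_ι]

theorem wordsPairing_mul (s t : TensorAlgebra K (H × M)) (c : Cot K H M) :
    wordsPairing φ₀ φ₁ (s * t) c = LinearMap.mul' K K (TensorProduct.map (wordsPairing φ₀ φ₁ s)
      (wordsPairing φ₀ φ₁ t) (Coalgebra.comul c)) := by
  simp only [wordsPairing, LinearMap.comp_apply, AlgHom.toLinearMap_apply, map_mul]
  rfl

open Coalgebra in
/-- The pairing of a word with a product is computed by a lift of the comultiplication to words. -/
theorem exists_wordsPairing_mul_right (h : IsCouplePairing φ₀ φ₁) (t : TensorAlgebra K (H × M)) :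
    ∃ z : TensorAlgebra K (H × M) ⊗[K] TensorAlgebra K (H × M),
      TensorProduct.map (wordsToCot K H M).toLinearMap (wordsToCot K H M).toLinearMap z =
        Coalgebra.comul (R := K) (wordsToCot K H M t) ∧
      ∀ c d, wordsPairing φ₀ φ₁ t (c * d) = LinearMap.mul' K K (TensorProduct.map
        ((wordsPairing φ₀ φ₁).flip c) ((wordsPairing φ₀ φ₁).flip d) z) := by
  induction t using TensorAlgebra.induction with
  | algebraMap r =>
    refine ⟨r • (1 ⊗ₜ 1), ?_, fun c d => ?_⟩
    · rw [AlgHom.commutes, Algebra.algebraMap_eq_smul_one, map_smul, map_smul, Bialgebra.comul_one]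
      simp [Algebra.TensorProduct.one_def]
    · simp [wordsPairing_algebraMap, wordsPairing_one]
  | ι x =>
    obtain ⟨a, m⟩ := x
    set jH : H →ₗ[K] TensorAlgebra K (H × M) := TensorAlgebra.ι K ∘ₗ LinearMap.inl K H M
    set jM : M →ₗ[K] TensorAlgebra K (H × M) := TensorAlgebra.ι K ∘ₗ LinearMap.inr K H M
    have hH : (wordsToCot K H M).toLinearMap ∘ₗ jH = i0 K H M := by
      ext a; simp [jH, wordsToCot_ι]
    have hM : (wordsToCot K H M).toLinearMap ∘ₗ jM = i1 K H M := by
      ext a; simp [jM, wordsToCot_ι]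
    have pH : ∀ c, (wordsPairing φ₀ φ₁).flip c ∘ₗ jH = φ₀.flip (p0 K H M c) := by
      intro c; ext a; simp [jH, wordsPairing_ι]
    have pM : ∀ c, (wordsPairing φ₀ φ₁).flip c ∘ₗ jM = φ₁.flip (p1 K H M c) := by
      intro c; ext a; simp [jM, wordsPairing_ι]
    refine ⟨TensorProduct.map jH jH (comul a) + (TensorProduct.map jH jM (coactL m) +
      TensorProduct.map jM jH (coactR m)), ?_, fun c d => ?_⟩
    · rw [wordsToCot_ι, map_add comul, comul_i0, comul_i1]
      simp only [map_add, TensorProduct.map_map,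
        hH, hM]
    · simp only [map_add, TensorProduct.map_map,
        pH, pM]
      rw [wordsPairing_ι, p0_mul, p1_mul, h.isHopfPairing.mul_right, ← LinearMap.flip_apply φ₁,
        map_add, LinearMap.add_apply, h.flip.smul_left, h.flip.op_smul_left]
  | mul s t hs ht =>
    obtain ⟨x, hx, hs⟩ := hs
    obtain ⟨y, hy, ht⟩ := ht
    refine ⟨x * y, ?_, fun c d => ?_⟩
    · rw [map_mul (wordsToCot K H M), Bialgebra.comul_mul, ← hx, ← hy]
      exact map_mul (Algebra.TensorProduct.map (wordsToCot K H M) (wordsToCot K H M)) x y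
    · rw [wordsPairing_mul, mul'_map_comul _ _ ((ℛ K c).mul (ℛ K d))]
      simp only [Coalgebra.Repr.mul_index, Coalgebra.Repr.mul_left, Coalgebra.Repr.mul_right, hs, ht]
      clear hx hy hs ht
      induction x with
      | zero => simp
      | add x x' hx hx' => simp only [map_add, add_mul, Finset.sum_add_distrib, hx, hx']
      | tmul u v =>
        induction y with
        | zero => simp
        | add x x' hx hx' => simp only [map_add, mul_add, Finset.sum_add_distrib, hx, hx']
        | tmul u' v' =>
          simp only [Algebra.TensorProduct.tmul_mul_tmul, map_tmul, LinearMap.mul'_apply,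
            LinearMap.flip_apply, wordsPairing_mul, mul'_map_comul _ _ (ℛ K c),
            mul'_map_comul _ _ (ℛ K d), Finset.sum_mul_sum, Finset.sum_product]
          exact Finset.sum_congr rfl fun i _ => Finset.sum_congr rfl fun j _ => by ring
  | add s t hs ht =>
    obtain ⟨x, hx, hs⟩ := hs
    obtain ⟨y, hy, ht⟩ := ht
    exact ⟨x + y, by simp only [map_add, hx, hy], fun c d => by
      simp only [map_add, LinearMap.add_apply, hs, ht]⟩

theorem wordsPairing_i0 (h : IsHopfPairing φ₀) (t : TensorAlgebra K (H × M)) (g : H) :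
    wordsPairing φ₀ φ₁ t (i0 K H M g) = φ₀ (p0 K H M (wordsToCot K H M t)) g := by
  induction t using TensorAlgebra.induction generalizing g with
  | algebraMap r =>
    rw [wordsPairing_algebraMap, AlgHom.commutes, Algebra.algebraMap_eq_smul_one, map_smul, p0_one,
      map_smul, LinearMap.smul_apply, h.one_left, counit_eq, p0_i0]
    rfl
  | ι x =>
    obtain ⟨a, m⟩ := x
    simp [wordsPairing_ι, wordsToCot_ι, p1_i0, p0_i1]
  | mul s t hs ht =>
    rw [wordsPairing_mul, comul_i0, map_mul, p0_mul, h.mul_left,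
      TensorProduct.map_map]
    congr 3
    · exact LinearMap.ext hs
    · exact LinearMap.ext ht
  | add s t hs ht => simp only [map_add, LinearMap.add_apply, hs, ht]

theorem wordsPairing_i1 (h : IsCouplePairing φ₀ φ₁) (t : TensorAlgebra K (H × M)) (n : M) :
    wordsPairing φ₀ φ₁ t (i1 K H M n) = φ₁ (p1 K H M (wordsToCot K H M t)) n := by
  induction t using TensorAlgebra.induction generalizing n with
  | algebraMap r =>
    rw [wordsPairing_algebraMap, AlgHom.commutes, Algebra.algebraMap_eq_smul_one, map_smul, one_def,
      p1_i0, counit_eq, p0_i1]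
    simp
  | ι x =>
    obtain ⟨a, m⟩ := x
    simp [wordsPairing_ι, wordsToCot_ι, p1_i0, p1_i1, p0_i1]
  | mul s t hs ht =>
    have h0 : ∀ t, wordsPairing φ₀ φ₁ t ∘ₗ i0 K H M = φ₀ (p0 K H M (wordsToCot K H M t)) :=
      fun t => LinearMap.ext (wordsPairing_i0 h.isHopfPairing t)
    have hs : wordsPairing φ₀ φ₁ s ∘ₗ i1 K H M = _ := LinearMap.ext hs
    have ht : wordsPairing φ₀ φ₁ t ∘ₗ i1 K H M = _ := LinearMap.ext ht
    rw [wordsPairing_mul, comul_i1, map_mul, p1_mul, map_add, map_add, map_add, LinearMap.add_apply,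
      h.smul_left, h.op_smul_left]
    simp only [TensorProduct.map_map, h0, hs, ht]
  | add s t hs ht => simp only [map_add, LinearMap.add_apply, hs, ht]

/-- The adjunction which makes the pairing descend to the quantum symmetric algebra: pairing words
with the images of words is the same from either side. -/
theorem wordsPairing_wordsToCot (h : IsCouplePairing φ₀ φ₁) (s t : TensorAlgebra K (H × M)) :
    wordsPairing φ₀ φ₁ s (wordsToCot K H M t) =
      wordsPairing φ₀.flip φ₁.flip t (wordsToCot K H M s) := by
  induction t using TensorAlgebra.induction generalizing s with
  | algebraMap r =>
    rw [wordsPairing_algebraMap, AlgHom.commutes, Algebra.algebraMap_eq_smul_one, map_smul, one_def,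
      wordsPairing_i0 h.isHopfPairing, h.isHopfPairing.one_right]
    rfl
  | ι x =>
    obtain ⟨a, m⟩ := x
    rw [wordsToCot_ι, map_add, wordsPairing_i0 h.isHopfPairing, wordsPairing_i1 h, wordsPairing_ι]
    rfl
  | mul t t' ht ht' =>
    obtain ⟨z, hz, hm⟩ := exists_wordsPairing_mul_right h s
    rw [map_mul, hm, wordsPairing_mul, ← hz, TensorProduct.map_map]
    congr 3
    · exact LinearMap.ext ht
    · exact LinearMap.ext ht'
  | add t t' ht ht' => simp only [map_add, LinearMap.add_apply, ht, ht']

/-- An element of the cotensor Hopf algebra is determined by its pairings with words. This is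
proved along the filtration by degree: pairing with words starting with a letter from `M` reduces
the element `x` to contractions of `tau x`, which lie one step lower. -/
theorem eq_zero_of_wordsPairing (h₀ : φ₀.SeparatingRight) (h₁ : φ₁.SeparatingRight)
    {x : Cot K H M} (hx : ∀ t, wordsPairing φ₀ φ₁ t x = 0) : x = 0 := by
  have hp : ∀ x : Cot K H M, (∀ t, wordsPairing φ₀ φ₁ t x = 0) → p0 K H M x = 0 := fun x hx =>
    h₀ _ fun a => by simpa [wordsPairing_ι] using hx (TensorAlgebra.ι K (a, 0))
  obtain ⟨n, hn⟩ := isCompat.exh x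
  induction n generalizing x with
  | zero => exact eq_of_p0_tau (by rw [hp x hx, map_zero]) (by rw [isCompat.t_zero x hn, map_zero])
  | succ n ih =>
    refine eq_of_p0_tau (by rw [hp x hx, map_zero]) ?_
    rw [map_zero]
    refine eq_zero_of_contract (φ := φ₁.flip) (fun m hm => h₁ m hm) _ fun m => ih (fun t => ?_) ?_
    · have h := hx (TensorAlgebra.ι K ((0 : H), m) * t)
      rw [wordsPairing_mul, wordsPairing_ι_right, ← LinearMap.map_comp_rTensor,
        LinearMap.comp_apply, p1_rTensor_comul] at h
      rw [← h]
      generalize tau K H M x = z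
      induction z with
      | zero => simp
      | add x y hx hy => simp only [map_add, hx, hy]
      | tmul a b => simp
    · exact tens_induction (p := fun z => TensorProduct.lid K _ ((φ₁.flip.flip m).rTensor _ z) ∈
        fil K H M n) (isCompat.t_mem n x hn) (by simp)
        (fun a v hv => by simpa using Submodule.smul_mem _ _ hv)
        (fun x y hx hy => by simpa only [map_add] using add_mem hx hy)

variable (φ₀ φ₁) in
/-- The linear combinations of words which both represent an element of degree `n` of the cotensor
Hopf algebra and act as a functional concentrated in degree `n`. -/
noncomputable def wordsDegree (n : ℕ) : Submodule K (TensorAlgebra K (H × M)) where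
  carrier := {t | wordsToCot K H M t ∈ LinearMap.range (of K H M n) ∧
    ∀ k, k ≠ n → ∀ x ∈ LinearMap.range (of K H M k), wordsPairing φ₀ φ₁ t x = 0}
  zero_mem' := ⟨by rw [map_zero]; exact zero_mem _, fun k _ x _ => by
    rw [map_zero, LinearMap.zero_apply]⟩
  add_mem' {s t} hs ht := ⟨by rw [map_add]; exact add_mem hs.1 ht.1, fun k hk x hx => by
    rw [map_add, LinearMap.add_apply, hs.2 k hk x hx, ht.2 k hk x hx, add_zero]⟩
  smul_mem' r t ht := ⟨by rw [map_smul]; exact Submodule.smul_mem _ _ ht.1, fun k hk x hx => by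
    rw [map_smul, LinearMap.smul_apply, ht.2 k hk x hx, smul_zero]⟩

variable (φ₀ φ₁) in
theorem iSup_wordsDegree : ⨆ n, wordsDegree φ₀ φ₁ n = ⊤ := by
  refine iSup_eq_top_of_adjoin (s := Set.range (TensorAlgebra.ι K (M := H × M)))
    ⟨by rw [map_one]; exact ⟨(1 : H), rfl⟩, fun k hk x hx => ?_⟩ ?_ ?_ TensorAlgebra.adjoin_range_ι
  · rw [wordsPairing_one, counit_eq, p0_eq_zero hk hx, map_zero]
  · rintro i j s hs t ht
    exact ⟨by rw [map_mul]; exact mul_mem_range hs.1 ht.1, fun k hk x hx => by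
      rw [wordsPairing_mul, map_comul_eq_zero hs.2 ht.2 k hk x hx, map_zero]⟩
  · rintro _ ⟨⟨a, m⟩, rfl⟩
    rw [ι_eq_add]
    refine add_mem (Submodule.mem_iSup_of_mem 0 ⟨⟨a, ?_⟩, fun k hk x hx => ?_⟩)
      (Submodule.mem_iSup_of_mem 1 ⟨⟨m, ?_⟩, fun k hk x hx => ?_⟩)
    · rw [wordsToCot_ι, map_zero, add_zero]; rfl
    · rw [wordsPairing_ι_left, LinearMap.comp_apply, p0_eq_zero hk hx, map_zero]
    · rw [wordsToCot_ι, map_zero, zero_add]; rfl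
    · rw [wordsPairing_ι_right, LinearMap.comp_apply, p1_eq_zero hk hx, map_zero]

/-- A homogeneous element of the quantum symmetric algebra is represented by words of the same
degree. -/
theorem exists_mem_wordsDegree (t : TensorAlgebra K (H × M)) {n : ℕ}
    (ht : wordsToCot K H M t ∈ LinearMap.range (of K H M n)) :
    ∃ s ∈ wordsDegree φ₀ φ₁ n, wordsToCot K H M s = wordsToCot K H M t := by
  have h := (iSup_wordsDegree φ₀ φ₁).ge (Submodule.mem_top (x := t))
  obtain ⟨f, hf, hft⟩ := (Submodule.mem_iSup_iff_exists_finsupp _ _).1 h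
  have hc : ∀ {k} {x : Cot K H M}, x ∈ LinearMap.range (of K H M k) →
      of K H M n (comp K H M n x) = if k = n then x else 0 := by
    rintro k _ ⟨x, rfl⟩
    split_ifs with hk
    · subst hk; rw [comp_of_self]
    · rw [comp_of_ne hk, map_zero]
  refine ⟨f n, hf n, ?_⟩
  have h1 := hc ht
  rw [if_pos rfl] at h1
  rw [← h1, ← hft, Finsupp.sum]
  simp only [map_sum]
  rw [Finset.sum_congr rfl fun k _ => hc (hf k).1]
  rw [Finset.sum_ite_eq']
  split_ifs with h0
  · rfl
  · rw [Finsupp.notMem_support_iff.1 h0, map_zero]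

end Words

/-! ### From pairings of couples to pairings of quantum symmetric algebras -/

section SelfDual

variable {K : Type w} {H M : Type u} [Field K] [Ring H] [HopfAlgebra K H]
  [AddCommGroup M] [Module K M] [Module H M] [Module Hᵐᵒᵖ M]
  [IsScalarTower K H M] [IsScalarTower K Hᵐᵒᵖ M] [SMulCommClass H Hᵐᵒᵖ M]
  [HopfBimodule K H M]

open HopfBimodule Cot

theorem map_val_comul (x : quantumSymmetricAlgebra K H M) :
    TensorProduct.map (quantumSymmetricAlgebra K H M).val.toLinearMap
      (quantumSymmetricAlgebra K H M).val.toLinearMap (Coalgebra.comul (R := K) x) =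
      Coalgebra.comul (R := K) (x : Cot K H M) :=
  map_subComul isSubHopf_quantumSymmetricAlgebra x

theorem exists_wordsToCot_eq (x : quantumSymmetricAlgebra K H M) :
    ∃ t, wordsToCot K H M t = x := by
  have hx : (x : Cot K H M) ∈ (wordsToCot K H M).range := by
    rw [range_wordsToCot]
    exact x.2
  exact hx

theorem wordsToCot_mem (t : TensorAlgebra K (H × M)) :
    wordsToCot K H M t ∈ quantumSymmetricAlgebra K H M := by
  rw [← range_wordsToCot]
  exact ⟨t, rfl⟩

variable (K H M) in
/-- Words as elements of the quantum symmetric algebra. -/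
noncomputable def wordsToQSA : TensorAlgebra K (H × M) →ₐ[K] quantumSymmetricAlgebra K H M :=
  (wordsToCot K H M).codRestrict _ wordsToCot_mem

theorem wordsToQSA_surjective : Function.Surjective (wordsToQSA K H M) := fun x => by
  obtain ⟨t, ht⟩ := exists_wordsToCot_eq x
  exact ⟨t, Subtype.ext ht⟩

/-- The pairing of words with the cotensor Hopf algebra induces a pairing of the quantum symmetric
algebra with itself. -/
theorem exists_pairing {φ₀ : H →ₗ[K] H →ₗ[K] K} {φ₁ : M →ₗ[K] M →ₗ[K] K}
    (h : IsCouplePairing φ₀ φ₁) :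
    ∃ φ : quantumSymmetricAlgebra K H M →ₗ[K] quantumSymmetricAlgebra K H M →ₗ[K] K,
      (∀ t x, φ (wordsToQSA K H M t) x = wordsPairing φ₀ φ₁ t x) ∧
      ∀ t x, φ x (wordsToQSA K H M t) = wordsPairing φ₀.flip φ₁.flip t x := by
  -- Represent the first argument by an arbitrary linear choice of words; the adjunction shows that
  -- the result does not depend on it.
  obtain ⟨σ, hσ⟩ := (wordsToQSA K H M).toLinearMap.exists_rightInverse_of_surjective
    (LinearMap.range_eq_top.2 wordsToQSA_surjective)
  have hσ' : ∀ x, wordsToCot K H M (σ x) = x := fun x => congrArg Subtype.val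
    (LinearMap.congr_fun hσ x)
  have hr : ∀ t x, wordsPairing φ₀ φ₁ (σ x) (wordsToCot K H M t) =
      wordsPairing φ₀.flip φ₁.flip t x := fun t x => by
    rw [wordsPairing_wordsToCot h, hσ']
  refine ⟨((wordsPairing φ₀ φ₁).compl₂ (quantumSymmetricAlgebra K H M).val.toLinearMap) ∘ₗ σ,
    fun t x => ?_, fun t x => hr t x⟩
  obtain ⟨u, rfl⟩ := wordsToQSA_surjective x
  refine (hr u _).trans ?_
  exact (wordsPairing_wordsToCot h t u).symm

theorem IsSelfDualCouple.isGradedSelfDual (h : IsSelfDualCouple K H M) :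
    IsGradedSelfDual (quantumSymmetricAlgebra.degree K H M) := by
  obtain ⟨φ₀, φ₁, h, h₀, h₁⟩ := h
  obtain ⟨φ, hl, hr⟩ := exists_pairing h
  have one_left : ∀ b, φ 1 b = Coalgebra.counit (R := K) b := fun b => by
    rw [← map_one (wordsToQSA K H M), hl, wordsPairing_one]
    rfl
  have one_right : ∀ a, φ a 1 = Coalgebra.counit (R := K) a := fun a => by
    rw [← map_one (wordsToQSA K H M), hr, wordsPairing_one]
    rfl
  have mul_left : ∀ a a' b, φ (a * a') b =
      LinearMap.mul' K K (TensorProduct.map (φ a) (φ a') (Coalgebra.comul b)) := fun a a' b => by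
    obtain ⟨s, rfl⟩ := wordsToQSA_surjective a
    obtain ⟨t, rfl⟩ := wordsToQSA_surjective a'
    rw [← map_mul, hl, wordsPairing_mul, ← map_val_comul, TensorProduct.map_map]
    congr 3 <;> ext x <;> exact (hl _ _).symm
  have mul_right : ∀ a b c, φ a (b * c) = LinearMap.mul' K K
      (TensorProduct.map (φ.flip b) (φ.flip c) (Coalgebra.comul a)) := fun a b c => by
    obtain ⟨s, rfl⟩ := wordsToQSA_surjective b
    obtain ⟨t, rfl⟩ := wordsToQSA_surjective c
    rw [← map_mul, hr, wordsPairing_mul, ← map_val_comul, TensorProduct.map_map]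
    congr 3 <;> ext x <;> exact (hr _ _).symm
  refine ⟨φ, ⟨one_left, one_right, mul_right, mul_left,
    pairing_antipode one_left one_right mul_right mul_left⟩, fun i j hij a ha b hb => ?_,
    fun a ha => Subtype.ext ?_, fun b hb => Subtype.ext ?_⟩
  · obtain ⟨t, rfl⟩ := wordsToQSA_surjective b
    -- An element of degree `j` has a representative acting in degree `j` only.
    obtain ⟨s, hs, hst⟩ := exists_mem_wordsDegree (φ₀ := φ₀.flip) (φ₁ := φ₁.flip) t hb
    have : wordsToQSA K H M t = wordsToQSA K H M s := Subtype.ext hst.symm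
    rw [this, hr]
    exact hs.2 i hij a ha
  · exact eq_zero_of_wordsPairing (φ₀ := φ₀.flip) (φ₁ := φ₁.flip) h₀.1 h₁.1 fun t => by
      rw [← hr, ha]
  · exact eq_zero_of_wordsPairing h₀.2 h₁.2 fun t => by rw [← hl, hb]

/-! ### From pairings of quantum symmetric algebras to pairings of couples -/

variable (K H M) in
/-- The inclusion of `H` in the quantum symmetric algebra. -/
noncomputable def qsaInl : H →ₗ[K] quantumSymmetricAlgebra K H M :=
  (i0 K H M).codRestrict (Subalgebra.toSubmodule (quantumSymmetricAlgebra K H M)) i0_mem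

variable (K H M) in
/-- The inclusion of `M` in the quantum symmetric algebra. -/
noncomputable def qsaInr : M →ₗ[K] quantumSymmetricAlgebra K H M :=
  (i1 K H M).codRestrict (Subalgebra.toSubmodule (quantumSymmetricAlgebra K H M)) i1_mem

theorem val_comp_qsaInl : (quantumSymmetricAlgebra K H M).val.toLinearMap ∘ₗ qsaInl K H M =
    i0 K H M := rfl

theorem val_comp_qsaInr : (quantumSymmetricAlgebra K H M).val.toLinearMap ∘ₗ qsaInr K H M =
    i1 K H M := rfl

theorem qsaInl_injective : Function.Injective (qsaInl K H M) := fun a b h => by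
  rw [← p0_i0 (K := K) (H := H) (M := M) a, ← p0_i0 (K := K) (H := H) (M := M) b]
  exact congrArg (fun x => p0 K H M x.1) h

theorem qsaInr_injective : Function.Injective (qsaInr K H M) := fun a b h => by
  rw [← p1_i1 (K := K) (H := H) (M := M) a, ← p1_i1 (K := K) (H := H) (M := M) b]
  exact congrArg (fun x => p1 K H M x.1) h

theorem range_qsaInl : LinearMap.range (qsaInl K H M) =
    quantumSymmetricAlgebra.degree K H M 0 := by
  apply le_antisymm
  · rintro _ ⟨a, rfl⟩
    exact ⟨a, rfl⟩
  · rintro x ⟨a, ha⟩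
    exact ⟨a, Subtype.ext ha⟩

theorem range_qsaInr : LinearMap.range (qsaInr K H M) =
    quantumSymmetricAlgebra.degree K H M 1 := by
  apply le_antisymm
  · rintro _ ⟨a, rfl⟩
    exact ⟨a, rfl⟩
  · rintro x ⟨a, ha⟩
    exact ⟨a, Subtype.ext ha⟩

theorem comul_qsaInl (a : H) : Coalgebra.comul (R := K) (qsaInl K H M a) =
    TensorProduct.map (qsaInl K H M) (qsaInl K H M) (Coalgebra.comul (R := K) a) := by
  apply map_val_injective
  rw [map_val_comul, TensorProduct.map_map, val_comp_qsaInl]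
  exact comul_i0 K H M a

theorem comul_qsaInr (m : M) : Coalgebra.comul (R := K) (qsaInr K H M m) =
    TensorProduct.map (qsaInl K H M) (qsaInr K H M) (coactL m) +
    TensorProduct.map (qsaInr K H M) (qsaInl K H M) (coactR m) := by
  apply map_val_injective
  rw [map_val_comul, map_add, TensorProduct.map_map, TensorProduct.map_map, val_comp_qsaInl,
    val_comp_qsaInr]
  exact comul_i1 m

theorem qsaInl_mul (a b : H) : qsaInl K H M (a * b) = qsaInl K H M a * qsaInl K H M b :=
  Subtype.ext (i0_mul_i0 a b).symm

theorem qsaInr_smul (a : H) (m : M) : qsaInr K H M (a • m) = qsaInl K H M a * qsaInr K H M m :=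
  Subtype.ext (i0_mul_i1 a m).symm

theorem qsaInr_op_smul (a : H) (m : M) :
    qsaInr K H M (MulOpposite.op a • m) = qsaInr K H M m * qsaInl K H M a :=
  Subtype.ext (i1_mul_i0 m a).symm

variable (K H M) in
/-- The quantum symmetric algebra is the sum of its components. -/
theorem iSup_degree : ⨆ n, quantumSymmetricAlgebra.degree K H M n = ⊤ := by
  refine iSup_eq_top_of_adjoin ⟨(1 : H), rfl⟩ (fun i j a ha b hb => mul_mem_range ha hb) ?_
    (Algebra.adjoin_adjoin_coe_preimage (R := K)
      (s := Set.range (Cot.i0 K H M) ∪ Set.range (Cot.i1 K H M)))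
  rintro x (⟨a, ha⟩ | ⟨m, hm⟩)
  · exact Submodule.mem_iSup_of_mem 0 ⟨a, ha⟩
  · exact Submodule.mem_iSup_of_mem 1 ⟨m, hm⟩

/-- A graded non-degenerate pairing stays non-degenerate on each component. -/
theorem separatingLeft_component {V : Type*} [AddCommGroup V] [Module K V]
    {φ : quantumSymmetricAlgebra K H M →ₗ[K] quantumSymmetricAlgebra K H M →ₗ[K] K}
    (hφ : φ.SeparatingLeft)
    (ho : ∀ i j, i ≠ j → ∀ a ∈ quantumSymmetricAlgebra.degree K H M i,
      ∀ b ∈ quantumSymmetricAlgebra.degree K H M j, φ a b = 0)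
    {j : V →ₗ[K] quantumSymmetricAlgebra K H M} (hj : Function.Injective j) {n : ℕ}
    (hn : LinearMap.range j = quantumSymmetricAlgebra.degree K H M n) :
    (φ.compl₁₂ j j).SeparatingLeft := by
  intro v hv
  have hv' : φ (j v) = 0 := by
    ext x
    refine Submodule.iSup_induction _ (motive := fun x => φ (j v) x = 0)
      ((iSup_degree K H M).ge (Submodule.mem_top (x := x))) (fun i x hx => ?_) (map_zero _)
      (fun x y hx hy => by rw [map_add, hx, hy, add_zero])
    by_cases h : n = i
    · subst h
      rw [← hn] at hx
      obtain ⟨w, rfl⟩ := hx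
      exact hv w
    · exact ho n i h _ (hn ▸ ⟨v, rfl⟩) x hx
  exact hj ((hφ _ fun y => by rw [hv', LinearMap.zero_apply]).trans (map_zero j).symm)

/-- The two-sided module formula for the restriction of a graded pairing to `M`, read off from the
iterated comultiplication of an element of `M`. -/
theorem pairing_smul_op_smul
    {φ : quantumSymmetricAlgebra K H M →ₗ[K] quantumSymmetricAlgebra K H M →ₗ[K] K}
    (mul_left : ∀ a a' b, φ (a * a') b =
      LinearMap.mul' K K (TensorProduct.map (φ a) (φ a') (Coalgebra.comul b)))
    (h01 : ∀ a m, φ (qsaInl K H M a) (qsaInr K H M m) = 0)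
    (h10 : ∀ m a, φ (qsaInr K H M m) (qsaInl K H M a) = 0) (a g : H) (m n : M) :
    φ (qsaInr K H M (a • MulOpposite.op g • m)) (qsaInr K H M n) =
      LinearMap.mul' K K (TensorProduct.map (φ.compl₁₂ (qsaInl K H M) (qsaInl K H M) a)
        (LinearMap.mul' K K ∘ₗ TensorProduct.map (φ.compl₁₂ (qsaInr K H M) (qsaInr K H M) m)
          (φ.compl₁₂ (qsaInl K H M) (qsaInl K H M) g))
        ((coactR (K := K) (H := H)).lTensor H (coactL (K := K) (H := H) n))) := by
  have e01 : ∀ a, φ (qsaInl K H M a) ∘ₗ qsaInr K H M = 0 := fun a => LinearMap.ext (h01 a)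
  have e10 : ∀ m, φ (qsaInr K H M m) ∘ₗ qsaInl K H M = 0 := fun m => LinearMap.ext (h10 m)
  have hr : φ (qsaInr K H M m * qsaInl K H M g) ∘ₗ qsaInr K H M =
      (LinearMap.mul' K K ∘ₗ TensorProduct.map (φ.compl₁₂ (qsaInr K H M) (qsaInr K H M) m)
          (φ.compl₁₂ (qsaInl K H M) (qsaInl K H M) g)) ∘ₗ coactR (K := K) (H := H) := by
    ext n
    rw [LinearMap.comp_apply, mul_left, comul_qsaInr, map_add, TensorProduct.map_map,
      TensorProduct.map_map, e01, e10, TensorProduct.map_zero_left, LinearMap.zero_apply, zero_add]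
    rfl
  rw [qsaInr_smul, qsaInr_op_smul, mul_left, comul_qsaInr, map_add, TensorProduct.map_map,
    TensorProduct.map_map, e01, TensorProduct.map_zero_left, LinearMap.zero_apply, add_zero, hr,
    ← LinearMap.map_comp_lTensor]
  rfl

theorem IsGradedSelfDual.isSelfDualCouple
    (h : IsGradedSelfDual (quantumSymmetricAlgebra.degree K H M)) : IsSelfDualCouple K H M := by
  -- Restating the type makes the vector space structure of the subalgebra, instead of the one
  -- underlying the Hopf algebra structure, the one that later unifications meet.
  obtain ⟨φ, hφ, ho, hl, hr⟩ :
    ∃ φ : quantumSymmetricAlgebra K H M →ₗ[K] quantumSymmetricAlgebra K H M →ₗ[K] K,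
      IsHopfPairing φ ∧ (∀ i j, i ≠ j → ∀ a ∈ quantumSymmetricAlgebra.degree K H M i,
        ∀ b ∈ quantumSymmetricAlgebra.degree K H M j, φ a b = 0) ∧ φ.Nondegenerate := h
  have ho' : ∀ i j, i ≠ j → ∀ a ∈ quantumSymmetricAlgebra.degree K H M i,
      ∀ b ∈ quantumSymmetricAlgebra.degree K H M j, φ.flip a b = 0 :=
    fun i j hij a ha b hb => ho j i hij.symm b hb a ha
  have hr' : φ.flip.SeparatingLeft := fun a ha => hr a ha
  have h01 : ∀ a m, φ (qsaInl K H M a) (qsaInr K H M m) = 0 := fun a m =>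
    ho 0 1 zero_ne_one _ ⟨a, rfl⟩ _ ⟨m, rfl⟩
  have h10 : ∀ m a, φ (qsaInr K H M m) (qsaInl K H M a) = 0 := fun m a =>
    ho 1 0 one_ne_zero _ ⟨m, rfl⟩ _ ⟨a, rfl⟩
  have one_left : ∀ b, φ (qsaInl K H M 1) (qsaInl K H M b) = Coalgebra.counit (R := K) b := fun b =>
    (hφ.one_left (qsaInl K H M b)).trans (congrArg _ (p0_i0 (K := K) (H := H) (M := M) b))
  have one_right : ∀ b, φ (qsaInl K H M b) (qsaInl K H M 1) = Coalgebra.counit (R := K) b := fun b =>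
    (hφ.one_right (qsaInl K H M b)).trans (congrArg _ (p0_i0 (K := K) (H := H) (M := M) b))
  have mul_left : ∀ a a' b, φ.compl₁₂ (qsaInl K H M) (qsaInl K H M) (a * a') b =
      LinearMap.mul' K K (TensorProduct.map (φ.compl₁₂ (qsaInl K H M) (qsaInl K H M) a)
        (φ.compl₁₂ (qsaInl K H M) (qsaInl K H M) a') (Coalgebra.comul b)) := fun a a' b => by
    rw [LinearMap.compl₁₂_apply, qsaInl_mul, hφ.mul_left, comul_qsaInl, TensorProduct.map_map]
    rfl
  have mul_right : ∀ a b c, φ.compl₁₂ (qsaInl K H M) (qsaInl K H M) a (b * c) =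
      LinearMap.mul' K K (TensorProduct.map ((φ.compl₁₂ (qsaInl K H M) (qsaInl K H M)).flip b)
        ((φ.compl₁₂ (qsaInl K H M) (qsaInl K H M)).flip c) (Coalgebra.comul a)) := fun a b c => by
    rw [LinearMap.compl₁₂_apply, qsaInl_mul, hφ.mul_right, comul_qsaInl, TensorProduct.map_map]
    rfl
  have hopf : IsHopfPairing (φ.compl₁₂ (qsaInl K H M) (qsaInl K H M)) :=
    ⟨one_left, one_right, mul_right, mul_left,
      pairing_antipode one_left one_right mul_right mul_left⟩
  refine ⟨φ.compl₁₂ (qsaInl K H M) (qsaInl K H M), φ.compl₁₂ (qsaInr K H M) (qsaInr K H M),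
    ⟨hopf, ?_, ?_⟩,
    ⟨separatingLeft_component hl ho qsaInl_injective range_qsaInl, ?_⟩,
    ⟨separatingLeft_component hl ho qsaInr_injective range_qsaInr, ?_⟩⟩
  · exact fun a g m n => pairing_smul_op_smul hφ.mul_left h01 h10 a g m n
  · exact fun a g m n => pairing_smul_op_smul (φ := φ.flip) hφ.flip.mul_left (fun a m => h10 m a)
      (fun m a => h01 a m) a g n m
  · exact separatingLeft_component hr' ho' qsaInl_injective range_qsaInl
  · exact separatingLeft_component hr' ho' qsaInr_injective range_qsaInr

end SelfDual

end QuantumSymmetric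

theorem corollary3p7 {K : Type w} {H M : Type u} [Field K] [Ring H] [HopfAlgebra K H]
    [AddCommGroup M] [Module K M] [Module H M] [Module Hᵐᵒᵖ M]
    [IsScalarTower K H M] [IsScalarTower K Hᵐᵒᵖ M] [SMulCommClass H Hᵐᵒᵖ M]
    [QuantumSymmetric.HopfBimodule K H M] :
    QuantumSymmetric.IsGradedSelfDual (QuantumSymmetric.quantumSymmetricAlgebra.degree K H M) ↔
      QuantumSymmetric.IsSelfDualCouple K H M :=
  ⟨QuantumSymmetric.IsGradedSelfDual.isSelfDualCouple,
    QuantumSymmetric.IsSelfDualCouple.isGradedSelfDual⟩
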